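/- **Setting.** Fix $n\ge 1$, $\tau>0$, constants $P_1,P_2\in\mathbb R$ and a real function $a\in L_1[0,\infty)$; put $A(\lambda)=\int_0^\infty a(t)e^{-i\lambda t}dt$. Let $\mathcal D_f^0$ (resp. $\mathcal D_g^0$) be the set of integrable densities $f\ge0$ with $\frac1{2\pi}\int f\,d\lambda\le P_1$ (resp. $g\ge 0$ with $\frac1{2\pi}\int g\,d\lambda\le P_2$), and $\mathcal D=\mathcal D^0_f\times\mathcal D^0_g$. A process $\xi(t)$, $t\in\mathbb R$, has mean-zero stationary $n$th increments $\xi^{(n)}(t,\tau)=\sum_{l=0}^n(-1)^l\binom nl\xi(t-l\tau)$ with spectral density $f$, that is, $$\mathsf E\,\xi^{(n)}(s+t,\tau_1)\overline{\xi^{(n)}(s,\tau_2)}=\frac1{2\pi}\int e^{i\lambda t}(1-e^{-i\tau_1\lambda})^n(1-e^{i\tau_2\lambda})^n\frac{(1+\lambda^2)^n}{\lambda^{2n}}f(\lambda)\,d\lambda ,$$ and $\eta(t)$ is a mean-zero stationary process with spectral density $g$, $\mathsf E\,\eta(s+t)\overline{\eta(s)}=\frac1{2\pi}\int e^{i\lambda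 t}g(\lambda)d\lambda$, uncorrelated with the increments of $\xi$. Filtering of $A\xi=\int_0^\infty a(t)\xi(-t)dt$ from the observations $\zeta=\xi+\eta$ at times $t\le0$ means to estimate $A\eta=\int_0^\infty a(t)\eta(-t)dt$ by elements of the closed linear span $H^0$ of $\zeta^{(n)}(t,\tau)$, $t\le 0$. Write $$p=f+\frac{\lambda^{2n}}{(1+\lambda^2)^n}g,\qquad d=(1+\lambda^2)^nf+\lambda^{2n}g ,$$ and let $L_2^0(p)$ be the closed linear span in $L_2(p)$ of the functions $e^{i\lambda t}(1-e^{-i\lambda\tau})^n\frac{(1+i\lambda)^n}{(i\lambda)^n}$, $t\le0$; it is isometric (up to the factor $2\pi$) to $H^0$, these functions corresponding to $\zeta^{(n)}(t,\tau)$. The estimate with spectral characteristic $h\in L_2^0(p)$ has mean-square error $$\Delta(h;f,g)=\frac1{2\pi}\int\Big|A(\lambda)-h(\lambda)\frac{(i\lambda)^n}{(1+i\lambda)^n}\Big|^2g(\lambda)\,d\lambda+\frac1{2\pi}\int|h(\lambda)|^2f(\lambda)\,d\lambda ,$$ and $\Delta(f,g)=\min_{h\in L_2^0(p)}\Delta(h;f,g)$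 is the error of the optimal estimate. Densities $(f^0,g^0)\in\mathcal D$ are *least favorable* if $\Delta(f^0,g^0)=\max_{\mathcal D}\Delta(f,g)$. With $H_{\mathcal D}=\bigcap_{(f,g)\in\mathcal D}L_2^0(p)$, $h^0\in H_{\mathcal D}$ is a *minimax (robust) spectral characteristic* if $\max_{(f,g)\in\mathcal D}\Delta(h^0;f,g)=\min_{h\in H_{\mathcal D}}\sup_{(f,g)\in\mathcal D}\Delta(h;f,g)<\infty$. *Minimality.* $(f,g)$ is minimal if there is a non-zero entire function $\gamma$ of exponential type with $\gamma(\lambda)=\int_0^\infty\alpha(t)e^{i\lambda t}dt$ for real $\lambda$ and some $\alpha\in L_1[0,\infty)$, such that $\int\frac{|\gamma|^2}{p}d\lambda<\infty$ and $\int\frac{|\gamma|^2\lambda^{2n}}{|1-e^{i\lambda\tau}|^{2n}(1+\lambda^2)^np}d\lambda<\infty$. *Operators.* For $t\ge-\tau n$ let $\mathbf a_\tau(t)=\sum_{l=\max\{0,\lceil -t/\tau\rceil\}}^{n}(-1)^l\binom nl a(t+\tau l)$ and let $P,S,Q$ be the operators $$(P y)(s)=\int_0^\infty y(t)\int e^{i\lambda(t-s)}w(\lambda)\,d\lambda\,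 dt,\qquad (S x)(s)=\int_{-\tau n}^\infty x(t)\int e^{-i\lambda(t+s)}w(\lambda)g(\lambda)\,d\lambda\, dt,$$ $$(Qz)(s)=\int_0^\infty z(t)\int e^{i\lambda(t-s)}\frac{(1+\lambda^2)^nf(\lambda)g(\lambda)}{d(\lambda)}\,d\lambda\, dt,\qquad w(\lambda)=\frac{\lambda^{2n}}{|1-e^{i\lambda\tau}|^{2n}d(\lambda)},\quad s\ge0 .$$ Here $P$ and $S\mathbf a_\tau$ are understood through their forms $\langle Py,z\rangle=\int wY\overline Z\,d\lambda$ and $\langle S\mathbf a_\tau,z\rangle=\int wg\,\widehat{\mathbf a}_\tau\overline Z\,d\lambda$, $\widehat{\mathbf a}_\tau(\lambda)=\int_{-\tau n}^\infty\mathbf a_\tau(t)e^{-i\lambda t}dt$, on the energy space of $P$: the functions $y(t)=\frac1{2\pi}\int Y(\lambda)e^{-i\lambda t}d\lambda$, with integrable spectrum $Y$, which vanish for $t\le0$ and satisfy $\int w|Y|^2d\lambda<\infty$. The function $P^{-1}S\mathbf a_\tau$ is the element $c$ of this space with $\langle Pc,z\rangle=\langle S\mathbf a_\tau,z\rangle$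 for all its elements $z$; $C(\lambda)=\int_0^\infty c(t)e^{i\lambda t}dt$ denotes its spectrum. The formula for the spectral characteristic is $$h_\tau(f,g)=\frac{A(\lambda)(1+i\lambda)^n(-i\lambda)^ng(\lambda)}{d(\lambda)}-\frac{(1+i\lambda)^n(-i\lambda)^nC(\lambda)}{(1-e^{i\lambda\tau})^nd(\lambda)} .\tag{1}$$ **Theorem.** Let $\int_0^\infty|\mathbf a_\tau(t-\tau n)|dt<\infty$ and $\int_0^\infty t|\mathbf a_\tau(t-\tau n)|^2dt<\infty$. Let $f^0\in\mathcal D^0_f$, $g^0\in\mathcal D_g^0$ be minimal, let $p^0,d^0,C^0$ be the functions $p,d,C$ for $(f^0,g^0)$, and let $$h_{\tau,f}=\frac{|A(1-e^{i\lambda\tau})^n(-i\lambda)^ng^0-(-i\lambda)^nC^0|}{|1-e^{i\lambda\tau}|^n|1+i\lambda|^np^0},\qquad h_{\tau,g}=\frac{|A(1-e^{i\lambda\tau})^n(1+\lambda^2)^nf^0+\lambda^{2n}C^0|}{|1-e^{i\lambda\tau}|^n(1+\lambda^2)^np^0}$$ be (essentially) bounded. Suppose that, for some constants $\alpha_1,\alpha_2\ge0$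 and almost all $\lambda$, $$|A(1-e^{i\lambda\tau})^n(1+\lambda^2)^nf^0+\lambda^{2n}C^0|=\alpha_1|1-e^{i\lambda\tau}|^n d^0,$$ $$|A(1-e^{i\lambda\tau})^n(-i\lambda)^ng^0-(-i\lambda)^nC^0|=\alpha_2|1-e^{i\lambda\tau}|^n|1-i\lambda|^{-n}d^0,$$ and that $(f^0,g^0)$ solves the extremum problem $$\langle S\mathbf a_\tau,P^{-1}S\mathbf a_\tau\rangle+\langle Qa,a\rangle\to\max$$ over the minimal pairs $(f,g)\in\mathcal D$. Then $f^0,g^0$ are least favorable in $\mathcal D$ for the optimal linear filtering of $A\xi$; $h_\tau(f^0,g^0)$ given by (1) is the spectral characteristic of the optimal estimate for $(f^0,g^0)$, belongs to $H_{\mathcal D}$ and is a minimax spectral characteristic, with $\max_{(f,g)\in\mathcal D}\Delta(h_\tau(f^0,g^0);f,g)=\Delta(f^0,g^0)$. Moreover, for all $(f,g)\in\mathcal D$ and all processes $\xi,\eta$ with spectral densities $f,g$ as above, $\Delta(f,g)$ is the minimum of $\mathsf E|A\eta-X|^2$ over $X\in H^0$, and for each $h\in L_2^0(p)$ the estimate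 $X\in H^0$ with spectral characteristic $h$ exists and satisfies $\mathsf E|A\eta-X|^2=\Delta(h;f,g)$. -/

import Mathlib

open MeasureTheory Complex ComplexConjugate
open scoped ENNReal

namespace IncrementFiltering

noncomputable section

/-! ### Spectral densities and elementary functions of the frequency `x` -/

/-- `A(x) = ∫₀^∞ a(t) e^{-ixt} dt`. -/
def specA (a : ℝ → ℝ) (x : ℝ) : ℂ :=
  ∫ t in Set.Ioi (0 : ℝ), (a t : ℂ) * exp (-(I * x * t))

/-- `1 - e^{ixτ}`. -/
def stepFactor (τ x : ℝ) : ℂ := 1 - exp (I * x * τ)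

/-- `(ix)^n / (1 + ix)^n`. -/
def incRatio (n : ℕ) (x : ℝ) : ℂ := (I * x) ^ n / (1 + I * x) ^ n

/-- Spectral density of the observed increments,
`p(x) = f(x) + x^{2n} (1 + x²)^{-n} g(x)`. -/
def obsDensity (n : ℕ) (f g : ℝ → ℝ) (x : ℝ) : ℝ :=
  f x + x ^ (2 * n) / (1 + x ^ 2) ^ n * g x

/-- `(1 + x²)^n f(x) + x^{2n} g(x)`. -/
def commonDenom (n : ℕ) (f g : ℝ → ℝ) (x : ℝ) : ℝ :=
  (1 + x ^ 2) ^ n * f x + x ^ (2 * n) * g x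

/-- Spectral densities of total power `(2π)⁻¹ ∫ f ≤ P`. -/
def PowerClass (P : ℝ) : Set (ℝ → ℝ) :=
  {f | Measurable f ∧ (∀ x, 0 ≤ f x) ∧ Integrable f ∧ (2 * Real.pi)⁻¹ * ∫ x, f x ≤ P}

/-- The minimality conditions: for a non-zero (entire) function `γ` of exponential type which is
on the real line of the form `γ(x) = ∫₀^∞ α(t) e^{ixt} dt`,
`∫ |γ|² / p < ∞` and `∫ |γ|² x^{2n} / (|1 - e^{ixτ}|^{2n} (1 + x²)^n p) < ∞`. The integrals are
taken in `[0, ∞]`, so that they are infinite if `p` vanishes where `γ` does not. -/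
def IsMinimal (n : ℕ) (τ : ℝ) (f g : ℝ → ℝ) : Prop :=
  ∃ (γ : ℂ → ℂ) (α : ℝ → ℂ),
    γ ≠ 0 ∧ Differentiable ℂ γ ∧ (∃ K σ : ℝ, ∀ z, ‖γ z‖ ≤ K * Real.exp (σ * ‖z‖)) ∧
    IntegrableOn α (Set.Ioi 0) ∧
    (∀ x : ℝ, γ x = ∫ t in Set.Ioi (0 : ℝ), α t * exp (I * x * t)) ∧
    (∫⁻ x : ℝ, ENNReal.ofReal (‖γ x‖ ^ 2) / ENNReal.ofReal (obsDensity n f g x)) < ∞ ∧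
    (∫⁻ x : ℝ, ENNReal.ofReal (‖γ x‖ ^ 2 * x ^ (2 * n)) /
      ENNReal.ofReal (‖stepFactor τ x‖ ^ (2 * n) * (1 + x ^ 2) ^ n * obsDensity n f g x)) < ∞

/-! ### The function `a_τ` -/

/-- `a_τ(t) = ∑_{l = max(0, ⌈-t/τ⌉)}^{n} (-1)^l C(n,l) a(t + τ l)`, used for `t ≥ -τ n`. -/
def aTau (n : ℕ) (τ : ℝ) (a : ℝ → ℝ) (t : ℝ) : ℝ :=
  ∑ l ∈ Finset.Icc ⌈-t / τ⌉.toNat n,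
    (n.choose l : ℝ) * (-1) ^ l * a (t + τ * l)

/-- `∫₀^∞ |a_τ(t - τn)| dt < ∞` and `∫₀^∞ t |a_τ(t - τn)|² dt < ∞`. -/
def ATauCondition (n : ℕ) (τ : ℝ) (a : ℝ → ℝ) : Prop :=
  IntegrableOn (fun t => |aTau n τ a (t - τ * n)|) (Set.Ioi 0) ∧
  IntegrableOn (fun t => t * |aTau n τ a (t - τ * n)| ^ 2) (Set.Ioi 0)

/-- `∫_{-τn}^∞ a_τ(t) e^{-ixt} dt`. -/
def aTauSpec (n : ℕ) (τ : ℝ) (a : ℝ → ℝ) (x : ℝ) : ℂ :=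
  ∫ t in Set.Ioi (-(τ * n)), (aTau n τ a t : ℂ) * exp (-(I * x * t))

/-! ### The operators `P`, `S`, `Q`

`P` is the positive operator on functions `y` on the half-line `[0, ∞)` with the kernel
`∫ e^{ix(t-s)} w(x) dx`, where `w` is the symbol `symP`. As `w` is never integrable (the densities
are), `P` is unbounded and is given by its quadratic form `⟨P y, z⟩ = ∫ w Y conj Z`, where
`Y(x) = ∫₀^∞ y(t) e^{ixt} dt`, on the space of those `y` for which `⟨P y, y⟩ = ∫ w |Y|²` is
finite. Functions on the half-line are represented by their spectra `Y`. -/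

/-- The symbol of `P`. -/
def symP (n : ℕ) (τ : ℝ) (f g : ℝ → ℝ) (x : ℝ) : ℝ :=
  x ^ (2 * n) / (‖stepFactor τ x‖ ^ (2 * n) * commonDenom n f g x)

/-- The symbol of `S`. -/
def symS (n : ℕ) (τ : ℝ) (f g : ℝ → ℝ) (x : ℝ) : ℝ :=
  x ^ (2 * n) * g x / (‖stepFactor τ x‖ ^ (2 * n) * commonDenom n f g x)

/-- The symbol of `Q`. -/
def symQ (n : ℕ) (f g : ℝ → ℝ) (x : ℝ) : ℝ :=
  (1 + x ^ 2) ^ n * f x * g x / commonDenom n f g x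

/-- The function `y(t) = (2π)⁻¹ ∫ Y(x) e^{-ixt} dx` whose spectrum is `Y`. -/
def timeFunction (Y : ℝ → ℂ) (t : ℝ) : ℂ :=
  (2 * Real.pi : ℂ)⁻¹ * ∫ x : ℝ, Y x * exp (-(I * x * t))

/-- The energy space of `P`: spectra `Y(x) = ∫₀^∞ y(t) e^{ixt} dt` of functions `y` that vanish
on `(-∞, 0]`, with `⟨P y, y⟩ < ∞`. -/
structure InEnergySpace (n : ℕ) (τ : ℝ) (f g : ℝ → ℝ) (Y : ℝ → ℂ) : Prop where
  integrable : Integrable Y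
  causal : ∀ t ≤ 0, timeFunction Y t = 0
  energy : Integrable (fun x => symP n τ f g x * ‖Y x‖ ^ 2)

/-- `⟨P y, z⟩` in terms of the spectra of `y` and `z`. -/
def formP (n : ℕ) (τ : ℝ) (f g : ℝ → ℝ) (Y Z : ℝ → ℂ) : ℂ :=
  ∫ x, (symP n τ f g x : ℂ) * Y x * conj (Z x)

/-- `⟨S a_τ, z⟩` in terms of the spectrum of `z`, where
`(S a_τ)(s) = ∫_{-τn}^∞ a_τ(t) ∫ e^{-ix(t+s)} symS(x) dx dt`. -/
def formS (n : ℕ) (τ : ℝ) (a : ℝ → ℝ) (f g : ℝ → ℝ) (Z : ℝ → ℂ) : ℂ :=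
  ∫ x, (symS n τ f g x : ℂ) * aTauSpec n τ a x * conj (Z x)

/-- `(Q a)(s) = ∫₀^∞ a(t) ∫ e^{ix(t-s)} symQ(x) dx dt`. -/
def opQ (n : ℕ) (a : ℝ → ℝ) (f g : ℝ → ℝ) (s : ℝ) : ℂ :=
  ∫ t in Set.Ioi (0 : ℝ), (a t : ℂ) * ∫ x : ℝ, exp (I * x * (t - s)) * (symQ n f g x : ℂ)

/-- `⟨Q a, a⟩`. -/
def formQ (n : ℕ) (a : ℝ → ℝ) (f g : ℝ → ℝ) : ℂ :=
  ∫ s in Set.Ioi (0 : ℝ), opQ n a f g s * (a s : ℂ)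

/-- `C` is the spectrum `C(x) = ∫₀^∞ c(t) e^{ixt} dt` of `c = P⁻¹ S a_τ`, that is, of the
solution of the equation `P c = S a_τ` on `[0, ∞)`. -/
def IsInverseImage (n : ℕ) (τ : ℝ) (a : ℝ → ℝ) (f g : ℝ → ℝ) (C : ℝ → ℂ) : Prop :=
  InEnergySpace n τ f g C ∧
    ∀ Z, InEnergySpace n τ f g Z → formP n τ f g C Z = formS n τ a f g Z

/-- `⟨S a_τ, P⁻¹ S a_τ⟩ + ⟨Q a, a⟩`, where `C` is the spectrum of `P⁻¹ S a_τ`. -/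
def errorValue (n : ℕ) (τ : ℝ) (a : ℝ → ℝ) (f g : ℝ → ℝ) (C : ℝ → ℂ) : ℝ :=
  (formS n τ a f g C + formQ n a f g).re

/-- The densities `f0`, `g0` (with `C0` the spectrum of `P⁻¹ S a_τ` for `f0`, `g0`) solve the
extremum problem `⟨S a_τ, P⁻¹ S a_τ⟩ + ⟨Q a, a⟩ → max` over the densities of the class
`Df × Dg` that satisfy the minimality conditions. -/
def SolvesExtremumProblem (n : ℕ) (τ : ℝ) (a : ℝ → ℝ) (Df Dg : Set (ℝ → ℝ)) (f0 g0 : ℝ → ℝ)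
    (C0 : ℝ → ℂ) : Prop :=
  ∀ f ∈ Df, ∀ g ∈ Dg, IsMinimal n τ f g → ∀ C, IsInverseImage n τ a f g C →
    errorValue n τ a f g C ≤ errorValue n τ a f0 g0 C0

/-! ### Spectral characteristic -/

/-- The spectral characteristic `h_τ(f, g)`. -/
def hTau (n : ℕ) (τ : ℝ) (a : ℝ → ℝ) (f g : ℝ → ℝ) (C : ℝ → ℂ) (x : ℝ) : ℂ :=
  specA a x * (1 + I * x) ^ n * (-(I * x)) ^ n * g x / commonDenom n f g x
    - (1 + I * x) ^ n * (-(I * x)) ^ n * C x / (stepFactor τ x ^ n * commonDenom n f g x)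

/-- `|A (1 - e^{ixτ})^n (-ix)^n g - (-ix)^n C|`. -/
def numF (n : ℕ) (τ : ℝ) (a : ℝ → ℝ) (g : ℝ → ℝ) (C : ℝ → ℂ) (x : ℝ) : ℝ :=
  ‖specA a x * stepFactor τ x ^ n * (-(I * x)) ^ n * g x - (-(I * x)) ^ n * C x‖

/-- `|A (1 - e^{ixτ})^n (1 + x²)^n f + x^{2n} C|`. -/
def numG (n : ℕ) (τ : ℝ) (a : ℝ → ℝ) (f : ℝ → ℝ) (C : ℝ → ℂ) (x : ℝ) : ℝ :=
  ‖specA a x * stepFactor τ x ^ n * (1 + (x : ℂ) ^ 2) ^ n * f x + (x : ℂ) ^ (2 * n) * C x‖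

/-- `h_{τ,f}(f, g)`. -/
def hTauF (n : ℕ) (τ : ℝ) (a : ℝ → ℝ) (f g : ℝ → ℝ) (C : ℝ → ℂ) (x : ℝ) : ℝ :=
  numF n τ a g C x / (‖stepFactor τ x‖ ^ n * ‖1 + I * x‖ ^ n * obsDensity n f g x)

/-- `h_{τ,g}(f, g)`. -/
def hTauG (n : ℕ) (τ : ℝ) (a : ℝ → ℝ) (f g : ℝ → ℝ) (C : ℝ → ℂ) (x : ℝ) : ℝ :=
  numG n τ a f C x / (‖stepFactor τ x‖ ^ n * (1 + x ^ 2) ^ n * obsDensity n f g x)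

/-- Essential boundedness. -/
def EssBounded (u : ℝ → ℝ) : Prop := ∃ K : ℝ, ∀ᵐ x : ℝ, |u x| ≤ K

/-! ### Linear estimates and their mean-square errors -/

/-- The functions `e^{ixt} (1 - e^{-ixτ})^n (1 + ix)^n / (ix)^n`. -/
def obsFunction (n : ℕ) (τ t : ℝ) (x : ℝ) : ℂ :=
  exp (I * x * t) * (1 - exp (-(I * x * τ))) ^ n * ((1 + I * x) ^ n / (I * x) ^ n)

/-- `∫ |u|² p dx`. -/
def sqNormObs (n : ℕ) (f g : ℝ → ℝ) (u : ℝ → ℂ) : ℝ≥0∞ :=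
  ∫⁻ x, ENNReal.ofReal (‖u x‖ ^ 2 * obsDensity n f g x)

/-- The closed linear span `L₂⁰(p)` in `L₂(p)` of the functions `obsFunction n τ t`, `t ≤ 0`. -/
def L20 (n : ℕ) (τ : ℝ) (f g : ℝ → ℝ) : Set (ℝ → ℂ) :=
  {h | AEStronglyMeasurable h ∧ sqNormObs n f g h < ∞ ∧
    ∀ ε : ℝ≥0∞, 0 < ε → ∃ c : ℝ →₀ ℂ, (∀ t ∈ c.support, t ≤ 0) ∧
      sqNormObs n f g (fun x => h x - c.sum fun t z => z * obsFunction n τ t x) < ε}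

/-- `H_D`, the intersection of the spaces `L₂⁰(p)` over the class `Df × Dg`. -/
def admissible (n : ℕ) (τ : ℝ) (Df Dg : Set (ℝ → ℝ)) : Set (ℝ → ℂ) :=
  {h | ∀ f ∈ Df, ∀ g ∈ Dg, h ∈ L20 n τ f g}

/-- The mean-square error `Δ(h; f, g)` of the linear estimate with spectral characteristic `h`. -/
def mse (n : ℕ) (a : ℝ → ℝ) (h : ℝ → ℂ) (f g : ℝ → ℝ) : ℝ≥0∞ :=
  ENNReal.ofReal (2 * Real.pi)⁻¹ *
    ((∫⁻ x, ENNReal.ofReal (‖specA a x - h x * incRatio n x‖ ^ 2 * g x)) +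
      ∫⁻ x, ENNReal.ofReal (‖h x‖ ^ 2 * f x))

/-- The mean-square error `Δ(f, g)` of the optimal linear estimate. -/
def optMse (n : ℕ) (τ : ℝ) (a : ℝ → ℝ) (f g : ℝ → ℝ) : ℝ≥0∞ :=
  ⨅ h ∈ L20 n τ f g, mse n a h f g

/-- `h` is the spectral characteristic of the optimal linear estimate. -/
def IsOptimal (n : ℕ) (τ : ℝ) (a : ℝ → ℝ) (f g : ℝ → ℝ) (h : ℝ → ℂ) : Prop :=
  h ∈ L20 n τ f g ∧ mse n a h f g = optMse n τ a f g

/-- `f0`, `g0` are least favorable in the class `Df × Dg`. -/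
def IsLeastFavorable (n : ℕ) (τ : ℝ) (a : ℝ → ℝ) (Df Dg : Set (ℝ → ℝ)) (f0 g0 : ℝ → ℝ) : Prop :=
  f0 ∈ Df ∧ g0 ∈ Dg ∧ ∀ f ∈ Df, ∀ g ∈ Dg, optMse n τ a f g ≤ optMse n τ a f0 g0

/-- The worst mean-square error of `h` over the class. -/
def worstMse (n : ℕ) (a : ℝ → ℝ) (Df Dg : Set (ℝ → ℝ)) (h : ℝ → ℂ) : ℝ≥0∞ :=
  ⨆ f ∈ Df, ⨆ g ∈ Dg, mse n a h f g

/-- `h` is a minimax-robust spectral characteristic for the class `Df × Dg`: its worst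
mean-square error is a finite maximum, and no element of `H_D` has a smaller one. -/
def IsMinimaxRobust (n : ℕ) (τ : ℝ) (a : ℝ → ℝ) (Df Dg : Set (ℝ → ℝ)) (h : ℝ → ℂ) : Prop :=
  h ∈ admissible n τ Df Dg ∧
  worstMse n a Df Dg h < ∞ ∧
  (∃ f ∈ Df, ∃ g ∈ Dg, mse n a h f g = worstMse n a Df Dg h) ∧
  ∀ h' ∈ admissible n τ Df Dg, worstMse n a Df Dg h ≤ worstMse n a Df Dg h'

/-! ### The random processes -/

/-- The `n`th increment `X^{(n)}(t, τ) = ∑_l (-1)^l C(n,l) X(t - lτ)`. -/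
def increment {Ω : Type*} (n : ℕ) (X : ℝ → Ω → ℂ) (t τ : ℝ) (ω : Ω) : ℂ :=
  ∑ l ∈ Finset.range (n + 1), (-1) ^ l * (n.choose l : ℂ) * X (t - l * τ) ω

/-- `ξ` has stationary `n`th increments with mean zero and spectral density `f`, `η` is stationary
with mean zero and spectral density `g`, and they are uncorrelated (spectral densities are with
respect to `dx / 2π`). -/
structure IsSignalNoise {Ω : Type*} [MeasurableSpace Ω] (n : ℕ) (f g : ℝ → ℝ) (μ : Measure Ω)
    (ξ η : ℝ → Ω → ℂ) : Prop where
  signal_memLp : ∀ t τ, MemLp (increment n ξ t τ) 2 μ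
  noise_memLp : ∀ t, MemLp (η t) 2 μ
  signal_mean : ∀ t τ, ∫ ω, increment n ξ t τ ω ∂μ = 0
  noise_mean : ∀ t, ∫ ω, η t ω ∂μ = 0
  structural : ∀ s t τ₁ τ₂ : ℝ,
    ∫ ω, increment n ξ (s + t) τ₁ ω * conj (increment n ξ s τ₂ ω) ∂μ =
      (2 * Real.pi : ℂ)⁻¹ * ∫ x : ℝ, exp (I * x * t) * (1 - exp (-(I * x * τ₁))) ^ n *
        (1 - exp (I * x * τ₂)) ^ n * ((1 + (x : ℂ) ^ 2) ^ n / (x : ℂ) ^ (2 * n)) * f x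
  covariance : ∀ s t : ℝ,
    ∫ ω, η (s + t) ω * conj (η s ω) ∂μ =
      (2 * Real.pi : ℂ)⁻¹ * ∫ x : ℝ, exp (I * x * t) * g x
  uncorrelated : ∀ s t τ, ∫ ω, increment n ξ t τ ω * conj (η s ω) ∂μ = 0

/-- The observed process `ζ = ξ + η`. -/
def observed {Ω : Type*} (ξ η : ℝ → Ω → ℂ) (t : ℝ) (ω : Ω) : ℂ := ξ t ω + η t ω

/-- The closed linear span in `L₂(Ω)` of the increments `ζ^{(n)}(t, τ)`, `t ≤ 0`. -/
def obsSpace {Ω : Type*} [MeasurableSpace Ω] (n : ℕ) (τ : ℝ) (μ : Measure Ω) (ξ η : ℝ → Ω → ℂ) :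
    Submodule ℂ (Lp ℂ 2 μ) :=
  (Submodule.span ℂ {Y : Lp ℂ 2 μ | ∃ t : ℝ, t ≤ 0 ∧
    (Y : Ω → ℂ) =ᵐ[μ] increment n (observed ξ η) t τ}).topologicalClosure

/-- `Y = Aη = ∫₀^∞ a(t) η(-t) dt`, as an integral in `L₂(Ω)`. -/
def IsNoiseFunctional {Ω : Type*} [MeasurableSpace Ω] (a : ℝ → ℝ) (μ : Measure Ω) (η : ℝ → Ω → ℂ)
    (Y : Lp ℂ 2 μ) : Prop :=
  ∃ N : ℝ → Lp ℂ 2 μ, (∀ t, (N t : Ω → ℂ) =ᵐ[μ] η t) ∧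
    IntegrableOn (fun t => (a t : ℂ) • N (-t)) (Set.Ioi 0) ∧
    Y = ∫ t in Set.Ioi (0 : ℝ), (a t : ℂ) • N (-t)

/-- `X` is the linear estimate with spectral characteristic `h`: it corresponds to `h` under the
isometry between the closed spans which takes `obsFunction n τ t` to `ζ^{(n)}(t, τ)`, `t ≤ 0`. -/
def HasSpectralCharacteristic {Ω : Type*} [MeasurableSpace Ω] (n : ℕ) (τ : ℝ) (f g : ℝ → ℝ)
    (μ : Measure Ω) (ξ η : ℝ → Ω → ℂ) (h : ℝ → ℂ) (X : Lp ℂ 2 μ) : Prop :=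
  ∀ ε : ℝ≥0∞, 0 < ε → ∃ c : ℝ →₀ ℂ, (∀ t ∈ c.support, t ≤ 0) ∧
    sqNormObs n f g (fun x => h x - c.sum fun t z => z * obsFunction n τ t x) < ε ∧
    eLpNorm (fun ω => X ω - c.sum fun t z => z * increment n (observed ξ η) t τ ω) 2 μ < ε

end

end IncrementFiltering

/-!
Write `p` for the density `obsDensity`, `r` for `incRatio`, so that `|r| ≤ 1` and
`p = f + |r|² g`, and `b` for the generating function `obsFunction n τ 0`, which is bounded.

**The error is a distance.** Completing the square (`sq_error_eq`, `mse_eq`), `2π Δ(h; f, g)` is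
`∫ |A|² f g / p`, which does not depend on `h`, plus the squared distance in `L₂(p)` between `h` and
the target function `A g conj r / p`. Hence the optimal `h` is the projection of the target onto
`L₂⁰(p)`. Division by `p conj b` identifies the energy space of `P` with the orthogonal complement of
`L₂⁰(p)` and `⟨P y, z⟩` with the scalar product of `L₂(p)`, while the functional `⟨S a_τ, z⟩` becomes
the scalar product with the target. So `P c = S a_τ` says that `c` corresponds to the component of
the target orthogonal to `L₂⁰(p)`; its difference from the target is `h_τ(f, g)`, which is therefore
optimal (`IsInverseImage.mse_hTau`), and `⟨S a_τ, P⁻¹ S a_τ⟩ + ⟨Q a, a⟩` is `2π Δ(f, g)`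
(`IsInverseImage.errorValue_eq`). In particular the solution `c` exists whenever `p > 0` almost
everywhere, which minimality implies.

**Saddle point.** Let `h₀ = h_τ(f⁰, g⁰)`. The two equations say that `|A - h₀ r| = α₁` and
`|h₀| = α₂` almost everywhere, so that `Δ(h₀; f, g)` is `α₁²` times the power of `g` plus `α₂²` times
the power of `f` (`mse_of_norm_eq`), and it is largest over the class when both powers are. Enlarge
`f⁰` and `g⁰` to densities `f₁ ≥ f⁰`, `g₁ ≥ g⁰` of full power. They are again minimal, and the
optimal estimate `h₁` for them satisfies `Δ(h₁; f⁰, g⁰) ≤ Δ(f₁, g₁) ≤ Δ(f⁰, g⁰)` by the extremum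
property. Since the optimal estimate is unique, `h₁ = h₀`, whence
`Δ(h₀; f, g) ≤ Δ(h₀; f₁, g₁) ≤ Δ(f⁰, g⁰)` for all densities of the class (`mse_hTau_le_of_le`).

**Membership in all the spaces `L₂⁰(p)`.** That `h₀` belongs to `L₂⁰(p)` for every pair of the class,
and not only for `(f⁰, g⁰)`, follows from its boundedness (`mem_L20_of_bounded`). Let `u` be the
Cayley transform `(1 - ix) / (1 + ix)`. Minimality makes the space `M = L₂⁰(p⁰)` a proper subspace
of `L₂(p⁰)`, and then, as in the proof of Beurling's theorem, `M` contains a non-zero `θ` orthogonal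
to `u M`. The measure `|θ|² p⁰ dx` is orthogonal to the non-zero powers of `u`, so it is a multiple
of `dx / (1 + x²)`. As `h₀ θ` lies in `M`, it follows that `∫ u^k h₀ dx / (1 + x²) = 0` for `k ≥ 1`:
in the coordinate `u` on the circle, the Fourier series of `h₀` has no negative powers. Its Fejér
means are polynomials in `u`, uniformly bounded, and a subsequence converges to `h₀` almost
everywhere. Polynomials in `u` are causal multipliers (`IsCausalMultiplier`): they preserve the
annihilator of the exponentials `e^{ixt}`, `t ≤ 0`. Since `b` is outer, in the sense
that `b ψ_j → 1` boundedly for causal multipliers `ψ_j`, every causal multiplier,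
and with them `h₀`, lies in `L₂⁰(p)` for every `p`.

**Processes.** The increments of `ζ` and the functions `obsFunction n τ t` have Gram matrices that
agree up to the factor `2π`, and so do their scalar products with `Aη` and with the target
(`IsSignalNoise.inner_obsIncLp`, `IsSignalNoise.inner_obsIncLp_noiseFunctional`). This transfers
estimates and their errors between `L₂(Ω)` and `L₂(p)`.
-/

namespace IncrementFiltering

open Filter Topology

/-! ### The Cayley transform and one-sided Fourier series on the line -/

/-- The Cayley transform `(1 - ix) / (1 + ix)`, which maps the real line onto the unit circle
without `-1` and is the boundary function of an inner function of the lower half-plane. -/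
noncomputable def cayley (x : ℝ) : ℂ := (1 - I * x) / (1 + I * x)

lemma add_I_mul_ne_zero {c : ℝ} (hc : c ≠ 0) (x : ℝ) : (c : ℂ) + I * x ≠ 0 := by
  intro h
  have := congrArg re h
  simp at this
  exact hc this

lemma one_add_I_mul_ne_zero (x : ℝ) : 1 + I * (x : ℂ) ≠ 0 := by
  simpa using add_I_mul_ne_zero one_ne_zero x

lemma one_sub_I_mul_ne_zero (x : ℝ) : 1 - I * (x : ℂ) ≠ 0 := by
  simpa [sub_eq_add_neg] using one_add_I_mul_ne_zero (-x)

lemma conj_one_add_I_mul (x : ℝ) : conj (1 + I * (x : ℂ)) = 1 - I * x := by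
  simp [sub_eq_add_neg]

lemma one_add_I_mul_conj (x : ℝ) : (1 + I * (x : ℂ)) * (1 - I * x) = 1 + (x : ℂ) ^ 2 := by
  linear_combination (-(x : ℂ) ^ 2) * I_sq

lemma norm_one_sub_I_mul (x : ℝ) : ‖1 - I * (x : ℂ)‖ = ‖1 + I * (x : ℂ)‖ := by
  rw [← conj_one_add_I_mul, RCLike.norm_conj]

lemma norm_one_add_I_mul_sq (x : ℝ) : ‖1 + I * (x : ℂ)‖ ^ 2 = 1 + x ^ 2 := by
  rw [← normSq_eq_norm_sq, normSq_apply]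
  simp
  ring

lemma norm_cayley (x : ℝ) : ‖cayley x‖ = 1 := by
  rw [cayley, norm_div, norm_one_sub_I_mul, div_self]
  simpa using one_add_I_mul_ne_zero x

lemma cayley_ne_zero (x : ℝ) : cayley x ≠ 0 := by
  rw [← norm_ne_zero_iff, norm_cayley]; exact one_ne_zero

lemma conj_cayley (x : ℝ) : conj (cayley x) = (cayley x)⁻¹ := by
  rw [← mul_left_inj' (cayley_ne_zero x), inv_mul_cancel₀ (cayley_ne_zero x), mul_comm, mul_conj,
    normSq_eq_norm_sq, norm_cayley]
  simp

lemma continuous_cayley : Continuous cayley := by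
  unfold cayley
  exact Continuous.div (by fun_prop) (by fun_prop) one_add_I_mul_ne_zero

lemma cayley_injective : Function.Injective cayley := by
  intro x y h
  unfold cayley at h
  rw [div_eq_div_iff (one_add_I_mul_ne_zero x) (one_add_I_mul_ne_zero y)] at h
  have : (x : ℂ) = y := by
    have h2 : (2 * I) * ((y : ℂ) - x) = 0 := by linear_combination h
    have := (mul_eq_zero.1 h2).resolve_left (by simp)
    linear_combination -this
  exact_mod_cast this

lemma norm_cayley_zpow (k : ℤ) (x : ℝ) : ‖cayley x ^ k‖ = 1 := by
  rw [norm_zpow, norm_cayley, one_zpow]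

lemma continuous_cayley_zpow (k : ℤ) : Continuous fun x => cayley x ^ k :=
  continuous_cayley.zpow₀ k fun x => Or.inl (cayley_ne_zero x)

lemma integrable_cayley_zpow_mul {φ : ℝ → ℂ} (hφ : Integrable φ) (k : ℤ) :
    Integrable fun x => cayley x ^ k * φ x :=
  hφ.bdd_mul (c := 1) (continuous_cayley_zpow k).aestronglyMeasurable
    (ae_of_all _ fun x => (norm_cayley_zpow k x).le)

lemma tendsto_cayley {l : Filter ℝ} (hl : Tendsto (fun x : ℝ => |x|) l atTop) :
    Tendsto cayley l (𝓝 (-1)) := by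
  have h : ∀ x, cayley x = -1 + 2 / (1 + I * x) := by
    intro x
    have := one_add_I_mul_ne_zero x
    unfold cayley
    field_simp
    ring
  have h2 : Tendsto (fun x : ℝ => 2 / (1 + I * (x : ℂ))) l (𝓝 0) := by
    rw [tendsto_zero_iff_norm_tendsto_zero]
    have h3 : Tendsto (fun x : ℝ => ‖1 + I * (x : ℂ)‖) l atTop := by
      refine tendsto_atTop_mono (fun x => ?_) hl
      simpa using abs_im_le_norm (1 + I * (x : ℂ))
    simp_rw [norm_div]
    exact h3.const_div_atTop _
  simpa [funext h] using h2.const_add (-1)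

/-- The Cauchy density `1 / (1 + x²)` is the pull-back of arc length: the non-zero powers of the
Cayley transform are orthogonal to the constants. -/
lemma integral_cayley_zpow_cauchy {k : ℤ} (hk : k ≠ 0) :
    ∫ x, cayley x ^ k * ((1 + x ^ 2)⁻¹ : ℝ) = 0 := by
  have hk' : (k : ℂ) ≠ 0 := by exact_mod_cast hk
  -- the integrand is the derivative of `(i / 2k) u ^ k`, and `u → -1` at both ends
  have hd : ∀ x : ℝ, HasDerivAt (fun x => I / (2 * k) * cayley x ^ k)
      (cayley x ^ k * ((1 + x ^ 2)⁻¹ : ℝ)) x := by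
    intro x
    have h1 := one_add_I_mul_ne_zero x
    have h2 := one_sub_I_mul_ne_zero x
    have ha : HasDerivAt (fun x : ℝ => I * (x : ℂ)) I x := by
      simpa using (ofRealCLM.hasDerivAt (x := x)).const_mul I
    have hu : HasDerivAt cayley (-(2 * I) / (1 + I * x) ^ 2) x := by
      refine ((ha.const_sub 1).fun_div (ha.const_add 1) h1).congr_deriv ?_
      congr 1
      ring
    have hz : HasDerivAt (fun x => cayley x ^ k)
        (k * cayley x ^ (k - 1) * (-(2 * I) / (1 + I * x) ^ 2)) x :=
      (hasDerivAt_zpow k (cayley x) (Or.inl (cayley_ne_zero x))).comp x hu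
    refine (hz.const_mul _).congr_deriv ?_
    rw [zpow_sub_one₀ (cayley_ne_zero x)]
    push_cast
    rw [← one_add_I_mul_conj]
    unfold cayley
    field_simp
    linear_combination (-1 : ℂ) * I_sq
  have hint : Integrable fun x : ℝ => cayley x ^ k * ((1 + x ^ 2)⁻¹ : ℝ) :=
    integrable_cayley_zpow_mul integrable_inv_one_add_sq.ofReal k
  have hlim : ∀ {l : Filter ℝ}, Tendsto (fun x : ℝ => |x|) l atTop →
      Tendsto (fun x => I / (2 * k) * cayley x ^ k) l (𝓝 (I / (2 * k) * (-1) ^ k)) := by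
    intro l hl
    exact ((tendsto_cayley hl).zpow₀ k (Or.inl (by simp))).const_mul _
  rw [integral_of_hasDerivAt_of_tendsto hd hint (hlim tendsto_abs_atBot_atTop)
    (hlim tendsto_abs_atTop_atTop), sub_self]

lemma ae_eq_zero_of_integral_cayley_real {ψ : ℝ → ℝ} (hψ : Integrable ψ)
    (h : ∀ k : ℤ, ∫ x, cayley x ^ k * (ψ x : ℂ) = 0) : ψ =ᵐ[volume] 0 := by
  let ub : BoundedContinuousFunction ℝ ℂ :=
    BoundedContinuousFunction.ofNormedAddCommGroup cayley continuous_cayley 1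
      fun x => (norm_cayley x).le
  have hub : ∀ x, ub x = cayley x := fun x => rfl
  let A : StarSubalgebra ℂ (BoundedContinuousFunction ℝ ℂ) := StarAlgebra.adjoin ℂ {ub}
  let P := volume.withDensity fun x => ENNReal.ofReal (ψ x)
  let P' := volume.withDensity fun x => ENNReal.ofReal (-ψ x)
  have hP : IsFiniteMeasure P := isFiniteMeasure_withDensity_ofReal hψ.2
  have hP' : IsFiniteMeasure P' := isFiniteMeasure_withDensity_ofReal hψ.neg.2
  have hdiff : ∀ g : BoundedContinuousFunction ℝ ℂ,
      ∫ x, g x ∂P - ∫ x, g x ∂P' = ∫ x, g x * (ψ x : ℂ) := by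
    intro g
    have e1 : ∀ {χ : ℝ → ℝ}, Integrable χ →
        Integrable (fun x => (max (χ x) 0) • g x) ∧
        ∫ x, g x ∂(volume.withDensity fun x => ENNReal.ofReal (χ x))
          = ∫ x, (max (χ x) 0) • g x := by
      intro χ hχ
      refine ⟨?_, ?_⟩
      · exact hχ.pos_part.smul_bdd ‖g‖ g.continuous.aestronglyMeasurable
          (ae_of_all _ fun x => g.norm_coe_le_norm x)
      · rw [integral_withDensity_eq_integral_toReal_smul₀ hχ.aemeasurable.ennreal_ofReal
          (ae_of_all _ fun x => ENNReal.ofReal_lt_top)]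
        simp_rw [ENNReal.toReal_ofReal']
    have e2 : ∫ x, g x ∂P' = ∫ x, (max ((-ψ) x) 0) • g x := (e1 hψ.neg).2
    rw [(e1 hψ).2, e2, ← integral_sub (e1 hψ).1 (e1 hψ.neg).1]
    refine integral_congr_ae (ae_of_all _ fun x => ?_)
    have h3 := congrArg ofReal (max_zero_sub_max_neg_zero_eq_self (ψ x))
    rw [ofReal_sub] at h3
    simp only [Pi.neg_apply, real_smul]
    linear_combination g x * h3
  have hPP : P = P' := by
    refine ext_of_forall_mem_subalgebra_integral_eq_of_pseudoEMetric_complete_countable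
      (A := A) ?_ ?_
    · intro x y hxy
      refine ⟨cayley, ⟨ub.toContinuousMap, ⟨ub, ?_, rfl⟩, rfl⟩, cayley_injective.ne hxy⟩
      exact StarAlgebra.self_mem_adjoin_singleton ℂ ub
    · intro g hg
      have hg' : g ∈ Submodule.span ℂ
          ((Submonoid.closure ({ub} ∪ star {ub}) : Submonoid _) : Set _) := by
        rw [← StarAlgebra.adjoin_eq_span]
        exact hg
      clear hg
      rw [← sub_eq_zero, hdiff]
      induction hg' using Submodule.span_induction with
      | mem g hg =>
        have hk : ∃ k : ℤ, ∀ x, g x = cayley x ^ k := by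
          induction hg using Submonoid.closure_induction with
          | mem g hg =>
            rcases hg with hg | hg
            · refine ⟨1, fun x => ?_⟩
              rw [Set.mem_singleton_iff.1 hg, hub, zpow_one]
            · refine ⟨-1, fun x => ?_⟩
              rw [Set.star_singleton, Set.mem_singleton_iff] at hg
              rw [hg, BoundedContinuousFunction.star_apply, hub, zpow_neg_one, ← conj_cayley]
              rfl
          | one => exact ⟨0, fun x => by simp⟩
          | mul g₁ g₂ _ _ h₁ h₂ =>
            obtain ⟨k₁, h₁⟩ := h₁
            obtain ⟨k₂, h₂⟩ := h₂
            exact ⟨k₁ + k₂, fun x => by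
              rw [BoundedContinuousFunction.mul_apply, h₁, h₂, zpow_add₀ (cayley_ne_zero x)]⟩
        obtain ⟨k, hk⟩ := hk
        simp_rw [hk, h k]
      | zero => simp
      | add g₁ g₂ _ _ h₁ h₂ =>
        have hi : ∀ g : BoundedContinuousFunction ℝ ℂ, Integrable fun x => g x * (ψ x : ℂ) :=
          fun g => hψ.ofReal.bdd_mul (c := ‖g‖) g.continuous.aestronglyMeasurable
            (ae_of_all _ fun x => g.norm_coe_le_norm x)
        simp_rw [BoundedContinuousFunction.add_apply, add_mul]
        rw [integral_add (hi g₁) (hi g₂), h₁, h₂, add_zero]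
      | smul c g _ h₁ =>
        simp_rw [BoundedContinuousFunction.smul_apply, smul_mul_assoc]
        rw [integral_smul, h₁, smul_zero]
  have hae := (withDensity_eq_iff hψ.aemeasurable.ennreal_ofReal
    hψ.neg.aemeasurable.ennreal_ofReal ?_).1 hPP
  · filter_upwards [hae] with x hx
    have := congrArg ENNReal.toReal hx
    simp only [Pi.neg_apply, ENNReal.toReal_ofReal'] at this
    have h3 := max_zero_sub_max_neg_zero_eq_self (ψ x)
    simp only [Pi.zero_apply]
    linarith
  · exact (hψ.lintegral_lt_top).ne

/-- A complex integrable function on the line is determined by its integrals against the powers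
of the Cayley transform. -/
lemma ae_eq_zero_of_integral_cayley {φ : ℝ → ℂ} (hφ : Integrable φ)
    (h : ∀ k : ℤ, ∫ x, cayley x ^ k * φ x = 0) : φ =ᵐ[volume] 0 := by
  have hc : ∀ k : ℤ, ∫ x, cayley x ^ k * conj (φ x) = 0 := by
    intro k
    have := congrArg conj (h (-k))
    rw [← integral_conj] at this
    simpa [conj_cayley] using this
  have hi := integrable_cayley_zpow_mul hφ
  have hi' := integrable_cayley_zpow_mul (φ := fun x => conj (φ x)) (by
    exact (LinearIsometryEquiv.integrable_comp_iff conjLIE).2 hφ)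
  have hre : (fun x => (φ x).re) =ᵐ[volume] 0 := by
    refine ae_eq_zero_of_integral_cayley_real hφ.re fun k => ?_
    have : ∀ x, cayley x ^ k * ((φ x).re : ℂ)
        = 2⁻¹ * (cayley x ^ k * φ x + cayley x ^ k * conj (φ x)) := by
      intro x
      rw [re_eq_add_conj]
      ring
    simp_rw [this]
    rw [integral_const_mul, integral_add (hi k) (hi' k), h, hc]
    simp
  have him : (fun x => (φ x).im) =ᵐ[volume] 0 := by
    refine ae_eq_zero_of_integral_cayley_real hφ.im fun k => ?_
    have : ∀ x, cayley x ^ k * ((φ x).im : ℂ)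
        = (2 * I)⁻¹ * (cayley x ^ k * φ x - cayley x ^ k * conj (φ x)) := by
      intro x
      rw [im_eq_sub_conj]
      field_simp
    simp_rw [this]
    rw [integral_const_mul, integral_sub (hi k) (hi' k), h, hc]
    simp
  filter_upwards [hre, him] with x h1 h2
  exact Complex.ext h1 h2

/-- The Cauchy distribution `dx / (π (1 + x²))`, the normalised arc length of the circle in the
Cayley coordinate. -/
noncomputable def cauchyLaw : Measure ℝ :=
  volume.withDensity fun x => ENNReal.ofReal (Real.pi⁻¹ * (1 + x ^ 2)⁻¹)

lemma integrable_cauchy_density : Integrable fun x : ℝ => Real.pi⁻¹ * (1 + x ^ 2)⁻¹ :=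
  integrable_inv_one_add_sq.const_mul _

instance : IsFiniteMeasure cauchyLaw :=
  isFiniteMeasure_withDensity_ofReal integrable_cauchy_density.2

lemma integral_cauchyLaw (φ : ℝ → ℂ) :
    ∫ x, φ x ∂cauchyLaw = (Real.pi : ℂ)⁻¹ * ∫ x, φ x * ((1 + x ^ 2)⁻¹ : ℝ) := by
  rw [cauchyLaw, integral_withDensity_eq_integral_toReal_smul₀
    integrable_cauchy_density.aemeasurable.ennreal_ofReal
    (ae_of_all _ fun x => ENNReal.ofReal_lt_top), ← integral_const_mul]
  refine integral_congr_ae (ae_of_all _ fun x => ?_)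
  simp only
  rw [ENNReal.toReal_ofReal (by positivity), real_smul]
  push_cast
  ring

lemma Integrable.of_cauchyLaw {φ : ℝ → ℂ} (h : Integrable φ cauchyLaw) :
    Integrable fun y => φ y * ((1 + y ^ 2)⁻¹ : ℝ) := by
  rw [cauchyLaw, integrable_withDensity_iff_integrable_smul₀'
    integrable_cauchy_density.aemeasurable.ennreal_ofReal
    (ae_of_all _ fun x => ENNReal.ofReal_lt_top)] at h
  refine (h.const_mul (Real.pi : ℂ)).congr (ae_of_all _ fun y => ?_)
  have hπ : (Real.pi : ℂ) ≠ 0 := by exact_mod_cast Real.pi_ne_zero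
  simp only
  rw [ENNReal.toReal_ofReal (by positivity), real_smul]
  push_cast
  field_simp

lemma ae_cauchyLaw_iff {q : ℝ → Prop} : (∀ᵐ x ∂cauchyLaw, q x) ↔ ∀ᵐ x, q x := by
  rw [cauchyLaw, ae_withDensity_iff' integrable_cauchy_density.aemeasurable.ennreal_ofReal]
  refine eventually_congr (ae_of_all _ fun x => ?_)
  have : 0 < Real.pi⁻¹ * (1 + x ^ 2)⁻¹ := by positivity
  simp [this]

lemma integral_cauchyLaw_cayley_zpow (k : ℤ) :
    ∫ x, cayley x ^ k ∂cauchyLaw = if k = 0 then 1 else 0 := by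
  rw [integral_cauchyLaw]
  split_ifs with hk
  · subst hk
    simp only [zpow_zero, one_mul]
    rw [integral_complex_ofReal, integral_univ_inv_one_add_sq]
    exact inv_mul_cancel₀ (by exact_mod_cast Real.pi_ne_zero)
  · rw [integral_cayley_zpow_cauchy hk, mul_zero]

/-- The powers of the Cayley transform as bounded continuous functions. -/
noncomputable def cayleyPow (k : ℤ) : BoundedContinuousFunction ℝ ℂ :=
  BoundedContinuousFunction.ofNormedAddCommGroup (fun x => cayley x ^ k)
    (continuous_cayley_zpow k) 1 fun x => (norm_cayley_zpow k x).le

@[simp] lemma cayleyPow_apply (k : ℤ) (x : ℝ) : cayleyPow k x = cayley x ^ k := rfl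

/-- The powers of the Cayley transform in `L₂` of the Cauchy distribution. -/
noncomputable def cayleyLp (k : ℤ) : Lp ℂ 2 cauchyLaw :=
  BoundedContinuousFunction.toLp 2 cauchyLaw ℂ (cayleyPow k)

lemma inner_cayleyLp (k : ℤ) (x : Lp ℂ 2 cauchyLaw) :
    inner ℂ (cayleyLp k) x = ∫ y, cayley y ^ (-k) * x y ∂cauchyLaw := by
  rw [L2.inner_def]
  refine integral_congr_ae ?_
  filter_upwards [BoundedContinuousFunction.coeFn_toLp (𝕜 := ℂ) (p := 2) cauchyLaw (cayleyPow k)]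
    with y hy
  rw [cayleyLp, hy, RCLike.inner_apply, cayleyPow_apply, map_zpow₀, conj_cayley, inv_zpow',
    mul_comm]

lemma orthonormal_cayleyLp : Orthonormal ℂ cayleyLp := by
  rw [orthonormal_iff_ite]
  intro j k
  rw [inner_cayleyLp]
  have : ∫ y, cayley y ^ (-j) * cayleyLp k y ∂cauchyLaw = ∫ y, cayley y ^ (k - j) ∂cauchyLaw := by
    refine integral_congr_ae ?_
    filter_upwards [BoundedContinuousFunction.coeFn_toLp (𝕜 := ℂ) (p := 2) cauchyLaw (cayleyPow k)]
      with y hy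
    rw [cayleyLp, hy, cayleyPow_apply, ← zpow_add₀ (cayley_ne_zero y)]
    congr 1
    ring
  rw [this, integral_cauchyLaw_cayley_zpow]
  simp only [sub_eq_zero, eq_comm]

lemma span_cayleyLp_orthogonal : (Submodule.span ℂ (Set.range cayleyLp))ᗮ = ⊥ := by
  rw [Submodule.eq_bot_iff]
  intro x hx
  rw [Submodule.mem_orthogonal] at hx
  have h1 : ∀ k : ℤ, ∫ y, cayley y ^ k * (x y * ((1 + y ^ 2)⁻¹ : ℝ)) = 0 := by
    intro k
    have := hx _ (Submodule.subset_span ⟨-k, rfl⟩)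
    rw [inner_cayleyLp, integral_cauchyLaw, neg_neg] at this
    simpa [mul_assoc, Real.pi_ne_zero] using this
  have h2 := Integrable.of_cauchyLaw ((Lp.memLp x).integrable (by norm_num))
  have h3 := ae_eq_zero_of_integral_cayley h2 h1
  rw [Lp.eq_zero_iff_ae_eq_zero]
  refine ae_cauchyLaw_iff.2 ?_
  filter_upwards [h3] with y hy
  have h4 : ((1 + y ^ 2)⁻¹ : ℝ) ≠ 0 := by positivity
  simpa [h4, -ofReal_inv] using hy

/-- The positivity of the Fejér kernel, in the form of a bound for the Fejér means. -/
lemma norm_fejer_mean_le {h : ℝ → ℂ} {K : ℝ} (hm : AEStronglyMeasurable h cauchyLaw)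
    (hK : ∀ᵐ y ∂cauchyLaw, ‖h y‖ ≤ K) {N : ℕ} (hN : N ≠ 0) (x : ℝ) :
    ‖(N : ℂ)⁻¹ * ∑ m ∈ Finset.range N, ∑ l ∈ Finset.range N,
      (∫ y, cayley y ^ (-((m : ℤ) - l)) * h y ∂cauchyLaw) * cayley x ^ ((m : ℤ) - l)‖ ≤ K := by
  let D : ℝ → ℂ := fun y => ∑ m ∈ Finset.range N, ∑ l ∈ Finset.range N,
    cayley x ^ ((m : ℤ) - l) * cayley y ^ (-((m : ℤ) - l))
  have hD : ∀ y, D y = ((‖∑ m ∈ Finset.range N, (cayley x * (cayley y)⁻¹) ^ m‖ ^ 2 : ℝ) : ℂ) := by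
    intro y
    rw [ofReal_pow, ← mul_conj', map_sum, Finset.sum_mul_sum]
    refine Finset.sum_congr rfl fun m _ => Finset.sum_congr rfl fun l _ => ?_
    have h1 := cayley_ne_zero x
    have h2 := cayley_ne_zero y
    rw [map_pow, map_mul, map_inv₀, conj_cayley, conj_cayley, zpow_neg, zpow_sub₀ h1, zpow_sub₀ h2]
    simp only [zpow_natCast, mul_pow, inv_pow, inv_inv]
    field_simp
  have hi : ∀ k : ℤ, Integrable (fun y => cayley y ^ k) cauchyLaw := fun k =>
    (integrable_const (1 : ℂ)).mono (continuous_cayley_zpow k).aestronglyMeasurable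
      (ae_of_all _ fun y => by simp [norm_cayley])
  have hDi : Integrable D cauchyLaw :=
    integrable_finsetSum _ fun m _ => integrable_finsetSum _ fun l _ => (hi _).const_mul _
  have hDN : ∫ y, D y ∂cauchyLaw = N := by
    simp only [D]
    rw [integral_finsetSum _ fun m _ => integrable_finsetSum _ fun l _ => (hi _).const_mul _]
    have : ∀ m ∈ Finset.range N, ∫ y, ∑ l ∈ Finset.range N,
        cayley x ^ ((m : ℤ) - l) * cayley y ^ (-((m : ℤ) - l)) ∂cauchyLaw = 1 := by
      intro m hmN
      rw [integral_finsetSum _ fun l _ => (hi _).const_mul _]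
      simp_rw [integral_const_mul, integral_cauchyLaw_cayley_zpow]
      rw [Finset.sum_eq_single m]
      · simp
      · intro l _ hl
        rw [if_neg (by omega), mul_zero]
      · exact fun h => absurd hmN h
    rw [Finset.sum_congr rfl this]
    simp
  have hi2 : ∀ k : ℤ, Integrable (fun y => cayley y ^ k * h y) cauchyLaw := fun k =>
    (hi k).mul_bdd hm hK
  have hrw : (∑ m ∈ Finset.range N, ∑ l ∈ Finset.range N,
      (∫ y, cayley y ^ (-((m : ℤ) - l)) * h y ∂cauchyLaw) * cayley x ^ ((m : ℤ) - l))
      = ∫ y, D y * h y ∂cauchyLaw := by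
    simp only [D, Finset.sum_mul]
    rw [integral_finsetSum _ fun m _ => integrable_finsetSum _ fun l _ => by
      simp_rw [mul_assoc]; exact (hi2 _).const_mul _]
    refine Finset.sum_congr rfl fun m _ => ?_
    rw [integral_finsetSum _ fun l _ => by simp_rw [mul_assoc]; exact (hi2 _).const_mul _]
    refine Finset.sum_congr rfl fun l _ => ?_
    simp_rw [mul_assoc]
    rw [integral_const_mul, mul_comm]
  have hnD : ∀ y, ‖D y‖ = (D y).re := by
    intro y
    rw [hD, norm_real, Real.norm_of_nonneg (by positivity), ofReal_re]
  have hbound : ‖∫ y, D y * h y ∂cauchyLaw‖ ≤ N * K := by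
    refine (norm_integral_le_of_norm_le (g := fun y => (D y).re * K) (hDi.re.mul_const K) ?_).trans
      (le_of_eq ?_)
    · filter_upwards [hK] with y hy
      rw [norm_mul, hnD]
      exact mul_le_mul_of_nonneg_left hy (hnD y ▸ norm_nonneg _)
    · rw [integral_mul_const]
      congr 1
      have := integral_re hDi
      rw [hDN] at this
      simpa using this
  rw [hrw, norm_mul, norm_inv, Complex.norm_natCast]
  have hN' : (0 : ℝ) < N := by positivity
  rw [inv_mul_le_iff₀ hN']
  exact hbound

lemma sum_sum_eq_sum_sum_of_neg_eq_zero {c : ℤ → ℂ} (hc : ∀ k < 0, c k = 0) (N : ℕ) :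
    ∑ m ∈ Finset.range N, ∑ l ∈ Finset.range N, c ((m : ℤ) - l)
      = ∑ m ∈ Finset.range N, ∑ j ∈ Finset.range (m + 1), c j := by
  refine Finset.sum_congr rfl fun m hm => ?_
  rw [← Finset.sum_range_reflect (fun j : ℕ => c j)]
  refine (Finset.sum_subset_zero_on_sdiff (Finset.range_mono (by simpa using hm)) ?_ ?_).symm
  · intro l hl
    simp only [Finset.mem_sdiff, Finset.mem_range] at hl
    exact hc _ (by omega)
  · intro l hl
    rw [Finset.mem_range] at hl
    congr 1
    omega

/-- A bounded function on the line whose negative Fourier coefficients in the Cayley coordinate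
vanish is a bounded almost everywhere limit of polynomials in the Cayley transform: a subsequence
of its Fejér means. -/
lemma exists_tendsto_polynomial_cayley {h : ℝ → ℂ} {K : ℝ} (hm : AEStronglyMeasurable h)
    (hK : ∀ᵐ x, ‖h x‖ ≤ K)
    (hh : ∀ k : ℕ, k ≠ 0 → ∫ x, cayley x ^ k * (h x * ((1 + x ^ 2)⁻¹ : ℝ)) = 0) :
    ∃ q : ℕ → Polynomial ℂ, (∀ j x, ‖(q j).eval (cayley x)‖ ≤ K) ∧
      ∀ᵐ x, Tendsto (fun j => (q j).eval (cayley x)) atTop (𝓝 (h x)) := by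
  have hm' : AEStronglyMeasurable h cauchyLaw :=
    hm.mono_ac (withDensity_absolutelyContinuous _ _)
  have hK' := ae_cauchyLaw_iff.2 hK
  have hL : MemLp h 2 cauchyLaw := MemLp.of_bound hm' K hK'
  let X : Lp ℂ 2 cauchyLaw := hL.toLp h
  let B := HilbertBasis.mkOfOrthogonalEqBot orthonormal_cayleyLp span_cayleyLp_orthogonal
  let c : ℤ → ℂ := fun k => ∫ y, cayley y ^ (-k) * h y ∂cauchyLaw
  have hBc : ∀ k, B.repr X k = c k := by
    intro k
    rw [HilbertBasis.repr_apply_apply, HilbertBasis.coe_mkOfOrthogonalEqBot, inner_cayleyLp]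
    refine integral_congr_ae ?_
    filter_upwards [hL.coeFn_toLp] with y hy
    rw [hy]
  have hneg : ∀ k < 0, c k = 0 := by
    intro k hk
    obtain ⟨j, rfl⟩ : ∃ j : ℕ, k = -(j : ℤ) := ⟨k.natAbs, by omega⟩
    simp only [c, neg_neg]
    rw [integral_cauchyLaw]
    have := hh j (by omega)
    simp only [zpow_natCast, mul_assoc]
    rw [this, mul_zero]
  have hsum : HasSum (fun k : ℤ => c k • cayleyLp k) X := by
    have := B.hasSum_repr X
    simp only [hBc] at this
    simpa only [B, HilbertBasis.coe_mkOfOrthogonalEqBot] using this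
  have hsum' : HasSum (fun k : ℕ => c k • cayleyLp k) X := by
    refine (Nat.cast_injective (R := ℤ)).hasSum_iff (f := fun k : ℤ => c k • cayleyLp k) ?_ |>.2 hsum
    intro k hk
    rw [hneg k, zero_smul]
    by_contra h0
    exact hk ⟨k.toNat, by simp; omega⟩
  let q : ℕ → Polynomial ℂ := fun N => Polynomial.C (((N + 1 : ℕ) : ℂ)⁻¹) *
    ∑ m ∈ Finset.range (N + 1), ∑ j ∈ Finset.range (m + 1), Polynomial.monomial j (c j)
  have hq : ∀ N x, (q N).eval (cayley x) = ((N + 1 : ℕ) : ℂ)⁻¹ *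
      ∑ m ∈ Finset.range (N + 1), ∑ j ∈ Finset.range (m + 1), c j * cayley x ^ j := by
    intro N x
    simp [q, Polynomial.eval_finsetSum]
  let G : ℕ → BoundedContinuousFunction ℝ ℂ := fun N => ((((N + 1 : ℕ) : ℝ)⁻¹ : ℝ) : ℂ) •
    ∑ m ∈ Finset.range (N + 1), ∑ j ∈ Finset.range (m + 1), c j • cayleyPow j
  have hG : ∀ N x, G N x = (q N).eval (cayley x) := by
    intro N x
    rw [hq]
    simp [G, BoundedContinuousFunction.sum_apply]
  have hlim : Tendsto (fun N => BoundedContinuousFunction.toLp 2 cauchyLaw ℂ (G N)) atTop (𝓝 X) := by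
    have h1 := ((hsum'.tendsto_sum_nat.comp (tendsto_add_atTop_nat 1)).cesaro_smul).comp
      (tendsto_add_atTop_nat 1)
    refine h1.congr fun N => ?_
    simp only [G, Function.comp_apply, map_smul, map_sum, cayleyLp]
    rw [Complex.coe_smul]
    rfl
  have hmeas := tendstoInMeasure_of_tendsto_Lp hlim
  obtain ⟨ns, -, hns⟩ := hmeas.exists_seq_tendsto_ae
  refine ⟨fun j => q (ns j), fun j x => ?_, ?_⟩
  · rw [hq]
    have := norm_fejer_mean_le hm' hK' (Nat.succ_ne_zero (ns j)) x
    rw [sum_sum_eq_sum_sum_of_neg_eq_zero (c := fun k => c k * cayley x ^ k)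
      (fun k hk => by simp [hneg k hk])] at this
    simpa using this
  · refine ae_cauchyLaw_iff.1 ?_
    have hco := ae_all_iff.2 fun N => BoundedContinuousFunction.coeFn_toLp (𝕜 := ℂ) (p := 2)
      cauchyLaw (G N)
    filter_upwards [hns, hL.coeFn_toLp, hco] with x h1 h2 h3
    rw [h2] at h1
    refine h1.congr fun j => ?_
    rw [h3, hG]

/-! ### Causal multipliers -/

/-- Integrable functions annihilated by the exponentials `e^{ixt}`, `t ≤ 0`. -/
def Annihilates (k : ℝ → ℂ) : Prop :=
  Integrable k ∧ ∀ t : ℝ, t ≤ 0 → ∫ x : ℝ, exp (I * x * t) * k x = 0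

/-- Bounded functions `m` such that multiplication by `m` preserves the annihilator of the
exponentials `e^{ixt}`, `t ≤ 0`. They are the boundary values of the bounded analytic functions of
the lower half-plane; this formulation gives an algebra closed under bounded limits without
mentioning analyticity. -/
structure IsCausalMultiplier (m : ℝ → ℂ) : Prop where
  aestronglyMeasurable : AEStronglyMeasurable m
  bounded : ∃ K : ℝ, ∀ x, ‖m x‖ ≤ K
  map : ∀ k, Annihilates k → Annihilates fun x => m x * k x

lemma norm_exp_I_mul (x t : ℝ) : ‖exp (I * x * t)‖ = 1 := by
  rw [mul_assoc, ← ofReal_mul, mul_comm, norm_exp_ofReal_mul_I]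

lemma norm_exp_neg_I_mul (x t : ℝ) : ‖exp (-(I * x * t))‖ = 1 := by
  have := norm_exp_I_mul x (-t)
  rwa [ofReal_neg, mul_neg] at this

lemma Annihilates.congr {k k' : ℝ → ℂ} (hk : Annihilates k) (h : k =ᵐ[volume] k') :
    Annihilates k' := by
  refine ⟨hk.1.congr h, fun t ht => ?_⟩
  rw [← hk.2 t ht]
  refine integral_congr_ae ?_
  filter_upwards [h] with x hx
  rw [hx]

lemma Annihilates.integral_eq_zero {k : ℝ → ℂ} (hk : Annihilates k) : ∫ x, k x = 0 := by
  simpa using hk.2 0 le_rfl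

lemma integrable_exp_mul {k : ℝ → ℂ} (hk : Integrable k) (t : ℝ) :
    Integrable fun x : ℝ => exp (I * x * t) * k x :=
  hk.bdd_mul (c := 1) (by fun_prop) (ae_of_all _ fun x => (norm_exp_I_mul x t).le)

namespace IsCausalMultiplier

lemma const (c : ℂ) : IsCausalMultiplier fun _ => c := by
  refine ⟨aestronglyMeasurable_const, ⟨‖c‖, fun _ => le_rfl⟩, fun k hk => ⟨hk.1.const_mul c, ?_⟩⟩
  intro t ht
  simp_rw [mul_left_comm _ c]
  rw [integral_const_mul, hk.2 t ht, mul_zero]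

lemma exp_nonpos {s : ℝ} (hs : s ≤ 0) : IsCausalMultiplier fun x : ℝ => exp (I * x * s) := by
  refine ⟨by fun_prop, ⟨1, fun x => (norm_exp_I_mul x s).le⟩,
    fun k hk => ⟨integrable_exp_mul hk.1 s, fun t ht => ?_⟩⟩
  rw [← hk.2 (t + s) (by linarith)]
  refine integral_congr_ae (ae_of_all _ fun x => ?_)
  simp only
  rw [← mul_assoc, ← Complex.exp_add]
  congr 2
  push_cast
  ring

lemma add {m₁ m₂ : ℝ → ℂ} (h₁ : IsCausalMultiplier m₁) (h₂ : IsCausalMultiplier m₂) :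
    IsCausalMultiplier fun x => m₁ x + m₂ x := by
  obtain ⟨K₁, hK₁⟩ := h₁.bounded
  obtain ⟨K₂, hK₂⟩ := h₂.bounded
  refine ⟨h₁.1.add h₂.1, ⟨K₁ + K₂, fun x => (norm_add_le _ _).trans (add_le_add (hK₁ x) (hK₂ x))⟩,
    fun k hk => ?_⟩
  have hk₁ := h₁.map k hk
  have hk₂ := h₂.map k hk
  simp_rw [add_mul]
  refine ⟨hk₁.1.add hk₂.1, fun t ht => ?_⟩
  simp_rw [mul_add]
  rw [integral_add (integrable_exp_mul hk₁.1 t) (integrable_exp_mul hk₂.1 t), hk₁.2 t ht,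
    hk₂.2 t ht, add_zero]

lemma mul {m₁ m₂ : ℝ → ℂ} (h₁ : IsCausalMultiplier m₁) (h₂ : IsCausalMultiplier m₂) :
    IsCausalMultiplier fun x => m₁ x * m₂ x := by
  obtain ⟨K₁, hK₁⟩ := h₁.bounded
  obtain ⟨K₂, hK₂⟩ := h₂.bounded
  refine ⟨h₁.1.mul h₂.1, ⟨K₁ * K₂, fun x => ?_⟩, fun k hk => ?_⟩
  · rw [norm_mul]
    exact mul_le_mul (hK₁ x) (hK₂ x) (norm_nonneg _) ((norm_nonneg _).trans (hK₁ x))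
  · simp_rw [mul_assoc]
    exact h₁.map _ (h₂.map k hk)

lemma sub {m₁ m₂ : ℝ → ℂ} (h₁ : IsCausalMultiplier m₁) (h₂ : IsCausalMultiplier m₂) :
    IsCausalMultiplier fun x => m₁ x - m₂ x := by
  simpa [sub_eq_add_neg] using h₁.add ((const (-1)).mul h₂)

lemma pow {m : ℝ → ℂ} (h : IsCausalMultiplier m) (j : ℕ) :
    IsCausalMultiplier fun x => m x ^ j := by
  induction j with
  | zero => simpa using const 1
  | succ j ih => simpa [pow_succ] using ih.mul h

lemma sum {ι : Type*} (s : Finset ι) {m : ι → ℝ → ℂ} (h : ∀ i ∈ s, IsCausalMultiplier (m i)) :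
    IsCausalMultiplier fun x => ∑ i ∈ s, m i x := by
  classical
  induction s using Finset.induction_on with
  | empty => simpa using const 0
  | insert i s hi ih =>
    simp_rw [Finset.sum_insert hi]
    exact (h i (Finset.mem_insert_self _ _)).add
      (ih fun j hj => h j (Finset.mem_insert_of_mem hj))

lemma polynomial_eval {m : ℝ → ℂ} (h : IsCausalMultiplier m) (q : Polynomial ℂ) :
    IsCausalMultiplier fun x => q.eval (m x) := by
  simp_rw [Polynomial.eval_eq_sum_range]
  exact sum _ fun i _ => (const _).mul (h.pow i)

/-- Bounded almost everywhere limits of causal multipliers are causal multipliers. -/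
lemma of_tendsto {m : ℕ → ℝ → ℂ} {l : ℝ → ℂ} {K : ℝ} (hm : ∀ j, IsCausalMultiplier (m j))
    (hK : ∀ j x, ‖m j x‖ ≤ K) (hl : ∀ x, ‖l x‖ ≤ K)
    (h : ∀ᵐ x, Tendsto (fun j => m j x) atTop (𝓝 (l x))) : IsCausalMultiplier l := by
  have hlm : AEStronglyMeasurable l := aestronglyMeasurable_of_tendsto_ae _ (fun j => (hm j).1) h
  refine ⟨hlm, ⟨K, hl⟩, fun k hk => ⟨hk.1.bdd_mul (c := K) hlm (ae_of_all _ hl), fun t ht => ?_⟩⟩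
  refine tendsto_nhds_unique (f := fun j => ∫ x : ℝ, exp (I * x * t) * (m j x * k x)) (l := atTop)
    ?_ ?_
  · refine tendsto_integral_of_dominated_convergence (fun x => K * ‖k x‖) (fun j => ?_)
      (hk.1.norm.const_mul K) (fun j => ae_of_all _ fun x => ?_) ?_
    · exact (integrable_exp_mul ((hm j).map k hk).1 t).aestronglyMeasurable
    · rw [norm_mul, norm_mul, norm_exp_I_mul, one_mul]
      exact mul_le_mul_of_nonneg_right (hK j x) (norm_nonneg _)
    · filter_upwards [h] with x hx
      exact (hx.mul_const _).const_mul _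
  · simp_rw [((hm _).map k hk).2 t ht]
    exact tendsto_const_nhds

/-- The sum of a geometric series of exponentials. -/
lemma inv_one_sub {m : ℝ → ℂ} (h : IsCausalMultiplier m) (h1 : ∀ x, ‖m x‖ ≤ 1) {ρ : ℝ}
    (h0 : 0 ≤ ρ) (hρ : ρ < 1) : IsCausalMultiplier fun x => (1 - ρ * m x)⁻¹ := by
  have hn : ∀ x, ‖(ρ : ℂ) * m x‖ ≤ ρ := by
    intro x
    rw [norm_mul, norm_real, Real.norm_of_nonneg h0]
    exact mul_le_of_le_one_right h0 (h1 x)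
  have hpart : ∀ j x, ‖∑ i ∈ Finset.range j, ((ρ : ℂ) * m x) ^ i‖ ≤ (1 - ρ)⁻¹ := by
    intro j x
    calc ‖∑ i ∈ Finset.range j, ((ρ : ℂ) * m x) ^ i‖
        ≤ ∑ i ∈ Finset.range j, ρ ^ i := by
          refine norm_sum_le_of_le _ fun i _ => ?_
          rw [norm_pow]
          exact pow_le_pow_left₀ (norm_nonneg _) (hn x) i
      _ ≤ (1 - ρ)⁻¹ := by
          rw [← tsum_geometric_of_lt_one h0 hρ]
          exact (summable_geometric_of_lt_one h0 hρ).sum_le_tsum _ fun i _ => pow_nonneg h0 i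
  have hlim : ∀ x, Tendsto (fun j => ∑ i ∈ Finset.range j, ((ρ : ℂ) * m x) ^ i) atTop
      (𝓝 (1 - ρ * m x)⁻¹) := fun x =>
    (hasSum_geometric_of_norm_lt_one ((hn x).trans_lt hρ)).tendsto_sum_nat
  refine of_tendsto (K := (1 - ρ)⁻¹) (m := fun j x => ∑ i ∈ Finset.range j, ((ρ : ℂ) * m x) ^ i)
    (fun j => sum _ fun i _ => ((const _).mul h).pow i) hpart
    (fun x => le_of_tendsto (hlim x).norm (Eventually.of_forall fun j => hpart j x))
    (ae_of_all _ hlim)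

/-- `1 / (c + ix)` is the transform of `e^{-cs}`, `s ≥ 0`; here it is the limit of the Riemann sums
`δ / (1 - e^{-δ(c + ix)})` of this transform. -/
lemma inv_add_I_mul {c : ℝ} (hc : 0 < c) : IsCausalMultiplier fun x : ℝ => (c + I * x)⁻¹ := by
  let δ : ℕ → ℝ := fun j => ((j : ℝ) + 1)⁻¹
  have hδ : ∀ j, 0 < δ j := fun j => by positivity
  have hδ1 : ∀ j, δ j ≤ 1 := fun j => inv_le_one_of_one_le₀ (by simp)
  have hδ0 : Tendsto δ atTop (𝓝 0) := by
    simpa [δ] using tendsto_one_div_add_atTop_nhds_zero_nat (𝕜 := ℝ)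
  have hexp : ∀ j (x : ℝ), exp (-(δ j) * (c + I * x))
      = (Real.exp (-(δ j * c)) : ℝ) * exp (I * x * (-δ j : ℝ)) := by
    intro j x
    rw [ofReal_exp, ← Complex.exp_add]
    congr 1
    push_cast
    ring
  let m : ℕ → ℝ → ℂ := fun j x => δ j * (1 - exp (-(δ j) * (c + I * x)))⁻¹
  have hm : ∀ j, IsCausalMultiplier (m j) := by
    intro j
    refine (const _).mul ?_
    simp_rw [hexp]
    refine inv_one_sub (exp_nonpos (by linarith [hδ j])) (fun x => (norm_exp_I_mul x _).le)
      (Real.exp_nonneg _) ?_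
    rw [Real.exp_lt_one_iff]
    have := mul_pos (hδ j) hc
    linarith
  have hbd : ∀ j x, ‖m j x‖ ≤ c⁻¹ + 1 := by
    intro j x
    have hp := mul_pos (hδ j) hc
    have h1 : 1 - Real.exp (-(δ j * c)) ≤ ‖1 - exp (-(δ j) * (c + I * x))‖ := by
      refine le_trans (le_of_eq ?_) (norm_sub_norm_le _ _)
      rw [hexp, norm_mul, norm_exp_I_mul, norm_real, Real.norm_of_nonneg (Real.exp_nonneg _)]
      simp
    have h2 : δ j * c ≤ (1 + δ j * c) * (1 - Real.exp (-(δ j * c))) := by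
      have h3 : Real.exp (-(δ j * c)) * (1 + δ j * c) ≤ 1 := by
        rw [Real.exp_neg, inv_mul_le_iff₀ (Real.exp_pos _), mul_one, add_comm]
        exact Real.add_one_le_exp _
      linarith
    have h4 : 0 < 1 - Real.exp (-(δ j * c)) := by
      rw [sub_pos, Real.exp_lt_one_iff]; linarith
    simp only [m]
    rw [norm_mul, norm_inv, norm_real, Real.norm_of_nonneg (hδ j).le, ← div_eq_mul_inv,
      div_le_iff₀ (h4.trans_le h1)]
    have h5 : δ j ≤ (c⁻¹ + 1) * (1 - Real.exp (-(δ j * c))) := by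
      have h6 : δ j = c⁻¹ * (δ j * c) := by field_simp
      have h7 : c⁻¹ * (δ j * c) ≤ c⁻¹ * ((1 + δ j * c) * (1 - Real.exp (-(δ j * c)))) :=
        mul_le_mul_of_nonneg_left h2 (by positivity)
      have h8 : c⁻¹ * (1 + δ j * c) = c⁻¹ + δ j := by field_simp
      rw [← mul_assoc c⁻¹ (1 + _), h8, ← h6] at h7
      exact h7.trans (mul_le_mul_of_nonneg_right (by linarith [hδ1 j]) h4.le)
    exact h5.trans (mul_le_mul_of_nonneg_left h1 (by positivity))
  have hlim : ∀ x, Tendsto (fun j => m j x) atTop (𝓝 (c + I * x)⁻¹) := by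
    intro x
    set z : ℂ := c + I * x with hz
    have hz0 : z ≠ 0 := add_I_mul_ne_zero hc.ne' x
    have hd : HasDerivAt (fun s : ℝ => 1 - exp (-(s : ℂ) * z)) z 0 := by
      have h1 : HasDerivAt (fun s : ℝ => -(s : ℂ) * z) (-1 * z) 0 :=
        ((ofRealCLM.hasDerivAt (x := 0)).neg).mul_const z
      simpa using (h1.cexp).const_sub 1
    have hs := hd.tendsto_slope
    have hseq : Tendsto δ atTop (𝓝[≠] 0) :=
      tendsto_nhdsWithin_iff.2 ⟨hδ0, Eventually.of_forall fun j => (hδ j).ne'⟩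
    refine ((hs.comp hseq).inv₀ hz0).congr fun j => ?_
    have : (δ j : ℂ) ≠ 0 := by exact_mod_cast (hδ j).ne'
    simp [slope_def_module, m, mul_comm, hz]
  exact of_tendsto hm hbd (fun x => le_of_tendsto (hlim x).norm
    (Eventually.of_forall fun j => hbd j x)) (ae_of_all _ hlim)

end IsCausalMultiplier

lemma isCausalMultiplier_cayley : IsCausalMultiplier cayley := by
  have h := (IsCausalMultiplier.const (-1)).add
    ((IsCausalMultiplier.const 2).mul (IsCausalMultiplier.inv_add_I_mul one_pos))
  have he : (fun x : ℝ => (-1 : ℂ) + 2 * (((1 : ℝ) : ℂ) + I * x)⁻¹) = cayley := by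
    funext x
    have := one_add_I_mul_ne_zero x
    unfold cayley
    push_cast
    field_simp
    ring
  rwa [he] at h

/-! ### The generating function of the observations -/

lemma norm_one_sub_exp_le (x τ : ℝ) : ‖1 - exp (-(I * x * τ))‖ ≤ |x| * |τ| := by
  have h := Real.norm_exp_I_mul_ofReal_sub_one_le (x := -(x * τ))
  rw [Real.norm_eq_abs, abs_neg, abs_mul] at h
  refine le_trans (le_of_eq ?_) h
  rw [norm_sub_rev]
  congr 3
  push_cast
  ring

lemma norm_one_sub_exp_le_two (x τ : ℝ) : ‖1 - exp (-(I * x * τ))‖ ≤ 2 := by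
  refine (norm_sub_le _ _).trans ?_
  rw [norm_exp_neg_I_mul, norm_one]
  norm_num

lemma obsFunction_eq (n : ℕ) (τ t x : ℝ) :
    obsFunction n τ t x
      = exp (I * x * t) * ((1 - exp (-(I * x * τ))) * ((1 + I * x) / (I * x))) ^ n := by
  rw [obsFunction, mul_pow (1 - _), div_pow, mul_assoc]

lemma obsFunction_eq_exp_mul (n : ℕ) (τ t x : ℝ) :
    obsFunction n τ t x = exp (I * x * t) * obsFunction n τ 0 x := by
  simp [obsFunction, mul_assoc]

lemma norm_incFactor_le (τ x : ℝ) :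
    ‖(1 - exp (-(I * x * τ))) * ((1 + I * x) / (I * x))‖ ≤ |τ| + 2 := by
  by_cases hx : x = 0
  · subst hx; simp; positivity
  have hx' : 0 < |x| := abs_pos.2 hx
  have h : ‖(1 + I * (x : ℂ)) / (I * x)‖ ≤ |x|⁻¹ + 1 := by
    have hxc : (x : ℂ) ≠ 0 := by exact_mod_cast hx
    have he : (1 + I * (x : ℂ)) / (I * x) = (I * x)⁻¹ + 1 := by
      field_simp
    rw [he]
    refine (norm_add_le _ _).trans ?_
    simp
  rw [norm_mul]
  calc _ ≤ ‖1 - exp (-(I * x * τ))‖ * (|x|⁻¹ + 1) :=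
        mul_le_mul_of_nonneg_left h (norm_nonneg _)
    _ = ‖1 - exp (-(I * x * τ))‖ * |x|⁻¹ + ‖1 - exp (-(I * x * τ))‖ := by ring
    _ ≤ |τ| + 2 := by
        refine add_le_add ?_ (norm_one_sub_exp_le_two x τ)
        rw [← div_eq_mul_inv, div_le_iff₀ hx', mul_comm |τ|]
        exact norm_one_sub_exp_le x τ

lemma norm_obsFunction_le (n : ℕ) (τ t x : ℝ) : ‖obsFunction n τ t x‖ ≤ (|τ| + 2) ^ n := by
  rw [obsFunction_eq, norm_mul, norm_exp_I_mul, one_mul, norm_pow]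
  exact pow_le_pow_left₀ (norm_nonneg _) (norm_incFactor_le τ x) n

lemma measurable_obsFunction (n : ℕ) (τ t : ℝ) : Measurable (obsFunction n τ t) := by
  unfold obsFunction
  fun_prop

lemma ae_ne_zero : ∀ᵐ x : ℝ, x ≠ 0 := by simp [ae_iff, measure_singleton]

lemma ae_exp_ne_one {τ : ℝ} (hτ : τ ≠ 0) : ∀ᵐ x : ℝ, exp (-(I * x * τ)) ≠ 1 := by
  have hc : (Set.range fun k : ℤ => -(k * (2 * Real.pi)) / τ).Countable := Set.countable_range _
  filter_upwards [hc.ae_notMem volume] with x hx h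
  obtain ⟨k, hk⟩ := exp_eq_one_iff.1 h
  refine hx ⟨k, ?_⟩
  have h1 := congrArg im hk
  simp at h1
  simp only
  rw [div_eq_iff hτ]
  linarith

/-- `(1 - e^{-ixτ}) (1 + ix) / (ix)` is a causal multiplier, as the limit for `ε → 0` of the
functions with `ix + ε` in the denominator. -/
lemma isCausalMultiplier_obsFunction (n : ℕ) {τ t : ℝ} (hτ : 0 ≤ τ) (ht : t ≤ 0) :
    IsCausalMultiplier (obsFunction n τ t) := by
  have h1 : IsCausalMultiplier fun x : ℝ => (1 - exp (-(I * x * τ))) * ((1 + I * x) / (I * x)) := by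
    let ε : ℕ → ℝ := fun j => ((j : ℝ) + 1)⁻¹
    have hε : ∀ j, 0 < ε j := fun j => by positivity
    have hε0 : Tendsto ε atTop (𝓝 0) := by
      simpa [ε] using tendsto_one_div_add_atTop_nhds_zero_nat (𝕜 := ℝ)
    refine IsCausalMultiplier.of_tendsto (K := |τ| + 2)
      (m := fun j (x : ℝ) => (1 - exp (-(I * x * τ))) * ((1 + I * x) / (ε j + I * x)))
      (fun j => ?_) (fun j x => ?_) (norm_incFactor_le τ) ?_
    · refine IsCausalMultiplier.mul ?_ ?_
      · have := (IsCausalMultiplier.const 1).sub (IsCausalMultiplier.exp_nonpos (s := -τ)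
          (by linarith))
        simpa using this
      · have := (IsCausalMultiplier.const 1).add ((IsCausalMultiplier.const (1 - ε j)).mul
          (IsCausalMultiplier.inv_add_I_mul (hε j)))
        convert this using 2 with x
        have := add_I_mul_ne_zero (hε j).ne' x
        field_simp
        ring
    · refine le_trans ?_ (norm_incFactor_le τ x)
      by_cases hx : x = 0
      · subst hx; simp
      rw [norm_mul, norm_mul, norm_div, norm_div]
      have hxn : 0 < ‖I * (x : ℂ)‖ := by simpa using hx
      have hle : ‖I * (x : ℂ)‖ ≤ ‖(ε j : ℂ) + I * x‖ := by
        have := abs_im_le_norm ((ε j : ℂ) + I * x)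
        simpa using this
      gcongr
    · filter_upwards [ae_ne_zero] with x hx
      have hx' : I * (x : ℂ) ≠ 0 := by simpa using hx
      have h2 : Tendsto (fun j => (ε j : ℂ) + I * x) atTop (𝓝 (I * x)) := by
        have := ((continuous_ofReal.tendsto 0).comp hε0).add_const (I * (x : ℂ))
        simpa using this
      exact (tendsto_const_nhds.div h2 hx').const_mul _
  have := (IsCausalMultiplier.exp_nonpos ht).mul (h1.pow n)
  convert this using 2 with x
  exact obsFunction_eq n τ t x

/-- The generating function of the observations is outer: it has approximate inverses which are
causal multipliers. -/
lemma exists_tendsto_obsFunction_mul (n : ℕ) {τ : ℝ} (hτ : 0 < τ) :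
    ∃ ψ : ℕ → ℝ → ℂ, (∀ j, IsCausalMultiplier (ψ j)) ∧
      (∀ j x, ‖obsFunction n τ 0 x * ψ j x‖ ≤ 1) ∧
      ∀ᵐ x, Tendsto (fun j => obsFunction n τ 0 x * ψ j x) atTop (𝓝 1) := by
  let ε : ℕ → ℝ := fun j => ((j : ℝ) + 1)⁻¹
  have hε : ∀ j, 0 < ε j := fun j => by positivity
  have hε0 : Tendsto ε atTop (𝓝 0) := by
    simpa [ε] using tendsto_one_div_add_atTop_nhds_zero_nat (𝕜 := ℝ)
  let ψ : ℕ → ℝ → ℂ := fun j x =>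
    ((1 - (1 + I * x)⁻¹) * (1 + ε j - exp (-(I * x * τ)))⁻¹) ^ n
  have hle : ∀ j (x : ℝ), ‖1 - exp (-(I * x * τ))‖ ≤ ‖1 + ε j - exp (-(I * x * τ))‖ := by
    intro j x
    set z := exp (-(I * x * τ)) with hz
    have hz1 : ‖z‖ = 1 := norm_exp_neg_I_mul x τ
    have hre : z.re ≤ 1 := hz1 ▸ re_le_norm z
    refine (sq_le_sq₀ (norm_nonneg _) (norm_nonneg _)).1 ?_
    rw [← normSq_eq_norm_sq, ← normSq_eq_norm_sq, normSq_apply, normSq_apply]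
    simp
    nlinarith [hε j]
  have hbψ : ∀ j (x : ℝ), x ≠ 0 → obsFunction n τ 0 x * ψ j x
      = ((1 - exp (-(I * x * τ))) / (1 + ε j - exp (-(I * x * τ)))) ^ n := by
    intro j x hx
    have hx' : (x : ℂ) ≠ 0 := by exact_mod_cast hx
    have h1 := one_add_I_mul_ne_zero x
    rw [obsFunction_eq]
    simp only [ψ]
    rw [ofReal_zero, mul_zero, Complex.exp_zero, one_mul, ← mul_pow]
    congr 1
    have h2 : (1 - (1 + I * (x : ℂ))⁻¹) = I * x / (1 + I * x) := by
      field_simp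
      ring
    rw [h2]
    field_simp
  refine ⟨ψ, fun j => ?_, fun j x => ?_, ?_⟩
  · refine IsCausalMultiplier.pow (IsCausalMultiplier.mul ?_ ?_) n
    · have := (IsCausalMultiplier.const 1).sub (IsCausalMultiplier.inv_add_I_mul one_pos)
      simpa using this
    · have h1 : (0 : ℝ) < 1 + ε j := by linarith [hε j]
      have h2 := (IsCausalMultiplier.const ((1 + ε j : ℝ) : ℂ)⁻¹).mul
        (IsCausalMultiplier.inv_one_sub (IsCausalMultiplier.exp_nonpos (s := -τ) (by linarith))
        (fun x => (norm_exp_I_mul x _).le) (ρ := (1 + ε j)⁻¹) (by positivity)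
        (inv_lt_one_of_one_lt₀ (by linarith [hε j])))
      convert h2 using 2 with x
      have h3 : ((1 + ε j : ℝ) : ℂ) ≠ 0 := by exact_mod_cast h1.ne'
      rw [← mul_inv]
      congr 1
      push_cast at h3 ⊢
      rw [mul_sub, mul_one, mul_inv_cancel_left₀ h3]
      ring_nf
  · by_cases hx : x = 0
    · subst hx
      by_cases hn : n = 0
      · subst hn; simp [obsFunction, ψ]
      · simp [obsFunction, hn]
    rw [hbψ j x hx, norm_pow, norm_div]
    exact pow_le_one₀ (by positivity) (div_le_one_of_le₀ (hle j x) (norm_nonneg _))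
  · filter_upwards [ae_ne_zero, ae_exp_ne_one hτ.ne'] with x hx hx1
    simp_rw [hbψ _ x hx]
    have h1 : 1 - exp (-(I * x * τ)) ≠ 0 := sub_ne_zero.2 hx1.symm
    have h2 : Tendsto (fun j => 1 + (ε j : ℂ) - exp (-(I * x * τ))) atTop
        (𝓝 (1 - exp (-(I * x * τ)))) := by
      have := (((continuous_ofReal.tendsto 0).comp hε0).const_add 1).sub_const
        (exp (-(I * x * τ)))
      simpa using this
    have h3 := ((tendsto_const_nhds (x := 1 - exp (-(I * x * τ)))).div h2 h1).pow n
    rwa [div_self h1, one_pow] at h3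

/-! ### The Hilbert space `L₂(p)` and the subspace `L₂⁰(p)` -/

/-- Two non-negative integrable functions, as spectral densities of signal and noise. -/
structure IsDensityPair (f g : ℝ → ℝ) : Prop where
  measurable_signal : Measurable f
  measurable_noise : Measurable g
  signal_nonneg : ∀ x, 0 ≤ f x
  noise_nonneg : ∀ x, 0 ≤ g x
  integrable_signal : Integrable f
  integrable_noise : Integrable g

lemma isDensityPair_of_mem {P₁ P₂ : ℝ} {f g : ℝ → ℝ} (hf : f ∈ PowerClass P₁)
    (hg : g ∈ PowerClass P₂) : IsDensityPair f g :=
  ⟨hf.1, hg.1, hf.2.1, hg.2.1, hf.2.2.1, hg.2.2.1⟩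

/-- The measure `p dx` on the frequency axis. -/
noncomputable def obsMeasure (n : ℕ) (f g : ℝ → ℝ) : Measure ℝ :=
  volume.withDensity fun x => ENNReal.ofReal (obsDensity n f g x)

lemma norm_incRatio_sq (n : ℕ) (x : ℝ) :
    ‖incRatio n x‖ ^ 2 = x ^ (2 * n) / (1 + x ^ 2) ^ n := by
  rw [incRatio, norm_div, norm_pow, norm_pow, div_pow, ← pow_mul, ← pow_mul, mul_comm n 2, pow_mul,
    pow_mul ‖1 + I * (x : ℂ)‖, norm_one_add_I_mul_sq, norm_mul, norm_I, one_mul, norm_real,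
    Real.norm_eq_abs, sq_abs, pow_mul]

lemma norm_incRatio_le_one (n : ℕ) (x : ℝ) : ‖incRatio n x‖ ≤ 1 := by
  have h : x ^ (2 * n) ≤ (1 + x ^ 2) ^ n := by
    rw [pow_mul]
    exact pow_le_pow_left₀ (sq_nonneg x) (by linarith) n
  rw [← sq_le_one_iff₀ (norm_nonneg _), norm_incRatio_sq]
  exact div_le_one_of_le₀ h (by positivity)

lemma measurable_incRatio (n : ℕ) : Measurable (incRatio n) := by
  unfold incRatio
  fun_prop

lemma incRatio_ne_zero (n : ℕ) {x : ℝ} (hx : x ≠ 0) : incRatio n x ≠ 0 := by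
  have := one_add_I_mul_ne_zero x
  have hx' : (x : ℂ) ≠ 0 := by exact_mod_cast hx
  exact div_ne_zero (pow_ne_zero _ (mul_ne_zero I_ne_zero hx')) (pow_ne_zero _ this)

lemma obsDensity_eq (n : ℕ) (f g : ℝ → ℝ) (x : ℝ) :
    obsDensity n f g x = f x + ‖incRatio n x‖ ^ 2 * g x := by
  rw [norm_incRatio_sq, obsDensity]

lemma commonDenom_eq (n : ℕ) (f g : ℝ → ℝ) (x : ℝ) :
    commonDenom n f g x = (1 + x ^ 2) ^ n * obsDensity n f g x := by
  unfold commonDenom obsDensity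
  field_simp

namespace IsDensityPair

variable {f g : ℝ → ℝ} (h : IsDensityPair f g) (n : ℕ)
include h

lemma obsDensity_nonneg (x : ℝ) : 0 ≤ obsDensity n f g x := by
  have := h.signal_nonneg x
  have := h.noise_nonneg x
  rw [obsDensity_eq]
  positivity

lemma obsDensity_le (x : ℝ) : obsDensity n f g x ≤ f x + g x := by
  rw [obsDensity_eq]
  have h1 := norm_incRatio_le_one n x
  have h2 : ‖incRatio n x‖ ^ 2 ≤ 1 := pow_le_one₀ (norm_nonneg _) h1
  nlinarith [h.noise_nonneg x]

lemma signal_le_obsDensity (x : ℝ) : f x ≤ obsDensity n f g x := by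
  have := h.noise_nonneg x
  rw [obsDensity_eq, le_add_iff_nonneg_right]
  positivity

lemma noise_le_obsDensity (x : ℝ) : ‖incRatio n x‖ ^ 2 * g x ≤ obsDensity n f g x := by
  rw [obsDensity_eq, le_add_iff_nonneg_left]
  exact h.signal_nonneg x

lemma measurable_obsDensity : Measurable (obsDensity n f g) := by
  have := h.measurable_signal
  have := h.measurable_noise
  unfold obsDensity
  fun_prop

lemma integrable_obsDensity : Integrable (obsDensity n f g) := by
  refine (h.integrable_signal.add h.integrable_noise).mono'
    (h.measurable_obsDensity n).aestronglyMeasurable (ae_of_all _ fun x => ?_)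
  rw [Real.norm_of_nonneg (h.obsDensity_nonneg n x)]
  exact h.obsDensity_le n x

lemma isFiniteMeasure : IsFiniteMeasure (obsMeasure n f g) :=
  isFiniteMeasure_withDensity_ofReal (h.integrable_obsDensity n).2

lemma integral_obsMeasure (φ : ℝ → ℂ) :
    ∫ x, φ x ∂(obsMeasure n f g) = ∫ x, φ x * (obsDensity n f g x : ℂ) := by
  rw [obsMeasure, integral_withDensity_eq_integral_toReal_smul₀
    (h.measurable_obsDensity n).ennreal_ofReal.aemeasurable
    (ae_of_all _ fun x => ENNReal.ofReal_lt_top)]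
  refine integral_congr_ae (ae_of_all _ fun x => ?_)
  simp only
  rw [ENNReal.toReal_ofReal (h.obsDensity_nonneg n x), real_smul, mul_comm]

lemma integral_obsMeasure_real (φ : ℝ → ℝ) :
    ∫ x, φ x ∂(obsMeasure n f g) = ∫ x, φ x * obsDensity n f g x := by
  rw [obsMeasure, integral_withDensity_eq_integral_toReal_smul₀
    (h.measurable_obsDensity n).ennreal_ofReal.aemeasurable
    (ae_of_all _ fun x => ENNReal.ofReal_lt_top)]
  refine integral_congr_ae (ae_of_all _ fun x => ?_)
  simp only
  rw [ENNReal.toReal_ofReal (h.obsDensity_nonneg n x), smul_eq_mul, mul_comm]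

lemma integrable_obsMeasure_iff {φ : ℝ → ℂ} :
    Integrable φ (obsMeasure n f g) ↔ Integrable fun x => φ x * (obsDensity n f g x : ℂ) := by
  rw [obsMeasure, integrable_withDensity_iff_integrable_smul₀'
    (h.measurable_obsDensity n).ennreal_ofReal.aemeasurable
    (ae_of_all _ fun x => ENNReal.ofReal_lt_top)]
  refine integrable_congr (ae_of_all _ fun x => ?_)
  simp only
  rw [ENNReal.toReal_ofReal (h.obsDensity_nonneg n x), real_smul, mul_comm]

lemma lintegral_obsMeasure (φ : ℝ → ℝ≥0∞) :
    ∫⁻ x, φ x ∂(obsMeasure n f g) = ∫⁻ x, φ x * ENNReal.ofReal (obsDensity n f g x) := by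
  rw [obsMeasure, lintegral_withDensity_eq_lintegral_mul_non_measurable _
    (h.measurable_obsDensity n).ennreal_ofReal (ae_of_all _ fun x => ENNReal.ofReal_lt_top)]
  simp [mul_comm]

lemma sqNormObs_eq (u : ℝ → ℂ) : sqNormObs n f g u = eLpNorm u 2 (obsMeasure n f g) ^ 2 := by
  have h1 := eLpNorm_nnreal_pow_eq_lintegral (μ := obsMeasure n f g) (f := u) (p := 2) two_ne_zero
  have h2 : ((2 : NNReal) : ℝ) = (2 : ℕ) := by norm_num
  rw [h2] at h1
  simp only [ENNReal.rpow_natCast] at h1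
  have h3 : ((2 : NNReal) : ℝ≥0∞) = 2 := by norm_num
  rw [h3] at h1
  rw [h1, h.lintegral_obsMeasure, sqNormObs]
  refine lintegral_congr fun x => ?_
  rw [ENNReal.ofReal_mul (by positivity), ← ofReal_norm, ENNReal.ofReal_pow (norm_nonneg _)]

lemma memLp_iff {u : ℝ → ℂ} (hu : AEStronglyMeasurable u) :
    MemLp u 2 (obsMeasure n f g) ↔ sqNormObs n f g u < ∞ := by
  rw [h.sqNormObs_eq, MemLp]
  have : AEStronglyMeasurable u (obsMeasure n f g) :=
    hu.mono_ac (withDensity_absolutelyContinuous _ _)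
  simp [this, lt_top_iff_ne_top]

lemma memLp_of_bound {u : ℝ → ℂ} (hu : AEStronglyMeasurable u) {K : ℝ} (hK : ∀ᵐ x, ‖u x‖ ≤ K) :
    MemLp u 2 (obsMeasure n f g) := by
  have := h.isFiniteMeasure n
  exact MemLp.of_bound (hu.mono_ac (withDensity_absolutelyContinuous _ _)) K
    ((withDensity_absolutelyContinuous _ _).ae_le hK)

lemma memLp_obsFunction (τ t : ℝ) : MemLp (obsFunction n τ t) 2 (obsMeasure n f g) :=
  h.memLp_of_bound n (measurable_obsFunction n τ t).aestronglyMeasurable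
    (ae_of_all _ (norm_obsFunction_le n τ t))

end IsDensityPair

lemma integral_conj_mul_eq_inner {ν : Measure ℝ} {u v : ℝ → ℂ} (hu : MemLp u 2 ν)
    (hv : MemLp v 2 ν) : inner ℂ (hu.toLp u) (hv.toLp v) = ∫ x, conj (u x) * v x ∂ν := by
  rw [L2.inner_def]
  refine integral_congr_ae ?_
  filter_upwards [hu.coeFn_toLp, hv.coeFn_toLp] with x h1 h2
  rw [h1, h2, RCLike.inner_apply, mul_comm]

/-- The function `e^{ixt} (1 - e^{-ixτ})^n (1 + ix)^n / (ix)^n` as an element of `L₂(p)`. -/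
noncomputable def obsLp (n : ℕ) (τ : ℝ) {f g : ℝ → ℝ} (h : IsDensityPair f g) (t : ℝ) :
    Lp ℂ 2 (obsMeasure n f g) :=
  (h.memLp_obsFunction n τ t).toLp _

/-- The closed linear span of the functions `obsFunction n τ t`, `t ≤ 0`, as a subspace of
`L₂(p)`. -/
noncomputable def obsSubmodule (n : ℕ) (τ : ℝ) {f g : ℝ → ℝ} (h : IsDensityPair f g) :
    Submodule ℂ (Lp ℂ 2 (obsMeasure n f g)) :=
  (Submodule.span ℂ (obsLp n τ h '' Set.Iic 0)).topologicalClosure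

/-- The finite linear combinations of the functions `obsFunction n τ t`. -/
noncomputable def obsComb (n : ℕ) (τ : ℝ) (c : ℝ →₀ ℂ) (x : ℝ) : ℂ :=
  c.sum fun t z => z * obsFunction n τ t x

lemma memLp_obsComb (n : ℕ) (τ : ℝ) {f g : ℝ → ℝ} (h : IsDensityPair f g) (c : ℝ →₀ ℂ) :
    MemLp (obsComb n τ c) 2 (obsMeasure n f g) := by
  unfold obsComb Finsupp.sum
  exact memLp_finsetSum _ fun t _ => (h.memLp_obsFunction n τ t).const_mul _

lemma coeFn_sum_smul {α ι : Type*} [MeasurableSpace α] {ν : Measure α} (s : Finset ι) (c : ι → ℂ)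
    (F : ι → Lp ℂ 2 ν) :
    ((∑ i ∈ s, c i • F i : Lp ℂ 2 ν) : α → ℂ) =ᵐ[ν] fun x => ∑ i ∈ s, c i * F i x := by
  classical
  induction s using Finset.induction_on with
  | empty =>
    simp only [Finset.sum_empty]
    exact Lp.coeFn_zero _ _ _
  | insert i s hi ih =>
    simp_rw [Finset.sum_insert hi]
    filter_upwards [Lp.coeFn_add (c i • F i) (∑ i ∈ s, c i • F i), Lp.coeFn_smul (c i) (F i), ih]
      with x h1 h2 h3
    rw [h1, Pi.add_apply, h2, h3, Pi.smul_apply, smul_eq_mul]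

lemma toLp_obsComb (n : ℕ) (τ : ℝ) {f g : ℝ → ℝ} (h : IsDensityPair f g) (c : ℝ →₀ ℂ) :
    (memLp_obsComb n τ h c).toLp _ = Finsupp.linearCombination ℂ (obsLp n τ h) c := by
  rw [Finsupp.linearCombination_apply]
  unfold Finsupp.sum
  rw [Lp.ext_iff]
  refine (MemLp.coeFn_toLp _).trans (EventuallyEq.trans ?_ (coeFn_sum_smul _ _ _).symm)
  have h1 : ∀ᵐ x ∂(obsMeasure n f g), ∀ t ∈ c.support, obsLp n τ h t x = obsFunction n τ t x :=
    (ae_ball_iff c.support.countable_toSet).2 fun t _ => (h.memLp_obsFunction n τ t).coeFn_toLp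
  filter_upwards [h1] with x hx
  exact Finset.sum_congr rfl fun t ht => by rw [hx t ht]

lemma sqNormObs_sub_obsComb {n : ℕ} {τ : ℝ} {f g : ℝ → ℝ} (h : IsDensityPair f g)
    {u : ℝ → ℂ} (hL : MemLp u 2 (obsMeasure n f g)) (c : ℝ →₀ ℂ) :
    sqNormObs n f g (fun x => u x - c.sum fun t z => z * obsFunction n τ t x)
      = ENNReal.ofReal ‖hL.toLp u - Finsupp.linearCombination ℂ (obsLp n τ h) c‖ ^ 2 := by
  rw [h.sqNormObs_eq, ← toLp_obsComb, ← MemLp.toLp_sub, Lp.norm_toLp,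
    ENNReal.ofReal_toReal (hL.sub (memLp_obsComb n τ h c)).2.ne]
  rfl

lemma exists_ofReal_pow_lt {ε : ℝ≥0∞} (hε : 0 < ε) :
    ∃ δ : ℝ, 0 < δ ∧ ENNReal.ofReal δ ^ 2 < ε ∧ ENNReal.ofReal δ < ε := by
  have h1 : Tendsto ENNReal.ofReal (𝓝[>] 0) (𝓝 0) := by
    simpa using (ENNReal.continuous_ofReal.tendsto 0).mono_left nhdsWithin_le_nhds
  have h2 : Tendsto (fun δ : ℝ => ENNReal.ofReal δ ^ 2) (𝓝[>] 0) (𝓝 0) := by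
    simpa [Function.comp_def] using ((ENNReal.continuous_pow 2).tendsto 0).comp h1
  obtain ⟨δ, h3, h4, h5⟩ := ((h2.eventually_lt_const hε).and
    ((h1.eventually_lt_const hε).and self_mem_nhdsWithin)).exists
  exact ⟨δ, h5, h3, h4⟩

lemma mem_L20_iff_mem_obsSubmodule {n : ℕ} {τ : ℝ} {f g : ℝ → ℝ} (h : IsDensityPair f g)
    {u : ℝ → ℂ} (hu : AEStronglyMeasurable u) (hL : MemLp u 2 (obsMeasure n f g)) :
    u ∈ L20 n τ f g ↔ hL.toLp u ∈ obsSubmodule n τ h := by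
  have h2 : u ∈ L20 n τ f g ↔ ∀ ε : ℝ≥0∞, 0 < ε → ∃ c : ℝ →₀ ℂ, (∀ t ∈ c.support, t ≤ 0) ∧
      sqNormObs n f g (fun x => u x - c.sum fun t z => z * obsFunction n τ t x) < ε :=
    ⟨fun H => H.2.2, fun H => ⟨hu, (h.memLp_iff n hu).1 hL, H⟩⟩
  rw [h2, obsSubmodule, ← SetLike.mem_coe, Submodule.topologicalClosure_coe, Metric.mem_closure_iff]
  simp_rw [sqNormObs_sub_obsComb h hL, dist_eq_norm]
  constructor
  · intro H ε hε
    obtain ⟨c, hc, hlt⟩ := H (ENNReal.ofReal ε ^ 2) (by positivity)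
    refine ⟨_, (Finsupp.mem_span_image_iff_linearCombination ℂ).2 ⟨c, ?_, rfl⟩, ?_⟩
    · exact (Finsupp.mem_supported ℂ c).2 fun t ht => hc t ht
    · exact (ENNReal.ofReal_lt_ofReal_iff hε).1 ((ENNReal.pow_lt_pow_left_iff two_ne_zero).1 hlt)
  · intro H ε hε
    obtain ⟨δ, hδ0, hδ, -⟩ := exists_ofReal_pow_lt hε
    obtain ⟨y, hy, hlt⟩ := H δ hδ0
    obtain ⟨c, hc, rfl⟩ := (Finsupp.mem_span_image_iff_linearCombination ℂ).1 hy
    refine ⟨c, fun t ht => (Finsupp.mem_supported ℂ c).1 hc ht, lt_of_le_of_lt ?_ hδ⟩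
    gcongr

lemma memLp_of_mem_L20 {n : ℕ} {τ : ℝ} {f g : ℝ → ℝ} (h : IsDensityPair f g) {u : ℝ → ℂ}
    (hu : u ∈ L20 n τ f g) : MemLp u 2 (obsMeasure n f g) :=
  (h.memLp_iff n hu.1).2 hu.2.1

/-- Functions orthogonal in `L₂(p)` to the functions `obsFunction n τ t`, `t ≤ 0`. -/
def OrthogonalToObs (n : ℕ) (τ : ℝ) (f g : ℝ → ℝ) (v : ℝ → ℂ) : Prop :=
  MemLp v 2 (obsMeasure n f g) ∧
    ∀ t ≤ 0, ∫ x, conj (v x) * obsFunction n τ t x ∂(obsMeasure n f g) = 0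

lemma toLp_mem_orthogonal_iff {n : ℕ} {τ : ℝ} {f g : ℝ → ℝ} (h : IsDensityPair f g) {v : ℝ → ℂ}
    (hv : MemLp v 2 (obsMeasure n f g)) :
    hv.toLp v ∈ (obsSubmodule n τ h)ᗮ ↔ OrthogonalToObs n τ f g v := by
  rw [obsSubmodule, Submodule.orthogonal_closure, Submodule.mem_orthogonal']
  constructor
  · intro H
    refine ⟨hv, fun t ht => ?_⟩
    have := H _ (Submodule.subset_span ⟨t, ht, rfl⟩)
    rwa [obsLp, integral_conj_mul_eq_inner] at this
  · intro H y hy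
    induction hy using Submodule.span_induction with
    | mem y hy =>
      obtain ⟨t, ht, rfl⟩ := hy
      rw [obsLp, integral_conj_mul_eq_inner]
      exact H.2 t ht
    | zero => simp
    | add y z _ _ h1 h2 => rw [inner_add_right, h1, h2, add_zero]
    | smul c y _ h1 => rw [inner_smul_right, h1, mul_zero]

/-- `L₂⁰(p)` is the orthogonal complement of its orthogonal complement. -/
lemma mem_L20_iff {n : ℕ} {τ : ℝ} {f g : ℝ → ℝ} (h : IsDensityPair f g) {u : ℝ → ℂ} :
    u ∈ L20 n τ f g ↔ AEStronglyMeasurable u ∧ MemLp u 2 (obsMeasure n f g) ∧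
      ∀ v, OrthogonalToObs n τ f g v → ∫ x, conj (v x) * u x ∂(obsMeasure n f g) = 0 := by
  constructor
  · intro hu
    have hL := memLp_of_mem_L20 h hu
    refine ⟨hu.1, hL, fun v hv => ?_⟩
    rw [← integral_conj_mul_eq_inner hv.1 hL]
    exact (Submodule.mem_orthogonal' _ _).1 ((toLp_mem_orthogonal_iff h hv.1).2 hv) _
      ((mem_L20_iff_mem_obsSubmodule h hu.1 hL).1 hu)
  · rintro ⟨hu, hL, H⟩
    rw [mem_L20_iff_mem_obsSubmodule h hu hL]
    have hcl : (obsSubmodule n τ h)ᗮᗮ = obsSubmodule n τ h := by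
      rw [Submodule.orthogonal_orthogonal_eq_closure, obsSubmodule]
      exact (Submodule.isClosed_topologicalClosure _).submodule_topologicalClosure_eq
    rw [← hcl, Submodule.mem_orthogonal]
    intro y hy
    have hy1 : (Lp.memLp y).toLp y = y := Lp.toLp_coeFn y _
    rw [← hy1] at hy ⊢
    rw [integral_conj_mul_eq_inner]
    exact H _ ((toLp_mem_orthogonal_iff h _).1 hy)

lemma integral_conj_mul_eq_zero {n : ℕ} {τ : ℝ} {f g : ℝ → ℝ} (h : IsDensityPair f g)
    {u v : ℝ → ℂ} (hu : u ∈ L20 n τ f g) (hv : OrthogonalToObs n τ f g v) :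
    ∫ x, conj (v x) * u x ∂(obsMeasure n f g) = 0 :=
  ((mem_L20_iff h).1 hu).2.2 v hv

/-- Orthogonal projection onto `L₂⁰(p)`. -/
lemma exists_mem_L20_orthogonal {n : ℕ} {τ : ℝ} {f g : ℝ → ℝ} (h : IsDensityPair f g) {w : ℝ → ℂ}
    (hw : MemLp w 2 (obsMeasure n f g)) :
    ∃ u ∈ L20 n τ f g, OrthogonalToObs n τ f g fun x => w x - u x := by
  have : CompleteSpace (obsSubmodule n τ h) :=
    inferInstanceAs (CompleteSpace (Submodule.topologicalClosure _))
  let y := (obsSubmodule n τ h).starProjection (hw.toLp w)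
  have hy1 : (Lp.memLp y).toLp y = y := Lp.toLp_coeFn y _
  refine ⟨y, ?_, ?_⟩
  · rw [mem_L20_iff_mem_obsSubmodule h (Lp.stronglyMeasurable y).aestronglyMeasurable (Lp.memLp y),
      hy1]
    exact Submodule.starProjection_apply_mem _ _
  · refine (toLp_mem_orthogonal_iff h (hw.sub (Lp.memLp y))).1 ?_
    rw [MemLp.toLp_sub hw (Lp.memLp y), hy1]
    exact Submodule.sub_starProjection_mem_orthogonal _

lemma obsFunction_mem_L20 {n : ℕ} {τ : ℝ} {f g : ℝ → ℝ} (h : IsDensityPair f g) {t : ℝ}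
    (ht : t ≤ 0) : obsFunction n τ t ∈ L20 n τ f g :=
  (mem_L20_iff h).2 ⟨(measurable_obsFunction n τ t).aestronglyMeasurable,
    h.memLp_obsFunction n τ t, fun _ hv => hv.2 t ht⟩

lemma integrable_conj_mul {ν : Measure ℝ} {u v : ℝ → ℂ} (hu : MemLp u 2 ν) (hv : MemLp v 2 ν) :
    Integrable (fun x => conj (u x) * v x) ν := by
  exact (hu.star).integrable_mul hv

/-- An element of `L₂(p)` is orthogonal to the observations if and only if its product with the
generating function and the density is annihilated by the exponentials `e^{ixt}`, `t ≤ 0`. -/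
lemma orthogonalToObs_iff_annihilates {n : ℕ} {τ : ℝ} {f g : ℝ → ℝ} (h : IsDensityPair f g)
    {v : ℝ → ℂ} (hv : MemLp v 2 (obsMeasure n f g)) :
    OrthogonalToObs n τ f g v ↔
      Annihilates fun x => obsFunction n τ 0 x * (conj (v x) * (obsDensity n f g x : ℂ)) := by
  have hi : Integrable fun x => obsFunction n τ 0 x * (conj (v x) * (obsDensity n f g x : ℂ)) := by
    have := integrable_conj_mul hv (h.memLp_obsFunction n τ 0)
    rw [h.integrable_obsMeasure_iff] at this
    refine this.congr (ae_of_all _ fun x => ?_)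
    simp only
    ring
  have he : ∀ t, ∫ x, conj (v x) * obsFunction n τ t x ∂(obsMeasure n f g) =
      ∫ x : ℝ, exp (I * x * t)
        * (obsFunction n τ 0 x * (conj (v x) * (obsDensity n f g x : ℂ))) := by
    intro t
    rw [h.integral_obsMeasure]
    refine integral_congr_ae (ae_of_all _ fun x => ?_)
    simp only
    rw [obsFunction_eq_exp_mul]
    ring
  simp only [OrthogonalToObs, Annihilates, hv, hi, true_and, he]

/-- The orthogonal complement of `L₂⁰(p)` is invariant under the conjugates of causal
multipliers. -/
lemma OrthogonalToObs.conj_mul {n : ℕ} {τ : ℝ} {f g : ℝ → ℝ} (h : IsDensityPair f g)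
    {m v : ℝ → ℂ} (hm : IsCausalMultiplier m) (hv : OrthogonalToObs n τ f g v) :
    OrthogonalToObs n τ f g fun x => conj (m x) * v x := by
  obtain ⟨K, hK⟩ := hm.bounded
  have hL : MemLp (fun x => conj (m x) * v x) 2 (obsMeasure n f g) := by
    refine MemLp.of_le_mul (c := K) hv.1 ?_ (ae_of_all _ fun x => ?_)
    · exact ((hm.1.mono_ac (withDensity_absolutelyContinuous _ _)).star).mul hv.1.1
    · rw [norm_mul, RCLike.norm_conj]
      exact mul_le_mul_of_nonneg_right (hK x) (norm_nonneg _)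
  rw [orthogonalToObs_iff_annihilates h hL]
  refine (hm.map _ ((orthogonalToObs_iff_annihilates h hv.1).1 hv)).congr (ae_of_all _ fun x => ?_)
  simp only [map_mul, conj_conj]
  ring

/-- `L₂⁰(p)` is invariant under causal multipliers. -/
lemma IsCausalMultiplier.mul_mem_L20 {n : ℕ} {τ : ℝ} {f g : ℝ → ℝ} (h : IsDensityPair f g)
    {m u : ℝ → ℂ} (hm : IsCausalMultiplier m) (hu : u ∈ L20 n τ f g) :
    (fun x => m x * u x) ∈ L20 n τ f g := by
  obtain ⟨K, hK⟩ := hm.bounded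
  have hL := memLp_of_mem_L20 h hu
  rw [mem_L20_iff h]
  refine ⟨hm.1.mul hu.1, ?_, fun v hv => ?_⟩
  · refine MemLp.of_le_mul (c := K) hL ?_ (ae_of_all _ fun x => ?_)
    · exact (hm.1.mono_ac (withDensity_absolutelyContinuous _ _)).mul hL.1
    · rw [norm_mul]
      exact mul_le_mul_of_nonneg_right (hK x) (norm_nonneg _)
  · rw [← integral_conj_mul_eq_zero h hu (hv.conj_mul h hm)]
    refine integral_congr_ae (ae_of_all _ fun x => ?_)
    simp only [map_mul, conj_conj]
    ring

/-- Bounded almost everywhere limits of uniformly bounded elements of `L₂⁰(p)`. -/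
lemma mem_L20_of_tendsto {n : ℕ} {τ : ℝ} {f g : ℝ → ℝ} (h : IsDensityPair f g) {u : ℕ → ℝ → ℂ}
    {l : ℝ → ℂ} {K : ℝ} (hu : ∀ j, u j ∈ L20 n τ f g) (hK : ∀ j x, ‖u j x‖ ≤ K)
    (hl : ∀ᵐ x, Tendsto (fun j => u j x) atTop (𝓝 (l x))) : l ∈ L20 n τ f g := by
  have hlm : AEStronglyMeasurable l := aestronglyMeasurable_of_tendsto_ae _ (fun j => (hu j).1) hl
  have hlK : ∀ᵐ x, ‖l x‖ ≤ K := by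
    filter_upwards [hl] with x hx
    exact le_of_tendsto hx.norm (Eventually.of_forall fun j => hK j x)
  have hac : obsMeasure n f g ≪ volume := withDensity_absolutelyContinuous _ _
  have := h.isFiniteMeasure n
  rw [mem_L20_iff h]
  refine ⟨hlm, h.memLp_of_bound n hlm hlK, fun v hv => ?_⟩
  have hv1 : Integrable v (obsMeasure n f g) := hv.1.integrable (by norm_num)
  refine tendsto_nhds_unique (f := fun j => ∫ x, conj (v x) * u j x ∂(obsMeasure n f g))
    (l := atTop) ?_ ?_
  · refine tendsto_integral_of_dominated_convergence (fun x => ‖v x‖ * K) (fun j => ?_)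
      (hv1.norm.mul_const K) (fun j => ae_of_all _ fun x => ?_) ?_
    · exact (hv1.1.star).mul ((hu j).1.mono_ac hac)
    · rw [norm_mul, RCLike.norm_conj]
      exact mul_le_mul_of_nonneg_left (hK j x) (norm_nonneg _)
    · filter_upwards [hac.ae_le hl] with x hx
      exact hx.const_mul _
  · simp_rw [integral_conj_mul_eq_zero h (hu _) hv]
    exact tendsto_const_nhds

/-- Since the generating function of the observations is outer, `L₂⁰(p)` contains all causal
multipliers, whatever the density `p` is. -/
lemma IsCausalMultiplier.mem_L20 {n : ℕ} {τ : ℝ} (hτ : 0 < τ) {f g : ℝ → ℝ}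
    (h : IsDensityPair f g) {m : ℝ → ℂ} (hm : IsCausalMultiplier m) : m ∈ L20 n τ f g := by
  have h1 : (fun _ => 1) ∈ L20 n τ f g := by
    obtain ⟨ψ, hψ, hbd, hlim⟩ := exists_tendsto_obsFunction_mul n hτ
    refine mem_L20_of_tendsto h (u := fun j x => obsFunction n τ 0 x * ψ j x) (fun j => ?_) hbd hlim
    simpa [mul_comm] using (hψ j).mul_mem_L20 h (obsFunction_mem_L20 h (le_refl (0 : ℝ)))
  simpa using hm.mul_mem_L20 h h1

/-! ### Bounded elements of `L₂⁰(p)` belong to all these spaces -/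

lemma ae_obsFunction_ne_zero (n : ℕ) {τ : ℝ} (hτ : τ ≠ 0) (t : ℝ) :
    ∀ᵐ x, obsFunction n τ t x ≠ 0 := by
  filter_upwards [ae_ne_zero, ae_exp_ne_one hτ] with x hx hx1
  have h1 : 1 - exp (-(I * x * τ)) ≠ 0 := sub_ne_zero.2 hx1.symm
  have h2 := one_add_I_mul_ne_zero x
  have hx' : (x : ℂ) ≠ 0 := by exact_mod_cast hx
  exact mul_ne_zero (mul_ne_zero (Complex.exp_ne_zero _) (pow_ne_zero _ h1))
    (div_ne_zero (pow_ne_zero _ h2) (pow_ne_zero _ (mul_ne_zero I_ne_zero hx')))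

section

variable {n : ℕ} {τ : ℝ} {f g : ℝ → ℝ}

/-- If `L₂⁰(p)` is a proper subspace, it is not invariant under division by the Cayley transform:
otherwise its orthogonal complement would be invariant under multiplication by the Cayley transform,
and a non-zero element of the complement would give a non-zero integrable function whose integrals
against all integral powers of the Cayley transform vanish. -/
lemma exists_not_orthogonalToObs_cayley_mul (hτ : τ ≠ 0) (h : IsDensityPair f g)
    (hp : ∀ᵐ x, 0 < obsDensity n f g x)
    (hne : ∃ v, OrthogonalToObs n τ f g v ∧ ¬ v =ᵐ[volume] 0) :
    ∃ v, OrthogonalToObs n τ f g v ∧ ¬ OrthogonalToObs n τ f g fun x => cayley x * v x := by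
  by_contra! H
  obtain ⟨v, hv, hv0⟩ := hne
  have hpow : ∀ j : ℕ, OrthogonalToObs n τ f g fun x => cayley x ^ j * v x := by
    intro j
    induction j with
    | zero => simpa using hv
    | succ j ih => simpa [pow_succ', mul_assoc] using H _ ih
  have hA := (orthogonalToObs_iff_annihilates h hv.1).1 hv
  have hz := ae_eq_zero_of_integral_cayley hA.1 fun k => by
    obtain ⟨j, rfl | rfl⟩ := k.eq_nat_or_neg
    · simpa using ((isCausalMultiplier_cayley.pow j).map _ hA).integral_eq_zero
    · rw [← ((orthogonalToObs_iff_annihilates h (hpow j).1).1 (hpow j)).integral_eq_zero]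
      refine integral_congr_ae (ae_of_all _ fun x => ?_)
      simp only [map_mul, map_pow, conj_cayley, zpow_neg, zpow_natCast, inv_pow]
      ring
  refine hv0 ?_
  filter_upwards [hz, hp, ae_obsFunction_ne_zero n hτ 0] with x h1 h2 h3
  have h4 : (obsDensity n f g x : ℂ) ≠ 0 := by exact_mod_cast h2.ne'
  simpa [h3, h4] using h1

/-- A wandering vector of multiplication by the Cayley transform on `L₂⁰(p)`, as in the proof of
Beurling's theorem. -/
lemma exists_wandering (hτ : τ ≠ 0) (h : IsDensityPair f g)
    (hp : ∀ᵐ x, 0 < obsDensity n f g x)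
    (hne : ∃ v, OrthogonalToObs n τ f g v ∧ ¬ v =ᵐ[volume] 0) :
    ∃ θ ∈ L20 n τ f g, ¬ θ =ᵐ[obsMeasure n f g] 0 ∧
      ∀ m ∈ L20 n τ f g, ∫ x, conj (θ x) * (cayley x * m x) ∂(obsMeasure n f g) = 0 := by
  obtain ⟨v, hv, hv'⟩ := exists_not_orthogonalToObs_cayley_mul hτ h hp hne
  have hac : obsMeasure n f g ≪ volume := withDensity_absolutelyContinuous _ _
  have hL : MemLp (fun x => cayley x * v x) 2 (obsMeasure n f g) := by
    refine MemLp.of_le_mul (c := 1) hv.1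
      (continuous_cayley.aestronglyMeasurable.mul hv.1.1) (ae_of_all _ fun x => ?_)
    rw [norm_mul, norm_cayley]
  obtain ⟨θ, hθ, ho⟩ := exists_mem_L20_orthogonal (τ := τ) h hL
  refine ⟨θ, hθ, fun h0 => hv' ?_, fun m hm => ?_⟩
  · refine ⟨hL, fun t ht => ?_⟩
    rw [← ho.2 t ht]
    refine integral_congr_ae ?_
    filter_upwards [h0] with x hx
    rw [hx, Pi.zero_apply, sub_zero]
  · have hcm := isCausalMultiplier_cayley.mul_mem_L20 h hm
    have hcmL := memLp_of_mem_L20 h hcm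
    have h1 := integral_conj_mul_eq_zero h hcm ho
    have h2 := integral_conj_mul_eq_zero h hm hv
    have h3 : ∫ x, conj (cayley x * v x) * (cayley x * m x) ∂(obsMeasure n f g) = 0 := by
      rw [← h2]
      refine integral_congr_ae (ae_of_all _ fun x => ?_)
      simp only [map_mul, conj_cayley]
      have := cayley_ne_zero x
      field_simp
    simp only [map_sub, sub_mul] at h1
    rw [integral_sub (integrable_conj_mul hL hcmL)
      (integrable_conj_mul (memLp_of_mem_L20 h hθ) hcmL), h3, zero_sub, neg_eq_zero] at h1
    exact h1

/-- The modulus of a wandering vector is determined: `|θ|² p` is a multiple of the Cauchy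
density. -/
lemma norm_sq_wandering (h : IsDensityPair f g) {θ : ℝ → ℂ} (hθ : θ ∈ L20 n τ f g)
    (hθ0 : ¬ θ =ᵐ[obsMeasure n f g] 0)
    (ho : ∀ m ∈ L20 n τ f g, ∫ x, conj (θ x) * (cayley x * m x) ∂(obsMeasure n f g) = 0) :
    ∃ c : ℂ, c ≠ 0 ∧ ∀ᵐ x, conj (θ x) * θ x * (obsDensity n f g x : ℂ)
      = c * ((1 + x ^ 2)⁻¹ : ℝ) := by
  have hL := memLp_of_mem_L20 h hθ
  have hi : Integrable fun x => conj (θ x) * θ x * (obsDensity n f g x : ℂ) :=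
    (h.integrable_obsMeasure_iff n).1 (integrable_conj_mul hL hL)
  set ψ : ℝ → ℂ := fun x => conj (θ x) * θ x * (obsDensity n f g x : ℂ) with hψ
  have hψc : ∀ x, conj (ψ x) = ψ x := by
    intro x
    simp only [hψ, map_mul, conj_conj, conj_ofReal]
    ring
  have hpos : ∀ j : ℕ, ∫ x, cayley x ^ (j + 1) * ψ x = 0 := by
    intro j
    have := ho _ ((isCausalMultiplier_cayley.pow j).mul_mem_L20 h hθ)
    rw [h.integral_obsMeasure] at this
    rw [← this]
    refine integral_congr_ae (ae_of_all _ fun x => ?_)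
    simp only [hψ]
    ring
  have hneg : ∀ j : ℕ, ∫ x, (cayley x ^ (j + 1))⁻¹ * ψ x = 0 := by
    intro j
    have := congrArg conj (hpos j)
    rw [← integral_conj] at this
    simpa [hψc, conj_cayley, inv_pow] using this
  have hk : ∀ k : ℤ, k ≠ 0 → ∫ x, cayley x ^ k * ψ x = 0 := by
    intro k hk
    obtain ⟨j, rfl | rfl⟩ := k.eq_nat_or_neg
    · obtain ⟨i, rfl⟩ := Nat.exists_eq_succ_of_ne_zero (n := j) (by omega)
      exact_mod_cast hpos i
    · obtain ⟨i, rfl⟩ := Nat.exists_eq_succ_of_ne_zero (n := j) (by omega)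
      simp_rw [zpow_neg]
      exact_mod_cast hneg i
  have hπ : (Real.pi : ℂ) ≠ 0 := by exact_mod_cast Real.pi_ne_zero
  let c : ℂ := (∫ x, ψ x) / Real.pi
  have hci : Integrable fun x : ℝ => c * ((1 + x ^ 2)⁻¹ : ℝ) :=
    integrable_inv_one_add_sq.ofReal.const_mul c
  have hz := ae_eq_zero_of_integral_cayley (hi.sub hci) fun k => by
    simp only [Pi.sub_apply, mul_sub]
    rw [integral_sub (integrable_cayley_zpow_mul hi k) (integrable_cayley_zpow_mul hci k)]
    simp_rw [mul_left_comm _ c]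
    rw [integral_const_mul]
    by_cases h0 : k = 0
    · subst h0
      simp only [zpow_zero, one_mul]
      rw [integral_complex_ofReal, integral_univ_inv_one_add_sq, div_mul_cancel₀ _ hπ, sub_self]
    · rw [hk k h0, integral_cayley_zpow_cauchy h0, mul_zero, sub_zero]
  have hae : ∀ᵐ x, ψ x = c * ((1 + x ^ 2)⁻¹ : ℝ) := by
    filter_upwards [hz] with x hx
    exact sub_eq_zero.1 hx
  refine ⟨c, fun hc => hθ0 ?_, hae⟩
  rw [obsMeasure, EventuallyEq,
    ae_withDensity_iff (h.measurable_obsDensity n).ennreal_ofReal]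
  filter_upwards [hae] with x hx hpx
  have hp : (obsDensity n f g x : ℂ) ≠ 0 := by
    intro h0
    rw [ofReal_eq_zero] at h0
    simp [h0] at hpx
  rw [hc, zero_mul] at hx
  simpa [hψ, hp] using hx

/-- The product of a bounded element with an element of `L₂⁰(p)` is in `L₂⁰(p)`. -/
lemma mul_mem_L20_of_bounded (hτ : 0 ≤ τ) (h : IsDensityPair f g) {u θ : ℝ → ℂ}
    (hu : u ∈ L20 n τ f g) {K : ℝ} (hK : ∀ᵐ x, ‖u x‖ ≤ K) (hθ : θ ∈ L20 n τ f g) :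
    (fun x => u x * θ x) ∈ L20 n τ f g := by
  have hac : obsMeasure n f g ≪ volume := withDensity_absolutelyContinuous _ _
  have hb : ∀ {w : ℝ → ℂ}, MemLp w 2 (obsMeasure n f g) →
      MemLp (fun x => u x * w x) 2 (obsMeasure n f g) := by
    intro w hw
    refine MemLp.of_le_mul (c := K) hw ((hu.1.mono_ac hac).mul hw.1) ?_
    filter_upwards [hac.ae_le hK] with x hx
    rw [norm_mul]
    exact mul_le_mul_of_nonneg_right hx (norm_nonneg _)
  refine (mem_L20_iff h).2 ⟨hu.1.mul hθ.1, hb (memLp_of_mem_L20 h hθ), fun v hv => ?_⟩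
  have hw : OrthogonalToObs n τ f g fun x => conj (u x) * v x := by
    refine ⟨(hb hv.1.star).star.ae_eq (ae_of_all _ fun x => ?_), fun t ht => ?_⟩
    · simp
    · rw [← integral_conj_mul_eq_zero h hu
        (hv.conj_mul h (isCausalMultiplier_obsFunction n hτ ht))]
      refine integral_congr_ae (ae_of_all _ fun x => ?_)
      simp only [map_mul, conj_conj]
      ring
  rw [← integral_conj_mul_eq_zero h hθ hw]
  refine integral_congr_ae (ae_of_all _ fun x => ?_)
  simp only [map_mul, conj_conj]
  ring

/-- If `p > 0` almost everywhere and `L₂⁰(p)` is a proper subspace of `L₂(p)`, then its bounded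
elements have one-sided Fourier series in the Cayley coordinate, so that they belong to these
spaces for all densities. -/
lemma mem_L20_of_bounded (hτ : 0 < τ) (h : IsDensityPair f g)
    (hp : ∀ᵐ x, 0 < obsDensity n f g x)
    (hne : ∃ v, OrthogonalToObs n τ f g v ∧ ¬ v =ᵐ[volume] 0) {u : ℝ → ℂ}
    (hu : u ∈ L20 n τ f g) {K : ℝ} (hK : ∀ᵐ x, ‖u x‖ ≤ K) {f₁ g₁ : ℝ → ℝ}
    (h₁ : IsDensityPair f₁ g₁) : u ∈ L20 n τ f₁ g₁ := by
  obtain ⟨θ, hθ, hθ0, ho⟩ := exists_wandering hτ.ne' h hp hne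
  obtain ⟨c, hc, hcθ⟩ := norm_sq_wandering h hθ hθ0 ho
  have huθ := mul_mem_L20_of_bounded hτ.le h hu hK hθ
  have hcoef : ∀ k : ℕ, k ≠ 0 → ∫ x, cayley x ^ k * (u x * ((1 + x ^ 2)⁻¹ : ℝ)) = 0 := by
    intro k hk
    obtain ⟨j, rfl⟩ := Nat.exists_eq_succ_of_ne_zero hk
    have h1 := ho _ ((isCausalMultiplier_cayley.pow j).mul_mem_L20 h huθ)
    rw [h.integral_obsMeasure] at h1
    have h2 : ∫ x, c * (cayley x ^ (j + 1) * (u x * ((1 + x ^ 2)⁻¹ : ℝ))) = 0 := by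
      rw [← h1]
      refine integral_congr_ae ?_
      filter_upwards [hcθ] with x hx
      linear_combination (-(cayley x ^ (j + 1) * u x)) * hx
    rw [integral_const_mul] at h2
    exact (mul_eq_zero.1 h2).resolve_left hc
  obtain ⟨q, hq, hlim⟩ := exists_tendsto_polynomial_cayley hu.1 hK hcoef
  exact mem_L20_of_tendsto h₁
    (fun j => (isCausalMultiplier_cayley.polynomial_eval (q j)).mem_L20 hτ h₁) hq hlim

end

/-! ### The transform of the weight function -/

section

variable {a : ℝ → ℝ}

lemma integrableOn_mul_exp (ha : IntegrableOn a (Set.Ioi 0)) (x : ℝ) :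
    IntegrableOn (fun t : ℝ => (a t : ℂ) * exp (-(I * x * t))) (Set.Ioi 0) := by
  refine Integrable.mul_bdd (c := 1) ha.ofReal (by fun_prop) (ae_of_all _ fun t => ?_)
  rw [norm_exp_neg_I_mul]

lemma continuous_specA (ha : IntegrableOn a (Set.Ioi 0)) : Continuous (specA a) := by
  unfold specA
  refine continuous_of_dominated (bound := fun t => ‖a t‖)
    (fun x => (integrableOn_mul_exp ha x).aestronglyMeasurable)
    (fun x => ae_of_all _ fun t => ?_) ha.norm (ae_of_all _ fun t => by fun_prop)
  rw [norm_mul, norm_exp_neg_I_mul, mul_one, norm_real]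

lemma norm_specA_le (x : ℝ) : ‖specA a x‖ ≤ ∫ t in Set.Ioi (0 : ℝ), ‖a t‖ := by
  unfold specA
  refine (norm_integral_le_integral_norm _).trans (le_of_eq ?_)
  refine integral_congr_ae (ae_of_all _ fun t => ?_)
  simp only
  rw [norm_mul, norm_exp_neg_I_mul, mul_one, norm_real]

lemma integrable_prod_mul_exp (ha : IntegrableOn a (Set.Ioi 0)) {φ : ℝ → ℂ} (hφ : Integrable φ) :
    Integrable (fun z : ℝ × ℝ => (a z.1 : ℂ) * (exp (-(I * z.2 * z.1)) * φ z.2))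
      ((volume.restrict (Set.Ioi 0)).prod volume) := by
  have h1 := (Integrable.ofReal (𝕜 := ℂ) ha).mul_prod hφ
  refine (h1.bdd_mul (c := 1) (f := fun z : ℝ × ℝ => exp (-(I * z.2 * z.1))) (by fun_prop)
    (ae_of_all _ fun z => (norm_exp_neg_I_mul _ _).le)).congr (ae_of_all _ fun z => ?_)
  simp only [coe_algebraMap]
  ring

/-- Fubini's theorem for the transform of the weight function. -/
lemma integral_mul_integral_exp_neg (ha : IntegrableOn a (Set.Ioi 0)) {φ : ℝ → ℂ}
    (hφ : Integrable φ) :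
    ∫ t in Set.Ioi (0 : ℝ), (a t : ℂ) * ∫ x : ℝ, exp (-(I * x * t)) * φ x
      = ∫ x, specA a x * φ x := by
  simp_rw [← integral_const_mul]
  rw [integral_integral_swap (integrable_prod_mul_exp ha hφ)]
  refine integral_congr_ae (ae_of_all _ fun x => ?_)
  simp only [specA]
  rw [← integral_mul_const]
  refine integral_congr_ae (ae_of_all _ fun t => ?_)
  simp only
  ring

lemma integral_mul_integral_exp (ha : IntegrableOn a (Set.Ioi 0)) {φ : ℝ → ℂ}
    (hφ : Integrable φ) :
    ∫ t in Set.Ioi (0 : ℝ), (a t : ℂ) * ∫ x : ℝ, exp (I * x * t) * φ x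
      = ∫ x, conj (specA a x) * φ x := by
  have h := congrArg conj (integral_mul_integral_exp_neg ha (φ := fun x => conj (φ x))
    ((LinearIsometryEquiv.integrable_comp_iff conjLIE).2 hφ))
  rw [← integral_conj, ← integral_conj] at h
  simp only [map_mul, conj_conj, conj_ofReal, ← integral_conj, ← exp_conj, map_neg, conj_I,
    neg_mul, neg_neg] at h
  exact h

variable {f g : ℝ → ℝ} {n : ℕ}

lemma symQ_eq (n : ℕ) (f g : ℝ → ℝ) (x : ℝ) : symQ n f g x = f x * g x / obsDensity n f g x := by
  rw [symQ, commonDenom_eq, mul_assoc]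
  exact mul_div_mul_left _ _ (by positivity)

lemma symQ_nonneg (h : IsDensityPair f g) (x : ℝ) : 0 ≤ symQ n f g x := by
  rw [symQ_eq]
  exact div_nonneg (mul_nonneg (h.signal_nonneg x) (h.noise_nonneg x)) (h.obsDensity_nonneg n x)

lemma symQ_le (h : IsDensityPair f g) (x : ℝ) : symQ n f g x ≤ g x := by
  rw [symQ_eq, mul_comm, mul_div_assoc]
  exact mul_le_of_le_one_right (h.noise_nonneg x)
    (div_le_one_of_le₀ (h.signal_le_obsDensity n x) (h.obsDensity_nonneg n x))

lemma measurable_symQ (h : IsDensityPair f g) : Measurable (symQ n f g) := by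
  have h1 : symQ n f g = fun x => f x * g x / obsDensity n f g x := funext (symQ_eq n f g)
  rw [h1]
  exact (h.measurable_signal.mul h.measurable_noise).div (h.measurable_obsDensity n)

lemma integrable_symQ (h : IsDensityPair f g) : Integrable (symQ n f g) := by
  refine h.integrable_noise.mono' (measurable_symQ h).aestronglyMeasurable (ae_of_all _ fun x => ?_)
  rw [Real.norm_of_nonneg (symQ_nonneg h x)]
  exact symQ_le h x

lemma integrable_norm_specA_sq_mul (ha : IntegrableOn a (Set.Ioi 0)) {φ : ℝ → ℝ}
    (hφ : Integrable φ) : Integrable fun x => ‖specA a x‖ ^ 2 * φ x := by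
  refine hφ.bdd_mul (c := (∫ t in Set.Ioi (0 : ℝ), ‖a t‖) ^ 2)
    ((continuous_specA ha).norm.pow 2).aestronglyMeasurable (ae_of_all _ fun x => ?_)
  rw [norm_pow, norm_norm]
  exact pow_le_pow_left₀ (norm_nonneg _) (norm_specA_le x) 2

/-- The part of the error that does not depend on the estimate, `∫ |A|² f g / p`. -/
noncomputable def residualError (n : ℕ) (a f g : ℝ → ℝ) : ℝ :=
  ∫ x, ‖specA a x‖ ^ 2 * symQ n f g x

lemma residualError_nonneg (h : IsDensityPair f g) : 0 ≤ residualError n a f g :=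
  integral_nonneg fun x => mul_nonneg (by positivity) (symQ_nonneg h x)

lemma formQ_eq (ha : IntegrableOn a (Set.Ioi 0)) (h : IsDensityPair f g) :
    formQ n a f g = residualError n a f g := by
  have hq : Integrable fun x => (symQ n f g x : ℂ) := (integrable_symQ h).ofReal
  have hop : ∀ s, opQ n a f g s = ∫ x : ℝ, exp (-(I * x * s)) *
      (conj (specA a x) * (symQ n f g x : ℂ)) := by
    intro s
    have hi : Integrable fun x : ℝ => exp (-(I * x * s)) * (symQ n f g x : ℂ) :=
      hq.bdd_mul (c := 1) (by fun_prop) (ae_of_all _ fun x => (norm_exp_neg_I_mul x s).le)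
    have := integral_mul_integral_exp ha hi
    simp_rw [mul_left_comm (conj _)] at this
    rw [← this, opQ]
    refine integral_congr_ae (ae_of_all _ fun t => ?_)
    simp only
    congr 1
    refine integral_congr_ae (ae_of_all _ fun x => ?_)
    simp only
    rw [← mul_assoc, ← Complex.exp_add]
    congr 2
    ring
  have hi : Integrable fun x => conj (specA a x) * (symQ n f g x : ℂ) := by
    refine hq.bdd_mul (c := ∫ t in Set.Ioi (0 : ℝ), ‖a t‖)
      (continuous_conj.comp (continuous_specA ha)).aestronglyMeasurable (ae_of_all _ fun x => ?_)
    rw [RCLike.norm_conj]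
    exact norm_specA_le x
  rw [formQ]
  simp_rw [hop, mul_comm _ (a _ : ℂ)]
  rw [integral_mul_integral_exp_neg ha hi, residualError, ← integral_complex_ofReal]
  refine integral_congr_ae (ae_of_all _ fun x => ?_)
  simp only
  rw [← mul_assoc, mul_conj']
  push_cast
  rfl

/-- The transform of `a_τ` is that of `a` times `(1 - e^{ixτ})^n`. -/
lemma aTauSpec_eq {τ : ℝ} (hτ : 0 < τ) (ha : IntegrableOn a (Set.Ioi 0)) (x : ℝ) :
    aTauSpec n τ a x = specA a x * stepFactor τ x ^ n := by
  let b : ℝ → ℂ := (Set.Ioi 0).indicator fun t => (a t : ℂ)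
  have hb : Integrable b := (integrable_indicator_iff measurableSet_Ioi).2 ha.ofReal
  have hgrid : ∀ᵐ t : ℝ, t ∉ Set.range fun l : ℕ => -(τ * l) :=
    (Set.countable_range _).ae_notMem volume
  have hsum : ∀ᵐ t : ℝ, (aTau n τ a t : ℂ)
      = ∑ l ∈ Finset.range (n + 1), (n.choose l : ℂ) * (-1) ^ l * b (t + τ * l) := by
    filter_upwards [hgrid] with t ht
    have hiff : ∀ l : ℕ, ⌈-t / τ⌉.toNat ≤ l ↔ t + τ * l ∈ Set.Ioi 0 := by
      intro l
      have hne : t + τ * l ≠ 0 := fun h0 => ht ⟨l, by simp only; linarith⟩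
      rw [Int.toNat_le, Int.ceil_le, div_le_iff₀ hτ, Set.mem_Ioi, lt_iff_le_and_ne]
      push_cast
      constructor
      · intro h0
        exact ⟨by linarith, hne.symm⟩
      · intro h0
        linarith [h0.1]
    rw [aTau]
    push_cast
    have hsub : Finset.Icc ⌈-t / τ⌉.toNat n ⊆ Finset.range (n + 1) := by
      intro l hl
      simp only [Finset.mem_Icc, Finset.mem_range] at hl ⊢
      omega
    refine Finset.sum_subset_zero_on_sdiff hsub ?_ ?_
    · intro l hl
      simp only [Finset.mem_sdiff, Finset.mem_Icc, Finset.mem_range] at hl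
      have : t + τ * l ∉ Set.Ioi 0 := fun h0 => hl.2 ⟨(hiff l).2 h0, by omega⟩
      simp only [b]
      rw [Set.indicator_of_notMem this, mul_zero]
    · intro l hl
      simp only [Finset.mem_Icc] at hl
      simp only [b]
      rw [Set.indicator_of_mem ((hiff l).1 hl.1)]
  have hshift : ∀ l : ℕ, Integrable fun t : ℝ => b (t + τ * l) * exp (-(I * x * t)) := fun l =>
    (hb.comp_add_right (τ * l)).mul_bdd (c := 1) (by fun_prop)
      (ae_of_all _ fun t => (norm_exp_neg_I_mul x t).le)
  have hint : ∀ l : ℕ, ∫ t : ℝ, b (t + τ * l) * exp (-(I * x * t))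
      = exp (I * x * τ) ^ l * specA a x := by
    intro l
    rw [← integral_sub_right_eq_self _ (τ * l), specA, ← integral_indicator measurableSet_Ioi,
      ← integral_const_mul]
    refine integral_congr_ae (ae_of_all _ fun t => ?_)
    simp only [sub_add_cancel, b]
    by_cases ht : t ∈ Set.Ioi 0
    · rw [Set.indicator_of_mem ht, Set.indicator_of_mem ht, ← Complex.exp_nat_mul, mul_left_comm,
        ← Complex.exp_add]
      congr 2
      push_cast
      ring
    · simp [Set.indicator_of_notMem ht]
  rw [aTauSpec, setIntegral_eq_integral_of_ae_compl_eq_zero]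
  · have : ∫ t : ℝ, (aTau n τ a t : ℂ) * exp (-(I * x * t))
        = ∫ t : ℝ, ∑ l ∈ Finset.range (n + 1),
          ((n.choose l : ℂ) * (-1) ^ l) * (b (t + τ * l) * exp (-(I * x * t))) := by
      refine integral_congr_ae ?_
      filter_upwards [hsum] with t ht
      rw [ht, Finset.sum_mul]
      exact Finset.sum_congr rfl fun l _ => by ring
    rw [this, integral_finsetSum _ fun l _ => (hshift l).const_mul _]
    simp_rw [integral_const_mul, hint]
    rw [stepFactor, sub_eq_neg_add, add_pow, Finset.mul_sum]
    refine Finset.sum_congr rfl fun l _ => ?_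
    rw [one_pow, neg_pow]
    ring
  · filter_upwards [hsum] with t ht hmem
    rw [ht, Finset.sum_eq_zero, zero_mul]
    intro l hl
    have hl' : (l : ℝ) ≤ n := by
      rw [Finset.mem_range] at hl
      exact_mod_cast Nat.lt_succ_iff.1 hl
    have hmem' : t ≤ -(τ * n) := by simpa using hmem
    have : t + τ * l ∉ Set.Ioi 0 := by
      rw [Set.mem_Ioi, not_lt]
      nlinarith
    simp only [b]
    rw [Set.indicator_of_notMem this, mul_zero]

end

/-! ### The mean-square error as a distance in `L₂(p)` -/

/-- The element of `L₂(p)` whose projection onto `L₂⁰(p)` is the optimal spectral characteristic,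
`A g conj r / p` with `r = (ix)^n / (1 + ix)^n`. -/
noncomputable def targetFunction (n : ℕ) (a f g : ℝ → ℝ) (x : ℝ) : ℂ :=
  conj (incRatio n x) * specA a x * g x / obsDensity n f g x

section

variable {a f g : ℝ → ℝ} {n : ℕ} {τ : ℝ}

lemma measurable_targetFunction (ha : IntegrableOn a (Set.Ioi 0)) (h : IsDensityPair f g) :
    Measurable (targetFunction n a f g) := by
  have h1 := (continuous_specA ha).measurable
  have h2 := measurable_incRatio n
  have h3 := h.measurable_obsDensity n
  have h4 := h.measurable_noise
  have h5 : Measurable fun x => conj (incRatio n x) := continuous_conj.measurable.comp h2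
  unfold targetFunction
  fun_prop

/-- Completing the square. -/
lemma sq_error_eq (h : IsDensityPair f g) (u : ℝ → ℂ) {x : ℝ} (hx : x ≠ 0) :
    ‖specA a x - u x * incRatio n x‖ ^ 2 * g x + ‖u x‖ ^ 2 * f x
      = ‖specA a x‖ ^ 2 * symQ n f g x
        + ‖u x - targetFunction n a f g x‖ ^ 2 * obsDensity n f g x := by
  have hf := h.signal_nonneg x
  have hg := h.noise_nonneg x
  have hr : 0 < ‖incRatio n x‖ := norm_pos_iff.2 (incRatio_ne_zero n hx)
  rw [symQ_eq, targetFunction]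
  rcases (h.obsDensity_nonneg n x).eq_or_lt with hp | hp
  · have h1 := hp
    rw [obsDensity_eq] at h1
    have h2 : 0 ≤ ‖incRatio n x‖ ^ 2 * g x := by positivity
    have hf0 : f x = 0 := by linarith
    have hg0 : g x = 0 := by
      have h3 : ‖incRatio n x‖ ^ 2 * g x = 0 := by linarith
      exact (mul_eq_zero.1 h3).resolve_left (by positivity)
    simp [← hp, hf0, hg0]
  · have hpe := obsDensity_eq n f g x
    set p := obsDensity n f g x
    set r := incRatio n x
    set A := specA a x
    have hp' : (p : ℂ) ≠ 0 := by exact_mod_cast hp.ne'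
    apply ofReal_injective
    have hpe' : (p : ℂ) = f x + r * conj r * g x := by
      rw [mul_conj', hpe]
      push_cast
      rfl
    push_cast
    simp only [← mul_conj', map_sub, map_mul, map_div₀, conj_conj, conj_ofReal]
    field_simp
    rw [hpe']
    ring

lemma memLp_targetFunction (ha : IntegrableOn a (Set.Ioi 0)) (h : IsDensityPair f g) :
    MemLp (targetFunction n a f g) 2 (obsMeasure n f g) := by
  have hm := (measurable_targetFunction (n := n) ha h).aestronglyMeasurable (μ := volume)
  rw [h.memLp_iff n hm, sqNormObs]
  refine lt_of_le_of_lt (lintegral_mono_ae ?_)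
    (integrable_norm_specA_sq_mul ha h.integrable_noise).lintegral_lt_top
  filter_upwards [ae_ne_zero] with x hx
  refine ENNReal.ofReal_le_ofReal ?_
  have h1 := sq_error_eq (a := a) (n := n) h (fun _ => 0) hx
  simp only [zero_mul, sub_zero, norm_zero, ne_eq, OfNat.ofNat_ne_zero, not_false_eq_true,
    zero_pow, add_zero, zero_sub, norm_neg] at h1
  rw [h1, le_add_iff_nonneg_left]
  exact mul_nonneg (by positivity) (symQ_nonneg h x)

/-- The squared distance `∫ |u - v|² p` from the target function. -/
noncomputable def sqDistTarget (n : ℕ) (a f g : ℝ → ℝ) (u : ℝ → ℂ) : ℝ :=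
  ∫ x, ‖u x - targetFunction n a f g x‖ ^ 2 ∂(obsMeasure n f g)

lemma sqDistTarget_nonneg (u : ℝ → ℂ) : 0 ≤ sqDistTarget n a f g u :=
  integral_nonneg fun x => by positivity

lemma integrable_norm_sq_mul_obsDensity (h : IsDensityPair f g) {u : ℝ → ℂ}
    (hu : MemLp u 2 (obsMeasure n f g)) : Integrable fun x => ‖u x‖ ^ 2 * obsDensity n f g x := by
  have h1 := hu.integrable_norm_pow two_ne_zero
  rw [obsMeasure, integrable_withDensity_iff_integrable_smul₀'
    (h.measurable_obsDensity n).ennreal_ofReal.aemeasurable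
    (ae_of_all _ fun x => ENNReal.ofReal_lt_top)] at h1
  refine h1.congr (ae_of_all _ fun x => ?_)
  simp only
  rw [ENNReal.toReal_ofReal (h.obsDensity_nonneg n x), smul_eq_mul, mul_comm]

lemma mse_eq (ha : IntegrableOn a (Set.Ioi 0)) (h : IsDensityPair f g) {u : ℝ → ℂ}
    (hm : AEStronglyMeasurable u) (hu : MemLp u 2 (obsMeasure n f g)) :
    mse n a u f g
      = ENNReal.ofReal ((2 * Real.pi)⁻¹ * (residualError n a f g + sqDistTarget n a f g u)) := by
  have hi1 : Integrable fun x => ‖specA a x‖ ^ 2 * symQ n f g x :=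
    integrable_norm_specA_sq_mul ha (integrable_symQ h)
  have hi2 : Integrable fun x => ‖u x - targetFunction n a f g x‖ ^ 2 * obsDensity n f g x :=
    integrable_norm_sq_mul_obsDensity h (hu.sub (memLp_targetFunction ha h))
  have hA := (continuous_specA ha).aestronglyMeasurable (μ := volume)
  have hr := (measurable_incRatio n).aestronglyMeasurable (μ := volume)
  have hX : AEMeasurable fun x =>
      ENNReal.ofReal (‖specA a x - u x * incRatio n x‖ ^ 2 * g x) :=
    (((hA.sub (hm.mul hr)).norm.aemeasurable.pow_const 2).mul
      h.measurable_noise.aemeasurable).ennreal_ofReal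
  rw [mse, ← lintegral_add_left' hX, ENNReal.ofReal_mul (by positivity)]
  congr 1
  have hi12 : Integrable fun x => ‖specA a x‖ ^ 2 * symQ n f g x
      + ‖u x - targetFunction n a f g x‖ ^ 2 * obsDensity n f g x := hi1.add hi2
  rw [residualError, sqDistTarget, h.integral_obsMeasure_real, ← integral_add hi1 hi2,
    ofReal_integral_eq_lintegral_ofReal hi12]
  · refine lintegral_congr_ae ?_
    filter_upwards [ae_ne_zero] with x hx
    rw [← ENNReal.ofReal_add, sq_error_eq h u hx]
    · exact mul_nonneg (by positivity) (h.noise_nonneg x)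
    · exact mul_nonneg (by positivity) (h.signal_nonneg x)
  · refine ae_of_all _ fun x => ?_
    exact add_nonneg (mul_nonneg (by positivity) (symQ_nonneg h x))
      (mul_nonneg (by positivity) (h.obsDensity_nonneg n x))

/-- Pythagoras' theorem for the projection of the target function onto `L₂⁰(p)`. -/
lemma sqDistTarget_eq_add (ha : IntegrableOn a (Set.Ioi 0)) (h : IsDensityPair f g)
    {h₀ u : ℝ → ℂ} (h₀L : h₀ ∈ L20 n τ f g)
    (ho : OrthogonalToObs n τ f g fun x => targetFunction n a f g x - h₀ x)
    (hu : u ∈ L20 n τ f g) :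
    sqDistTarget n a f g u
      = sqDistTarget n a f g h₀ + ∫ x, ‖u x - h₀ x‖ ^ 2 ∂(obsMeasure n f g) := by
  have h1 := memLp_of_mem_L20 h h₀L
  have h2 := memLp_of_mem_L20 h hu
  have hv := memLp_targetFunction (n := n) ha h
  set v := targetFunction n a f g with hvdef
  have hz : ∫ x, conj (v x - h₀ x) * (u x - h₀ x) ∂(obsMeasure n f g) = 0 := by
    simp_rw [mul_sub]
    rw [integral_sub (integrable_conj_mul ho.1 h2) (integrable_conj_mul ho.1 h1),
      integral_conj_mul_eq_zero h hu ho, integral_conj_mul_eq_zero h h₀L ho, sub_zero]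
  have hzi : Integrable (fun x => conj (v x - h₀ x) * (u x - h₀ x)) (obsMeasure n f g) :=
    integrable_conj_mul ho.1 (h2.sub h1)
  have hre : ∫ x, (conj (v x - h₀ x) * (u x - h₀ x)).re ∂(obsMeasure n f g) = 0 := by
    have := integral_re hzi
    rw [hz] at this
    simpa using this
  have hi1 := (h1.sub hv).integrable_norm_pow (two_ne_zero)
  have hi2 := (h2.sub h1).integrable_norm_pow (two_ne_zero)
  have hpt : ∀ x, ‖u x - v x‖ ^ 2 = ‖h₀ x - v x‖ ^ 2 + ‖u x - h₀ x‖ ^ 2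
      - 2 * (conj (v x - h₀ x) * (u x - h₀ x)).re := by
    intro x
    simp only [← normSq_eq_norm_sq, normSq_apply]
    simp
    ring
  simp only [sqDistTarget, ← hvdef]
  simp_rw [hpt]
  rw [integral_sub, integral_const_mul, hre, mul_zero, sub_zero, integral_add]
  · exact hi1
  · exact hi2
  · exact hi1.add hi2
  · exact hzi.re.const_mul 2

lemma optMse_eq (ha : IntegrableOn a (Set.Ioi 0)) (h : IsDensityPair f g)
    {h₀ : ℝ → ℂ} (h₀L : h₀ ∈ L20 n τ f g)
    (ho : OrthogonalToObs n τ f g fun x => targetFunction n a f g x - h₀ x) :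
    mse n a h₀ f g = optMse n τ a f g := by
  refine le_antisymm (le_iInf₂ fun u hu => ?_) (iInf₂_le h₀ h₀L)
  rw [mse_eq ha h h₀L.1 (memLp_of_mem_L20 h h₀L), mse_eq ha h hu.1 (memLp_of_mem_L20 h hu),
    sqDistTarget_eq_add ha h h₀L ho hu]
  refine ENNReal.ofReal_le_ofReal (mul_le_mul_of_nonneg_left ?_ (by positivity))
  have : 0 ≤ ∫ x, ‖u x - h₀ x‖ ^ 2 ∂(obsMeasure n f g) := integral_nonneg fun x => by positivity
  linarith

/-- The optimal spectral characteristic is unique. -/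
lemma ae_eq_of_mse_le_optMse (ha : IntegrableOn a (Set.Ioi 0)) (h : IsDensityPair f g)
    (hp : ∀ᵐ x, 0 < obsDensity n f g x) {h₀ u : ℝ → ℂ} (h₀L : h₀ ∈ L20 n τ f g)
    (ho : OrthogonalToObs n τ f g fun x => targetFunction n a f g x - h₀ x)
    (hu : u ∈ L20 n τ f g) (hle : mse n a u f g ≤ optMse n τ a f g) : u =ᵐ[volume] h₀ := by
  have h1 := memLp_of_mem_L20 h h₀L
  have h2 := memLp_of_mem_L20 h hu
  rw [← optMse_eq ha h h₀L ho, mse_eq ha h h₀L.1 h1, mse_eq ha h hu.1 h2,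
    sqDistTarget_eq_add ha h h₀L ho hu] at hle
  have hπ : 0 < (2 * Real.pi)⁻¹ := by positivity
  have h3 := (ENNReal.ofReal_le_ofReal_iff (mul_nonneg hπ.le
    (add_nonneg (residualError_nonneg h) (sqDistTarget_nonneg h₀)))).1 hle
  have h4 := le_of_mul_le_mul_left h3 hπ
  have h5 : ∫ x, ‖u x - h₀ x‖ ^ 2 ∂(obsMeasure n f g) = 0 :=
    le_antisymm (by linarith) (integral_nonneg fun x => by positivity)
  have hi : Integrable (fun x => ‖u x - h₀ x‖ ^ 2) (obsMeasure n f g) :=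
    (h2.sub h1).integrable_norm_pow two_ne_zero
  rw [integral_eq_zero_iff_of_nonneg (fun x => by positivity) hi, obsMeasure, EventuallyEq,
    ae_withDensity_iff (h.measurable_obsDensity n).ennreal_ofReal] at h5
  filter_upwards [h5, hp] with x hx hpx
  have := hx (by simpa using hpx)
  simpa [sub_eq_zero] using this

end

/-! ### Consequences of minimality -/

lemma ae_ne_zero_of_differentiable {γ : ℂ → ℂ} (hd : Differentiable ℂ γ) (h0 : γ ≠ 0) :
    ∀ᵐ x : ℝ, γ x ≠ 0 := by
  have hA : AnalyticOnNhd ℂ γ Set.univ := fun z _ => hd.analyticAt z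
  rw [ae_iff]
  refine measure_null_of_locally_null _ fun x hx => ⟨{x}, ?_, measure_singleton x⟩
  have h1 : ∀ᶠ z in 𝓝[≠] (x : ℂ), γ z ≠ 0 := by
    by_contra h
    have := hA.eqOn_zero_of_preconnected_of_frequently_eq_zero isPreconnected_univ (Set.mem_univ _)
      ((not_eventually.1 h).mono fun z hz => not_not.1 hz)
    exact h0 (funext fun z => this (Set.mem_univ z))
  have h2 : Tendsto (fun y : ℝ => (y : ℂ)) (𝓝[≠] x) (𝓝[≠] (x : ℂ)) :=
    tendsto_nhdsWithin_iff.2 ⟨(continuous_ofReal.tendsto x).mono_left nhdsWithin_le_nhds,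
      by filter_upwards [self_mem_nhdsWithin] with y hy; simpa using hy⟩
  have h3 := eventually_nhdsWithin_iff.1 (h2.eventually h1)
  rw [mem_nhdsWithin_iff_eventually]
  filter_upwards [h3] with y hy hyS
  by_contra hne
  exact hyS (hy hne)

lemma IsMinimal.ae_obsDensity_pos {n : ℕ} {τ : ℝ} {f g : ℝ → ℝ} (h : IsDensityPair f g)
    (hmin : IsMinimal n τ f g) : ∀ᵐ x, 0 < obsDensity n f g x := by
  obtain ⟨γ, α, h0, hd, -, -, -, hfin, -⟩ := hmin
  have hγ : Continuous fun x : ℝ => γ x := hd.continuous.comp continuous_ofReal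
  have hm : Measurable fun x : ℝ =>
      ENNReal.ofReal (‖γ x‖ ^ 2) / ENNReal.ofReal (obsDensity n f g x) :=
    (hγ.norm.pow 2).measurable.ennreal_ofReal.div (h.measurable_obsDensity n).ennreal_ofReal
  filter_upwards [ae_lt_top hm hfin.ne, ae_ne_zero_of_differentiable hd h0] with x hx hx0
  by_contra hp
  rw [ENNReal.ofReal_of_nonpos (not_lt.1 hp), ENNReal.div_zero] at hx
  · exact lt_irrefl _ hx
  · have : 0 < ‖γ x‖ := norm_pos_iff.2 hx0
    simpa using hx0

lemma continuous_timeFunction {Y : ℝ → ℂ} (hY : Integrable Y) : Continuous (timeFunction Y) := by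
  unfold timeFunction
  refine continuous_const.mul ?_
  refine continuous_of_dominated (bound := fun x => ‖Y x‖)
    (fun t => hY.aestronglyMeasurable.mul (by fun_prop)) (fun t => ae_of_all _ fun x => ?_) hY.norm
    (ae_of_all _ fun x => by fun_prop)
  rw [norm_mul, norm_exp_neg_I_mul, mul_one]

/-- Fourier inversion for a transform of a function on the half-line. -/
lemma timeFunction_eq_zero {γ α : ℝ → ℂ} (hα : IntegrableOn α (Set.Ioi 0))
    (hγ : ∀ x : ℝ, γ x = ∫ t in Set.Ioi (0 : ℝ), α t * exp (I * x * t)) (hi : Integrable γ)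
    {t : ℝ} (ht : t ≤ 0) : timeFunction γ t = 0 := by
  open scoped FourierTransform in
  let β : ℝ → ℂ := (Set.Ioi 0).indicator α
  have hβ : Integrable β := (integrable_indicator_iff measurableSet_Ioi).2 hα
  have hF : 𝓕 β = fun w => γ (-(2 * Real.pi) * w) := by
    funext w
    rw [Real.fourier_real_eq_integral_exp_smul, hγ, ← integral_indicator measurableSet_Ioi]
    refine integral_congr_ae (ae_of_all _ fun s => ?_)
    simp only [β, smul_eq_mul]
    by_cases hs : s ∈ Set.Ioi 0
    · rw [Set.indicator_of_mem hs, Set.indicator_of_mem hs, mul_comm]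
      congr 2
      push_cast
      ring
    · simp [Set.indicator_of_notMem hs]
  have hpi : -(2 * Real.pi) ≠ 0 := by
    have := Real.pi_pos
    linarith
  have hFi : Integrable (𝓕 β) := by
    rw [hF]
    exact hi.comp_mul_left' hpi
  have hinv : ∀ s, 𝓕⁻ (𝓕 β) s = timeFunction γ s := by
    intro s
    rw [Real.fourierInv_eq', hF, timeFunction]
    have h1 := Measure.integral_comp_mul_left (fun x : ℝ => γ x * exp (-(I * x * s)))
      (-(2 * Real.pi))
    have h2 : |(-(2 * Real.pi))⁻¹| = (2 * Real.pi)⁻¹ := by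
      rw [abs_inv, abs_neg, abs_of_pos (by positivity)]
    rw [h2, real_smul] at h1
    push_cast at h1
    rw [← h1]
    refine integral_congr_ae (ae_of_all _ fun w => ?_)
    simp only [smul_eq_mul, RCLike.inner_apply, conj_trivial]
    rw [mul_comm]
    congr 2
    push_cast
    ring
  have hneg : ∀ s < 0, timeFunction γ s = 0 := by
    intro s hs
    have h0 : β =ᶠ[𝓝 s] fun _ => 0 := by
      filter_upwards [Iio_mem_nhds hs] with y hy
      exact Set.indicator_of_notMem (by simpa using (Set.mem_Iio.1 hy).le) _
    rw [← hinv, hβ.fourierInv_fourier_eq hFi (h0.continuousAt), h0.eq_of_nhds]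
  rcases ht.eq_or_lt with rfl | ht
  · have h1 : Tendsto (timeFunction γ) (𝓝[<] 0) (𝓝 (timeFunction γ 0)) :=
      ((continuous_timeFunction hi).tendsto 0).mono_left nhdsWithin_le_nhds
    refine tendsto_nhds_unique h1 (tendsto_const_nhds.congr' ?_)
    filter_upwards [self_mem_nhdsWithin] with s hs
    exact (hneg s hs).symm
  · exact hneg t ht

/-! ### The energy space of `P` as the orthogonal complement of `L₂⁰(p)` -/

section

variable {n : ℕ} {τ : ℝ} {a f g : ℝ → ℝ}

lemma conj_obsFunction_zero (n : ℕ) (τ x : ℝ) :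
    conj (obsFunction n τ 0 x) = stepFactor τ x ^ n / conj (incRatio n x) := by
  simp only [obsFunction, incRatio, stepFactor, ofReal_zero, mul_zero, Complex.exp_zero, one_mul,
    map_mul, map_pow, map_sub, map_one, ← exp_conj, map_neg, conj_I, conj_ofReal, map_div₀,
    neg_mul, neg_neg, map_add]
  rw [div_div_eq_mul_div, mul_div_assoc]

lemma ae_stepFactor_ne_zero (hτ : τ ≠ 0) : ∀ᵐ x, stepFactor τ x ≠ 0 := by
  filter_upwards [ae_exp_ne_one hτ] with x hx h
  refine hx ?_
  rw [exp_neg, inv_eq_one]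
  exact (sub_eq_zero.1 h).symm

lemma symP_eq (n : ℕ) (τ : ℝ) (f g : ℝ → ℝ) (x : ℝ) :
    symP n τ f g x = (obsDensity n f g x * ‖obsFunction n τ 0 x‖ ^ 2)⁻¹ := by
  rw [← RCLike.norm_conj (K := ℂ) (obsFunction n τ 0 x), conj_obsFunction_zero, norm_div, norm_pow,
    RCLike.norm_conj, div_pow, ← pow_mul, mul_comm n 2, norm_incRatio_sq, symP, commonDenom_eq]
  have : (1 + x ^ 2) ^ n ≠ 0 := by positivity
  by_cases hx : x ^ (2 * n) = 0
  · simp [hx]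
  by_cases hs : ‖stepFactor τ x‖ ^ (2 * n) = 0
  · simp [hs]
  by_cases hp : obsDensity n f g x = 0
  · simp [hp]
  field_simp

lemma symS_eq (n : ℕ) (τ : ℝ) (f g : ℝ → ℝ) (x : ℝ) :
    symS n τ f g x = symP n τ f g x * g x := by
  rw [symS, symP]
  ring

/-- The function of `L₂(p)` corresponding to a spectrum of the energy space of `P`. -/
noncomputable def energyToObs (n : ℕ) (τ : ℝ) (f g : ℝ → ℝ) (Z : ℝ → ℂ) (x : ℝ) : ℂ :=
  Z x / (obsDensity n f g x * conj (obsFunction n τ 0 x))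

/-- The spectrum corresponding to a function of `L₂(p)`. -/
noncomputable def obsToEnergy (n : ℕ) (τ : ℝ) (f g : ℝ → ℝ) (k : ℝ → ℂ) (x : ℝ) : ℂ :=
  k x * (obsDensity n f g x * conj (obsFunction n τ 0 x))

lemma ae_weight_ne_zero (hτ : τ ≠ 0) (hp : ∀ᵐ x, 0 < obsDensity n f g x) :
    ∀ᵐ x, (obsDensity n f g x : ℂ) ≠ 0 ∧ obsFunction n τ 0 x ≠ 0 := by
  filter_upwards [hp, ae_obsFunction_ne_zero n hτ 0] with x h1 h2
  exact ⟨by exact_mod_cast h1.ne', h2⟩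

lemma energyToObs_obsToEnergy (hτ : τ ≠ 0) (hp : ∀ᵐ x, 0 < obsDensity n f g x) (k : ℝ → ℂ) :
    energyToObs n τ f g (obsToEnergy n τ f g k) =ᵐ[volume] k := by
  filter_upwards [ae_weight_ne_zero hτ hp] with x hx
  have h2 : conj (obsFunction n τ 0 x) ≠ 0 := (map_ne_zero _).2 hx.2
  rw [energyToObs, obsToEnergy, mul_div_cancel_right₀ _ (mul_ne_zero hx.1 h2)]

lemma norm_energyToObs_sq_mul (hτ : τ ≠ 0) (hp : ∀ᵐ x, 0 < obsDensity n f g x) (Z : ℝ → ℂ) :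
    ∀ᵐ x, ‖energyToObs n τ f g Z x‖ ^ 2 * obsDensity n f g x
      = symP n τ f g x * ‖Z x‖ ^ 2 := by
  filter_upwards [hp, ae_obsFunction_ne_zero n hτ 0] with x h1 h2
  have h3 : ‖obsFunction n τ 0 x‖ ≠ 0 := norm_ne_zero_iff.2 h2
  rw [energyToObs, symP_eq, norm_div, norm_mul, RCLike.norm_conj, norm_real,
    Real.norm_of_nonneg h1.le]
  field_simp

lemma measurable_conj_obsFunction (n : ℕ) (τ t : ℝ) :
    Measurable fun x => conj (obsFunction n τ t x) :=
  continuous_conj.measurable.comp (measurable_obsFunction n τ t)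

lemma aestronglyMeasurable_energyToObs (h : IsDensityPair f g) {Z : ℝ → ℂ}
    (hZ : AEStronglyMeasurable Z) : AEStronglyMeasurable (energyToObs n τ f g Z) := by
  have h1 := h.measurable_obsDensity n
  have h2 := measurable_conj_obsFunction n τ 0
  exact (hZ.aemeasurable.div (h1.complex_ofReal.mul h2).aemeasurable).aestronglyMeasurable

lemma orthogonalToObs_energyToObs (hτ : τ ≠ 0) (h : IsDensityPair f g)
    (hp : ∀ᵐ x, 0 < obsDensity n f g x) {Z : ℝ → ℂ} (hZ : InEnergySpace n τ f g Z) :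
    OrthogonalToObs n τ f g (energyToObs n τ f g Z) := by
  have hm := aestronglyMeasurable_energyToObs (n := n) (τ := τ) h hZ.integrable.aestronglyMeasurable
  refine ⟨?_, fun t ht => ?_⟩
  · rw [h.memLp_iff n hm, sqNormObs]
    refine lt_of_le_of_lt (lintegral_mono_ae ?_) hZ.energy.lintegral_lt_top
    filter_upwards [norm_energyToObs_sq_mul hτ hp Z] with x hx
    rw [hx]
  · rw [h.integral_obsMeasure]
    have h1 := congrArg conj (hZ.causal t ht)
    rw [timeFunction, map_mul, map_zero, ← integral_conj] at h1
    have h2 := (mul_eq_zero.1 h1).resolve_left (by simp [Real.pi_ne_zero])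
    rw [← h2]
    refine integral_congr_ae ?_
    filter_upwards [ae_weight_ne_zero hτ hp] with x hx
    obtain ⟨h3, h4⟩ := hx
    rw [energyToObs, obsFunction_eq_exp_mul n τ t x]
    simp only [map_mul, map_div₀, conj_conj, conj_ofReal, ← exp_conj, map_neg, conj_I, neg_mul,
      neg_neg]
    field_simp

lemma inEnergySpace_obsToEnergy (hτ : τ ≠ 0) (h : IsDensityPair f g)
    (hp : ∀ᵐ x, 0 < obsDensity n f g x) {k : ℝ → ℂ} (hk : OrthogonalToObs n τ f g k) :
    InEnergySpace n τ f g (obsToEnergy n τ f g k) := by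
  have hA := (orthogonalToObs_iff_annihilates h hk.1).1 hk
  have hconj : ∀ x, conj (obsFunction n τ 0 x * (conj (k x) * (obsDensity n f g x : ℂ)))
      = obsToEnergy n τ f g k x := by
    intro x
    simp only [map_mul, conj_conj, conj_ofReal, obsToEnergy]
    ring
  refine ⟨?_, fun t ht => ?_, ?_⟩
  · refine ((LinearIsometryEquiv.integrable_comp_iff conjLIE).2 hA.1).congr
      (ae_of_all _ fun x => ?_)
    exact hconj x
  · rw [timeFunction]
    have h1 := congrArg conj (hA.2 t ht)
    rw [← integral_conj, map_zero] at h1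
    have h2 : ∫ x : ℝ, obsToEnergy n τ f g k x * exp (-(I * x * t)) = 0 := by
      rw [← h1]
      refine integral_congr_ae (ae_of_all _ fun x => ?_)
      simp only
      rw [map_mul, hconj, mul_comm]
      simp only [← exp_conj, map_mul, conj_I, conj_ofReal, neg_mul]
    rw [h2, mul_zero]
  · refine (integrable_norm_sq_mul_obsDensity h hk.1).congr ?_
    filter_upwards [norm_energyToObs_sq_mul hτ hp (obsToEnergy n τ f g k),
      energyToObs_obsToEnergy hτ hp k] with x h1 h2
    rw [← h1, h2]

lemma formP_eq (hτ : τ ≠ 0) (h : IsDensityPair f g) (hp : ∀ᵐ x, 0 < obsDensity n f g x)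
    (Y Z : ℝ → ℂ) :
    formP n τ f g Y Z
      = ∫ x, conj (energyToObs n τ f g Z x) * energyToObs n τ f g Y x ∂(obsMeasure n f g) := by
  rw [h.integral_obsMeasure, formP]
  refine integral_congr_ae ?_
  filter_upwards [ae_weight_ne_zero hτ hp] with x hx
  obtain ⟨h1, h2⟩ := hx
  have h3 : conj (obsFunction n τ 0 x) ≠ 0 := (map_ne_zero _).2 h2
  rw [symP_eq, energyToObs, energyToObs]
  push_cast
  rw [← mul_conj']
  simp only [map_mul, map_div₀, conj_conj, conj_ofReal]
  field_simp

lemma formS_eq (hτ : 0 < τ) (ha : IntegrableOn a (Set.Ioi 0)) (h : IsDensityPair f g)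
    (hp : ∀ᵐ x, 0 < obsDensity n f g x) (Z : ℝ → ℂ) :
    formS n τ a f g Z
      = ∫ x, conj (energyToObs n τ f g Z x) * targetFunction n a f g x ∂(obsMeasure n f g) := by
  rw [h.integral_obsMeasure, formS]
  refine integral_congr_ae ?_
  filter_upwards [ae_weight_ne_zero hτ.ne' hp, ae_ne_zero] with x hx hx0
  obtain ⟨h1, h2⟩ := hx
  have h3 : conj (obsFunction n τ 0 x) ≠ 0 := (map_ne_zero _).2 h2
  have h4 : conj (incRatio n x) ≠ 0 := (map_ne_zero _).2 (incRatio_ne_zero n hx0)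
  have h5 : stepFactor τ x ^ n = conj (obsFunction n τ 0 x) * conj (incRatio n x) := by
    rw [conj_obsFunction_zero]
    field_simp
  rw [symS_eq, symP_eq, energyToObs, aTauSpec_eq hτ ha, h5, targetFunction]
  push_cast
  rw [← mul_conj']
  simp only [map_mul, map_div₀, conj_conj, conj_ofReal]
  field_simp

/-! ### The spectral characteristic of the optimal estimate -/

lemma conj_incRatio (n : ℕ) (x : ℝ) :
    conj (incRatio n x) = (-(I * x)) ^ n / (1 - I * x) ^ n := by
  simp [incRatio, sub_eq_add_neg]

lemma commonDenom_ofReal (n : ℕ) (f g : ℝ → ℝ) (x : ℝ) :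
    (commonDenom n f g x : ℂ)
      = (1 + I * x) ^ n * (1 - I * x) ^ n * (obsDensity n f g x : ℂ) := by
  rw [commonDenom_eq, ← mul_pow, one_add_I_mul_conj]
  push_cast
  rfl

lemma targetFunction_sub_hTau (n : ℕ) (τ : ℝ) (a f g : ℝ → ℝ) (C : ℝ → ℂ) (x : ℝ) :
    targetFunction n a f g x - hTau n τ a f g C x = energyToObs n τ f g C x := by
  have h1 := pow_ne_zero n (one_add_I_mul_ne_zero x)
  have h2 := pow_ne_zero n (one_sub_I_mul_ne_zero x)
  have e1 : specA a x * (1 + I * x) ^ n * (-(I * x)) ^ n * g x / commonDenom n f g x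
      = targetFunction n a f g x := by
    rw [targetFunction, conj_incRatio, commonDenom_ofReal, mul_assoc ((1 + I * (x : ℂ)) ^ n),
      div_mul_eq_mul_div, div_mul_eq_mul_div, div_div, mul_assoc (specA a x), mul_assoc (specA a x),
      mul_left_comm (specA a x), mul_assoc ((1 + I * (x : ℂ)) ^ n), mul_div_mul_left _ _ h1]
    congr 1
    ring
  have e2 : (1 + I * x) ^ n * (-(I * x)) ^ n * C x / (stepFactor τ x ^ n * commonDenom n f g x)
      = energyToObs n τ f g C x := by
    rw [energyToObs, conj_obsFunction_zero, conj_incRatio, commonDenom_ofReal, div_div_eq_mul_div,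
      mul_div_assoc', div_div_eq_mul_div, show stepFactor τ x ^ n *
      ((1 + I * (x : ℂ)) ^ n * (1 - I * x) ^ n * (obsDensity n f g x : ℂ))
      = (1 + I * (x : ℂ)) ^ n *
        ((obsDensity n f g x : ℂ) * (stepFactor τ x ^ n * (1 - I * x) ^ n)) by ring,
      mul_assoc, mul_div_mul_left _ _ h1, mul_comm (C x)]
  rw [hTau, e1, e2, sub_sub_cancel]

lemma aestronglyMeasurable_hTau (ha : IntegrableOn a (Set.Ioi 0)) (h : IsDensityPair f g)
    {C : ℝ → ℂ} (hC : AEStronglyMeasurable C) : AEStronglyMeasurable (hTau n τ a f g C) := by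
  have h1 := ((measurable_targetFunction (n := n) ha h).aestronglyMeasurable (μ := volume)).sub
    (aestronglyMeasurable_energyToObs (n := n) (τ := τ) h hC)
  refine h1.congr (ae_of_all _ fun x => ?_)
  rw [Pi.sub_apply, ← targetFunction_sub_hTau (a := a), sub_sub_cancel]

lemma IsInverseImage.orthogonalToObs (hτ : τ ≠ 0) (h : IsDensityPair f g)
    (hp : ∀ᵐ x, 0 < obsDensity n f g x) {C : ℝ → ℂ} (hC : IsInverseImage n τ a f g C) :
    OrthogonalToObs n τ f g fun x => targetFunction n a f g x - hTau n τ a f g C x := by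
  simp_rw [targetFunction_sub_hTau]
  exact orthogonalToObs_energyToObs hτ h hp hC.1

/-- The equation `P c = S a_τ` says that `h_τ` is orthogonal to the orthogonal complement of
`L₂⁰(p)`. -/
lemma IsInverseImage.hTau_mem_L20 (hτ : 0 < τ) (ha : IntegrableOn a (Set.Ioi 0))
    (h : IsDensityPair f g) (hp : ∀ᵐ x, 0 < obsDensity n f g x) {C : ℝ → ℂ}
    (hC : IsInverseImage n τ a f g C) : hTau n τ a f g C ∈ L20 n τ f g := by
  have ho := hC.orthogonalToObs hτ.ne' h hp
  have hv := memLp_targetFunction (n := n) ha h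
  have hE := (orthogonalToObs_energyToObs hτ.ne' h hp hC.1).1
  have heq : ∀ x, hTau n τ a f g C x = targetFunction n a f g x - energyToObs n τ f g C x := by
    intro x
    rw [← targetFunction_sub_hTau (a := a), sub_sub_cancel]
  refine (mem_L20_iff h).2 ⟨aestronglyMeasurable_hTau ha h hC.1.integrable.aestronglyMeasurable,
    (hv.sub hE).ae_eq (ae_of_all _ fun x => (heq x).symm), fun k hk => ?_⟩
  have h1 := hC.2 _ (inEnergySpace_obsToEnergy hτ.ne' h hp hk)
  have hk' := (withDensity_absolutelyContinuous volume
    (fun x => ENNReal.ofReal (obsDensity n f g x))).ae_le (energyToObs_obsToEnergy hτ.ne' hp k)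
  rw [formP_eq hτ.ne' h hp, formS_eq hτ ha h hp] at h1
  have h2 : ∀ w : ℝ → ℂ, ∫ x, conj (energyToObs n τ f g (obsToEnergy n τ f g k) x) * w x
      ∂(obsMeasure n f g) = ∫ x, conj (k x) * w x ∂(obsMeasure n f g) := by
    intro w
    refine integral_congr_ae ?_
    filter_upwards [hk'] with x hx
    rw [hx]
  rw [h2, h2] at h1
  simp_rw [heq, mul_sub]
  rw [integral_sub (integrable_conj_mul hk.1 hv) (integrable_conj_mul hk.1 hE), h1, sub_self]

lemma exists_isInverseImage (hτ : 0 < τ) (ha : IntegrableOn a (Set.Ioi 0))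
    (h : IsDensityPair f g) (hp : ∀ᵐ x, 0 < obsDensity n f g x) :
    ∃ C, IsInverseImage n τ a f g C := by
  have hv := memLp_targetFunction (n := n) ha h
  obtain ⟨u, hu, ho⟩ := exists_mem_L20_orthogonal (τ := τ) h hv
  refine ⟨_, inEnergySpace_obsToEnergy hτ.ne' h hp ho, fun Z hZ => ?_⟩
  have hZo := orthogonalToObs_energyToObs hτ.ne' h hp hZ
  have hk' := (withDensity_absolutelyContinuous volume
    (fun x => ENNReal.ofReal (obsDensity n f g x))).ae_le (energyToObs_obsToEnergy hτ.ne' hp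
      fun x => targetFunction n a f g x - u x)
  rw [formP_eq hτ.ne' h hp, formS_eq hτ ha h hp]
  have h1 : ∫ x, conj (energyToObs n τ f g Z x) * energyToObs n τ f g (obsToEnergy n τ f g
      fun x => targetFunction n a f g x - u x) x ∂(obsMeasure n f g)
      = ∫ x, (conj (energyToObs n τ f g Z x) * targetFunction n a f g x
        - conj (energyToObs n τ f g Z x) * u x) ∂(obsMeasure n f g) := by
    refine integral_congr_ae ?_
    filter_upwards [hk'] with x hx
    rw [hx, mul_sub]
  rw [h1, integral_sub (integrable_conj_mul hZo.1 hv)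
    (integrable_conj_mul hZo.1 (memLp_of_mem_L20 h hu)), integral_conj_mul_eq_zero h hu hZo,
    sub_zero]

/-- The value of the extremum problem is `2π` times the error of the optimal estimate. -/
lemma IsInverseImage.errorValue_eq (hτ : 0 < τ) (ha : IntegrableOn a (Set.Ioi 0))
    (h : IsDensityPair f g) (hp : ∀ᵐ x, 0 < obsDensity n f g x) {C : ℝ → ℂ}
    (hC : IsInverseImage n τ a f g C) :
    errorValue n τ a f g C
      = residualError n a f g + sqDistTarget n a f g (hTau n τ a f g C) := by
  have hE := orthogonalToObs_energyToObs hτ.ne' h hp hC.1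
  have hL := hC.hTau_mem_L20 hτ ha h hp
  have h1 : formS n τ a f g C = (sqDistTarget n a f g (hTau n τ a f g C) : ℂ) := by
    rw [formS_eq hτ ha h hp]
    have h2 : ∀ x, conj (energyToObs n τ f g C x) * targetFunction n a f g x
        = conj (energyToObs n τ f g C x) * hTau n τ a f g C x
          + conj (energyToObs n τ f g C x) * energyToObs n τ f g C x := by
      intro x
      rw [← targetFunction_sub_hTau (a := a)]
      ring
    simp_rw [h2]
    rw [integral_add (integrable_conj_mul hE.1 (memLp_of_mem_L20 h hL))
      (integrable_conj_mul hE.1 hE.1), integral_conj_mul_eq_zero h hL hE, zero_add, sqDistTarget,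
      ← integral_complex_ofReal]
    refine integral_congr_ae (ae_of_all _ fun x => ?_)
    simp only
    rw [conj_mul', norm_sub_rev, targetFunction_sub_hTau]
    push_cast
    rfl
  rw [errorValue, formQ_eq ha h, h1, ← ofReal_add, ofReal_re, add_comm]

lemma IsInverseImage.mse_hTau (hτ : 0 < τ) (ha : IntegrableOn a (Set.Ioi 0))
    (h : IsDensityPair f g) (hp : ∀ᵐ x, 0 < obsDensity n f g x) {C : ℝ → ℂ}
    (hC : IsInverseImage n τ a f g C) :
    mse n a (hTau n τ a f g C) f g = optMse n τ a f g :=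
  optMse_eq ha h (hC.hTau_mem_L20 hτ ha h hp) (hC.orthogonalToObs hτ.ne' h hp)

lemma IsInverseImage.optMse_eq_ofReal (hτ : 0 < τ) (ha : IntegrableOn a (Set.Ioi 0))
    (h : IsDensityPair f g) (hp : ∀ᵐ x, 0 < obsDensity n f g x) {C : ℝ → ℂ}
    (hC : IsInverseImage n τ a f g C) :
    optMse n τ a f g = ENNReal.ofReal ((2 * Real.pi)⁻¹ * errorValue n τ a f g C) := by
  have hL := hC.hTau_mem_L20 hτ ha h hp
  rw [← hC.mse_hTau hτ ha h hp, mse_eq ha h hL.1 (memLp_of_mem_L20 h hL),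
    hC.errorValue_eq hτ ha h hp]

/-- The minimality conditions make `L₂⁰(p)` a proper subspace of `L₂(p)`: the function `γ` is in
the energy space. -/
lemma IsMinimal.exists_orthogonalToObs (hτ : τ ≠ 0) (h : IsDensityPair f g)
    (hmin : IsMinimal n τ f g) : ∃ v, OrthogonalToObs n τ f g v ∧ ¬ v =ᵐ[volume] 0 := by
  have hp := hmin.ae_obsDensity_pos h
  obtain ⟨γ, α, h0, hd, -, hα, hγα, -, hfin⟩ := hmin
  have hγ : Continuous fun x : ℝ => γ x := hd.continuous.comp continuous_ofReal
  have hsymP : ∀ x, 0 ≤ symP n τ f g x := fun x => by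
    rw [symP_eq]
    exact inv_nonneg.2 (mul_nonneg (h.obsDensity_nonneg n x) (by positivity))
  have hms : Measurable (symP n τ f g) := by
    have h1 := h.measurable_obsDensity n
    have h2 := (measurable_obsFunction n τ 0).norm
    have h3 : symP n τ f g = fun x => (obsDensity n f g x * ‖obsFunction n τ 0 x‖ ^ 2)⁻¹ :=
      funext (symP_eq n τ f g)
    rw [h3]
    exact (h1.mul (h2.pow_const 2)).inv
  have henergy : Integrable fun x : ℝ => symP n τ f g x * ‖γ x‖ ^ 2 := by
    refine ⟨(hms.mul (hγ.norm.pow 2).measurable).aestronglyMeasurable, ?_⟩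
    rw [hasFiniteIntegral_iff_ofReal (ae_of_all _ fun x => mul_nonneg (hsymP x) (by positivity))]
    refine lt_of_le_of_lt (lintegral_mono_ae ?_) hfin
    filter_upwards [hp, ae_stepFactor_ne_zero hτ] with x hx hs
    have h1 : 0 < ‖stepFactor τ x‖ := norm_pos_iff.2 hs
    rw [← ENNReal.ofReal_div_of_pos (by positivity)]
    refine ENNReal.ofReal_le_ofReal (le_of_eq ?_)
    rw [symP, commonDenom_eq]
    field_simp
  have hweight : Integrable fun x => ‖obsFunction n τ 0 x‖ ^ 2 * obsDensity n f g x :=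
    integrable_norm_sq_mul_obsDensity h (h.memLp_obsFunction n τ 0)
  -- the Cauchy-Schwarz inequality in the form `2 |γ| ≤ w |γ|² + 1 / w`
  have hint : Integrable fun x : ℝ => γ x := by
    refine (henergy.add hweight).mono' hγ.aestronglyMeasurable ?_
    filter_upwards [hp, ae_obsFunction_ne_zero n hτ 0] with x hx hb
    have h1 : 0 < ‖obsFunction n τ 0 x‖ := norm_pos_iff.2 hb
    rw [Pi.add_apply, symP_eq]
    set s := ‖obsFunction n τ 0 x‖ ^ 2 * obsDensity n f g x with hs
    have hs0 : 0 < s := by positivity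
    rw [mul_comm (obsDensity n f g x), ← hs]
    have h2 : 0 ≤ s⁻¹ * (‖γ x‖ - s) ^ 2 := by positivity
    have h3 : s⁻¹ * (‖γ x‖ - s) ^ 2 = s⁻¹ * ‖γ x‖ ^ 2 + s - 2 * ‖γ x‖ := by
      field_simp
      ring
    have h4 := norm_nonneg (γ x)
    linarith
  refine ⟨_, orthogonalToObs_energyToObs hτ h hp
    ⟨hint, fun t ht => timeFunction_eq_zero hα hγα hint ht, henergy⟩, fun hz => ?_⟩
  have hF : ∀ᵐ x : ℝ, False := by
    filter_upwards [hz, ae_weight_ne_zero hτ hp, ae_ne_zero_of_differentiable hd h0] with x h1 h2 h3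
    have h4 : conj (obsFunction n τ 0 x) ≠ 0 := (map_ne_zero _).2 h2.2
    exact div_ne_zero h3 (mul_ne_zero h2.1 h4) h1
  rw [ae_iff] at hF
  simp at hF

/-! ### The moduli of the spectral characteristic and of the error -/

lemma norm_hTau (hτ : τ ≠ 0) (n : ℕ) (a f g : ℝ → ℝ) (C : ℝ → ℂ) :
    ∀ᵐ x, ‖hTau n τ a f g C x‖ * (‖stepFactor τ x‖ ^ n * |commonDenom n f g x|)
      = ‖1 + I * (x : ℂ)‖ ^ n * numF n τ a g C x ∨ commonDenom n f g x = 0 := by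
  filter_upwards [ae_stepFactor_ne_zero hτ] with x hs
  by_cases hd : commonDenom n f g x = 0
  · exact Or.inr hd
  left
  have hd' : (commonDenom n f g x : ℂ) ≠ 0 := by exact_mod_cast hd
  have hs' := pow_ne_zero n hs
  rw [numF, ← norm_pow, ← norm_pow, ← Real.norm_eq_abs, ← norm_real (commonDenom n f g x),
    ← norm_mul, ← norm_mul, ← norm_mul]
  congr 1
  rw [hTau]
  field_simp

lemma norm_error (hτ : τ ≠ 0) (n : ℕ) (a f g : ℝ → ℝ) (C : ℝ → ℂ) :
    ∀ᵐ x, ‖specA a x - hTau n τ a f g C x * incRatio n x‖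
      * (‖stepFactor τ x‖ ^ n * |commonDenom n f g x|) = numG n τ a f C x
        ∨ commonDenom n f g x = 0 := by
  filter_upwards [ae_stepFactor_ne_zero hτ] with x hs
  by_cases hd : commonDenom n f g x = 0
  · exact Or.inr hd
  left
  have hd' : (commonDenom n f g x : ℂ) ≠ 0 := by exact_mod_cast hd
  have hs' := pow_ne_zero n hs
  have h1 := pow_ne_zero n (one_add_I_mul_ne_zero x)
  rw [numG, ← norm_pow, ← Real.norm_eq_abs, ← norm_real (commonDenom n f g x),
    ← norm_mul, ← norm_mul]
  congr 1
  have hdd : (commonDenom n f g x : ℂ)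
      = (1 + (x : ℂ) ^ 2) ^ n * f x + (x : ℂ) ^ (2 * n) * g x := by
    rw [commonDenom]
    push_cast
    rfl
  have hx : (-(I * (x : ℂ))) ^ n * (I * x) ^ n = (x : ℂ) ^ (2 * n) := by
    rw [← mul_pow, pow_mul]
    congr 1
    linear_combination (-(x : ℂ) ^ 2) * I_sq
  rw [hTau, incRatio]
  have key : (specA a x - (specA a x * (1 + I * x) ^ n * (-(I * x)) ^ n * g x / commonDenom n f g x
      - (1 + I * x) ^ n * (-(I * x)) ^ n * C x / (stepFactor τ x ^ n * commonDenom n f g x))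
      * ((I * x) ^ n / (1 + I * x) ^ n)) * (stepFactor τ x ^ n * commonDenom n f g x)
      = specA a x * stepFactor τ x ^ n * commonDenom n f g x
        - ((-(I * x)) ^ n * (I * x) ^ n) * (specA a x * stepFactor τ x ^ n * g x - C x) := by
    field_simp
  rw [key, hx, hdd]
  ring

end

/-! ### The extremum problem and the saddle point -/

section

variable {n : ℕ} {τ : ℝ} {a f g f₁ g₁ : ℝ → ℝ}

lemma obsDensity_mono (hf : ∀ x, f x ≤ f₁ x) (hg : ∀ x, g x ≤ g₁ x) (x : ℝ) :
    obsDensity n f g x ≤ obsDensity n f₁ g₁ x := by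
  rw [obsDensity_eq, obsDensity_eq]
  exact add_le_add (hf x) (mul_le_mul_of_nonneg_left (hg x) (by positivity))

lemma sqNormObs_mono (hf : ∀ x, f x ≤ f₁ x) (hg : ∀ x, g x ≤ g₁ x) (u : ℝ → ℂ) :
    sqNormObs n f g u ≤ sqNormObs n f₁ g₁ u :=
  lintegral_mono fun x => ENNReal.ofReal_le_ofReal
    (mul_le_mul_of_nonneg_left (obsDensity_mono hf hg x) (by positivity))

lemma L20_anti (hf : ∀ x, f x ≤ f₁ x) (hg : ∀ x, g x ≤ g₁ x) :
    L20 n τ f₁ g₁ ⊆ L20 n τ f g := by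
  rintro u ⟨h1, h2, h3⟩
  refine ⟨h1, (sqNormObs_mono hf hg u).trans_lt h2, fun ε hε => ?_⟩
  obtain ⟨c, hc, hlt⟩ := h3 ε hε
  exact ⟨c, hc, (sqNormObs_mono hf hg _).trans_lt hlt⟩

lemma IsMinimal.mono (hf : ∀ x, f x ≤ f₁ x) (hg : ∀ x, g x ≤ g₁ x) (h : IsMinimal n τ f g) :
    IsMinimal n τ f₁ g₁ := by
  obtain ⟨γ, α, h0, hd, he, hα, hγ, h1, h2⟩ := h
  refine ⟨γ, α, h0, hd, he, hα, hγ, lt_of_le_of_lt (lintegral_mono fun x => ?_) h1,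
    lt_of_le_of_lt (lintegral_mono fun x => ?_) h2⟩
  · exact ENNReal.div_le_div_left (ENNReal.ofReal_le_ofReal (obsDensity_mono hf hg x)) _
  · refine ENNReal.div_le_div_left (ENNReal.ofReal_le_ofReal ?_) _
    exact mul_le_mul_of_nonneg_left (obsDensity_mono hf hg x) (by positivity)

lemma mse_mono (hf : ∀ x, f x ≤ f₁ x) (hg : ∀ x, g x ≤ g₁ x) (u : ℝ → ℂ) :
    mse n a u f g ≤ mse n a u f₁ g₁ := by
  unfold mse
  gcongr with x x
  · exact hg x
  · exact hf x

lemma mse_congr {u v : ℝ → ℂ} (h : u =ᵐ[volume] v) (n : ℕ) (a f g : ℝ → ℝ) :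
    mse n a u f g = mse n a v f g := by
  unfold mse
  congr 2
  · refine lintegral_congr_ae ?_
    filter_upwards [h] with x hx
    rw [hx]
  · refine lintegral_congr_ae ?_
    filter_upwards [h] with x hx
    rw [hx]

/-- The densities `f`, `g` maximise the error of the optimal estimate for `f`, `g` among larger
densities of the class: the optimal estimate for the larger densities has on `f`, `g` at most the
error of the optimal one, and so coincides with it. -/
lemma mse_hTau_le_of_le {P₁ P₂ : ℝ} (hτ : 0 < τ) (ha : IntegrableOn a (Set.Ioi 0))
    (hfg : IsDensityPair f g) (hmin : IsMinimal n τ f g) {C : ℝ → ℂ}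
    (hC : IsInverseImage n τ a f g C)
    (hext : SolvesExtremumProblem n τ a (PowerClass P₁) (PowerClass P₂) f g C)
    (hf₁ : f₁ ∈ PowerClass P₁) (hg₁ : g₁ ∈ PowerClass P₂)
    (hf : ∀ x, f x ≤ f₁ x) (hg : ∀ x, g x ≤ g₁ x) :
    mse n a (hTau n τ a f g C) f₁ g₁ ≤ optMse n τ a f g := by
  have h₁ := isDensityPair_of_mem hf₁ hg₁
  have hmin₁ := hmin.mono hf hg
  have hp := hmin.ae_obsDensity_pos hfg
  have hp₁ := hmin₁.ae_obsDensity_pos h₁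
  obtain ⟨C₁, hC₁⟩ := exists_isInverseImage (n := n) hτ ha h₁ hp₁
  have hle : optMse n τ a f₁ g₁ ≤ optMse n τ a f g := by
    rw [hC.optMse_eq_ofReal hτ ha hfg hp, hC₁.optMse_eq_ofReal hτ ha h₁ hp₁]
    exact ENNReal.ofReal_le_ofReal (mul_le_mul_of_nonneg_left
      (hext _ hf₁ _ hg₁ hmin₁ _ hC₁) (by positivity))
  have h1 := hC₁.mse_hTau hτ ha h₁ hp₁
  have heq := ae_eq_of_mse_le_optMse ha hfg hp (hC.hTau_mem_L20 hτ ha hfg hp)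
    (hC.orthogonalToObs hτ.ne' hfg hp) (L20_anti hf hg (hC₁.hTau_mem_L20 hτ ha h₁ hp₁))
    ((mse_mono hf hg _).trans (h1.le.trans hle))
  rw [← mse_congr heq, h1]
  exact hle

/-- The error of an estimate for which the moduli of the spectral characteristic and of the error
are constant depends only on the powers of the densities. -/
lemma mse_of_norm_eq (hfg : IsDensityPair f g) {u : ℝ → ℂ} {α₁ α₂ : ℝ}
    (h1 : ∀ᵐ x, ‖specA a x - u x * incRatio n x‖ = α₁) (h2 : ∀ᵐ x, ‖u x‖ = α₂) :
    mse n a u f g = ENNReal.ofReal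
      (α₁ ^ 2 * ((2 * Real.pi)⁻¹ * ∫ x, g x) + α₂ ^ 2 * ((2 * Real.pi)⁻¹ * ∫ x, f x)) := by
  have e1 : ∫⁻ x, ENNReal.ofReal (‖specA a x - u x * incRatio n x‖ ^ 2 * g x)
      = ENNReal.ofReal (α₁ ^ 2 * ∫ x, g x) := by
    rw [← integral_const_mul, ofReal_integral_eq_lintegral_ofReal
      (hfg.integrable_noise.const_mul _)
      (ae_of_all _ fun x => mul_nonneg (sq_nonneg _) (hfg.noise_nonneg x))]
    refine lintegral_congr_ae ?_
    filter_upwards [h1] with x hx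
    rw [hx]
  have e2 : ∫⁻ x, ENNReal.ofReal (‖u x‖ ^ 2 * f x) = ENNReal.ofReal (α₂ ^ 2 * ∫ x, f x) := by
    rw [← integral_const_mul, ofReal_integral_eq_lintegral_ofReal
      (hfg.integrable_signal.const_mul _)
      (ae_of_all _ fun x => mul_nonneg (sq_nonneg _) (hfg.signal_nonneg x))]
    refine lintegral_congr_ae ?_
    filter_upwards [h2] with x hx
    rw [hx]
  have i1 : 0 ≤ ∫ x, g x := integral_nonneg hfg.noise_nonneg
  have i2 : 0 ≤ ∫ x, f x := integral_nonneg hfg.signal_nonneg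
  rw [mse, e1, e2, ← ENNReal.ofReal_add (by positivity) (by positivity),
    ← ENNReal.ofReal_mul (by positivity)]
  congr 1
  ring

/-- Every density of power at most `P` is bounded by one of power `P`. -/
lemma exists_le_of_mem_powerClass {P : ℝ} (hf : f ∈ PowerClass P) :
    ∃ f₁ ∈ PowerClass P, (∀ x, f x ≤ f₁ x) ∧ (2 * Real.pi)⁻¹ * ∫ x, f₁ x = P := by
  obtain ⟨hm, h0, hi, hP⟩ := hf
  have hπ := Real.pi_pos
  set δ := P - (2 * Real.pi)⁻¹ * ∫ x, f x with hδ
  have hδ0 : 0 ≤ δ := sub_nonneg.2 hP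
  have hint : Integrable fun x : ℝ => 2 * δ * (1 + x ^ 2)⁻¹ :=
    integrable_inv_one_add_sq.const_mul _
  have hpow : (2 * Real.pi)⁻¹ * ∫ x, (f x + 2 * δ * (1 + x ^ 2)⁻¹) = P := by
    rw [integral_add hi hint, integral_const_mul, integral_univ_inv_one_add_sq, hδ]
    field_simp
    ring
  refine ⟨fun x => f x + 2 * δ * (1 + x ^ 2)⁻¹, ⟨by fun_prop, fun x => ?_, hi.add hint, hpow.le⟩,
    fun x => ?_, hpow⟩
  · exact add_nonneg (h0 x) (by positivity)
  · exact le_add_of_nonneg_right (by positivity)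

end

/-! ### Transfer between families of vectors with proportional Gram matrices -/

section

variable {ι E F : Type*} [NormedAddCommGroup E] [InnerProductSpace ℂ E] [NormedAddCommGroup F]
  [InnerProductSpace ℂ F]

/-- `x` and `y` are limits of the same linear combinations, with indices in `s`, of the vectors
`v i` and of the vectors `w i`. -/
def IsGramPair (v : ι → E) (w : ι → F) (s : Set ι) (x : E) (y : F) : Prop :=
  ∀ ε : ℝ, 0 < ε → ∃ c ∈ Finsupp.supported ℂ ℂ s,
    ‖x - Finsupp.linearCombination ℂ v c‖ < ε ∧ ‖y - Finsupp.linearCombination ℂ w c‖ < ε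

variable {v : ι → E} {w : ι → F} {s : Set ι} {x : E} {y : F} {κ : ℝ}

lemma inner_self_eq_ofReal (x : E) : inner ℂ x x = ((‖x‖ ^ 2 : ℝ) : ℂ) := by
  rw [inner_self_eq_norm_sq_to_K]
  push_cast
  rfl

lemma IsGramPair.symm (h : IsGramPair v w s x y) : IsGramPair w v s y x := fun ε hε => by
  obtain ⟨c, hc, h1, h2⟩ := h ε hε
  exact ⟨c, hc, h2, h1⟩

lemma IsGramPair.exists_seq (h : IsGramPair v w s x y) :
    ∃ c : ℕ → ι →₀ ℂ, Tendsto (fun k => Finsupp.linearCombination ℂ v (c k)) atTop (𝓝 x) ∧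
      Tendsto (fun k => Finsupp.linearCombination ℂ w (c k)) atTop (𝓝 y) := by
  choose c _ h1 h2 using fun k : ℕ => h (1 / ((k : ℝ) + 1)) (by positivity)
  have h0 := tendsto_one_div_add_atTop_nhds_zero_nat (𝕜 := ℝ)
  refine ⟨c, tendsto_iff_norm_sub_tendsto_zero.2 ?_, tendsto_iff_norm_sub_tendsto_zero.2 ?_⟩
  · exact squeeze_zero (fun _ => norm_nonneg _) (fun k => by rw [norm_sub_rev]; exact (h1 k).le) h0
  · exact squeeze_zero (fun _ => norm_nonneg _) (fun k => by rw [norm_sub_rev]; exact (h2 k).le) h0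

lemma IsGramPair.right_mem (h : IsGramPair v w s x y) :
    y ∈ (Submodule.span ℂ (w '' s)).topologicalClosure := by
  rw [← SetLike.mem_coe, Submodule.topologicalClosure_coe, Metric.mem_closure_iff]
  intro ε hε
  obtain ⟨c, hc, -, h2⟩ := h ε hε
  exact ⟨_, (Finsupp.mem_span_image_iff_linearCombination ℂ).2 ⟨c, hc, rfl⟩, by rwa [dist_eq_norm]⟩

lemma inner_linearCombination_eq {x₀ : E} {y₀ : F}
    (h : ∀ i, inner ℂ (w i) y₀ = κ * inner ℂ (v i) x₀) (c : ι →₀ ℂ) :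
    inner ℂ (Finsupp.linearCombination ℂ w c) y₀
      = κ * inner ℂ (Finsupp.linearCombination ℂ v c) x₀ := by
  rw [Finsupp.linearCombination_apply, Finsupp.linearCombination_apply, Finsupp.sum, Finsupp.sum,
    sum_inner, sum_inner, Finset.mul_sum]
  refine Finset.sum_congr rfl fun i _ => ?_
  rw [inner_smul_left, inner_smul_left, h]
  ring

lemma norm_linearCombination_sq_eq
    (hG : ∀ i j, inner ℂ (w i) (w j) = κ * inner ℂ (v i) (v j)) (c : ι →₀ ℂ) :
    ‖Finsupp.linearCombination ℂ w c‖ ^ 2 = κ * ‖Finsupp.linearCombination ℂ v c‖ ^ 2 := by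
  have h1 : ∀ i, inner ℂ (w i) (Finsupp.linearCombination ℂ w c)
      = κ * inner ℂ (v i) (Finsupp.linearCombination ℂ v c) := by
    intro i
    rw [Finsupp.linearCombination_apply, Finsupp.linearCombination_apply, Finsupp.sum, Finsupp.sum,
      inner_sum, inner_sum, Finset.mul_sum]
    refine Finset.sum_congr rfl fun j _ => ?_
    rw [inner_smul_right, inner_smul_right, hG]
    ring
  have h2 := inner_linearCombination_eq h1 c
  rw [inner_self_eq_ofReal, inner_self_eq_ofReal] at h2
  exact_mod_cast h2

lemma IsGramPair.inner_eq (h : IsGramPair v w s x y) {x₀ : E} {y₀ : F}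
    (h₀ : ∀ i, inner ℂ (w i) y₀ = κ * inner ℂ (v i) x₀) : inner ℂ y y₀ = κ * inner ℂ x x₀ := by
  obtain ⟨c, h1, h2⟩ := h.exists_seq
  refine tendsto_nhds_unique (h2.inner tendsto_const_nhds) ?_
  simp_rw [inner_linearCombination_eq h₀]
  exact (h1.inner tendsto_const_nhds).const_mul _

lemma IsGramPair.norm_sq_eq (h : IsGramPair v w s x y)
    (hG : ∀ i j, inner ℂ (w i) (w j) = κ * inner ℂ (v i) (v j)) : ‖y‖ ^ 2 = κ * ‖x‖ ^ 2 := by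
  obtain ⟨c, h1, h2⟩ := h.exists_seq
  refine tendsto_nhds_unique (h2.norm.pow 2) ?_
  simp_rw [norm_linearCombination_sq_eq hG]
  exact (h1.norm.pow 2).const_mul _

/-- Distances from fixed vectors agree up to a constant. -/
lemma IsGramPair.norm_sub_sq_eq (h : IsGramPair v w s x y)
    (hG : ∀ i j, inner ℂ (w i) (w j) = κ * inner ℂ (v i) (v j)) {x₀ : E} {y₀ : F}
    (h₀ : ∀ i, inner ℂ (w i) y₀ = κ * inner ℂ (v i) x₀) :
    ‖y₀ - y‖ ^ 2 = ‖y₀‖ ^ 2 - κ * ‖x₀‖ ^ 2 + κ * ‖x - x₀‖ ^ 2 := by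
  have h1 := h.inner_eq h₀
  have h2 := h.norm_sq_eq hG
  rw [norm_sub_rev, norm_sub_sq (𝕜 := ℂ), norm_sub_sq (𝕜 := ℂ), h1, h2]
  simp
  ring

/-- If the Gram matrices of two families are proportional, every element of the closed span of one
family corresponds to an element of the closed span of the other. -/
lemma exists_isGramPair [CompleteSpace F] (hG : ∀ i j, inner ℂ (w i) (w j) = κ * inner ℂ (v i) (v j))
    (hx : x ∈ (Submodule.span ℂ (v '' s)).topologicalClosure) : ∃ y, IsGramPair v w s x y := by
  have hap : ∀ ε : ℝ, 0 < ε → ∃ c ∈ Finsupp.supported ℂ ℂ s,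
      ‖x - Finsupp.linearCombination ℂ v c‖ < ε := by
    intro ε hε
    rw [← SetLike.mem_coe, Submodule.topologicalClosure_coe, Metric.mem_closure_iff] at hx
    obtain ⟨z, hz, hlt⟩ := hx ε hε
    obtain ⟨c, hc, rfl⟩ := (Finsupp.mem_span_image_iff_linearCombination ℂ).1 hz
    exact ⟨c, hc, by rwa [← dist_eq_norm]⟩
  choose c hc h1 using fun k : ℕ => hap (1 / ((k : ℝ) + 1)) (by positivity)
  have h0 := tendsto_one_div_add_atTop_nhds_zero_nat (𝕜 := ℝ)
  have hlim : Tendsto (fun k => Finsupp.linearCombination ℂ v (c k)) atTop (𝓝 x) :=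
    tendsto_iff_norm_sub_tendsto_zero.2
      (squeeze_zero (fun _ => norm_nonneg _) (fun k => by rw [norm_sub_rev]; exact (h1 k).le) h0)
  have hnorm : ∀ k l, ‖Finsupp.linearCombination ℂ w (c k) - Finsupp.linearCombination ℂ w (c l)‖
      = √κ * ‖Finsupp.linearCombination ℂ v (c k) - Finsupp.linearCombination ℂ v (c l)‖ := by
    intro k l
    rw [← map_sub, ← map_sub, ← Real.sqrt_sq (norm_nonneg (Finsupp.linearCombination ℂ w _)),
      norm_linearCombination_sq_eq hG, Real.sqrt_mul' _ (sq_nonneg _), Real.sqrt_sq (norm_nonneg _)]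
  have hcau : CauchySeq fun k => Finsupp.linearCombination ℂ w (c k) := by
    rw [Metric.cauchySeq_iff]
    intro ε hε
    obtain ⟨N, hN⟩ := (Metric.cauchySeq_iff.1 hlim.cauchySeq) (ε / (√κ + 1)) (by positivity)
    refine ⟨N, fun k hk l hl => ?_⟩
    have := hN k hk l hl
    rw [dist_eq_norm] at this ⊢
    rw [hnorm]
    rw [lt_div_iff₀ (by positivity)] at this
    nlinarith [norm_nonneg (Finsupp.linearCombination ℂ v (c k)
      - Finsupp.linearCombination ℂ v (c l)), Real.sqrt_nonneg κ]
  obtain ⟨y, hy⟩ := cauchySeq_tendsto_of_complete hcau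
  refine ⟨y, fun ε hε => ?_⟩
  have e1 := (tendsto_iff_norm_sub_tendsto_zero.1 hlim).eventually_lt_const hε
  have e2 := (tendsto_iff_norm_sub_tendsto_zero.1 hy).eventually_lt_const hε
  obtain ⟨k, h3, h4⟩ := (e1.and e2).exists
  rw [norm_sub_rev] at h3 h4
  exact ⟨c k, hc k, h3, h4⟩

end

/-! ### The random processes -/

lemma norm_toLp_sq {Ω : Type*} [MeasurableSpace Ω] {ν : Measure Ω} {u : Ω → ℂ} (hu : MemLp u 2 ν) :
    ‖hu.toLp u‖ ^ 2 = ∫ x, ‖u x‖ ^ 2 ∂ν := by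
  have h1 : inner ℂ (hu.toLp u) (hu.toLp u) = ((∫ x, ‖u x‖ ^ 2 ∂ν : ℝ) : ℂ) := by
    rw [L2.inner_def, ← integral_complex_ofReal]
    refine integral_congr_ae ?_
    filter_upwards [hu.coeFn_toLp] with x hx
    rw [hx, RCLike.inner_apply, mul_conj']
    push_cast
    rfl
  rw [inner_self_eq_ofReal] at h1
  exact_mod_cast h1

lemma inner_toLp {Ω : Type*} [MeasurableSpace Ω] {ν : Measure Ω} {u v : Ω → ℂ} (hu : MemLp u 2 ν)
    (hv : MemLp v 2 ν) : inner ℂ (hu.toLp u) (hv.toLp v) = ∫ x, v x * conj (u x) ∂ν := by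
  rw [L2.inner_def]
  refine integral_congr_ae ?_
  filter_upwards [hu.coeFn_toLp, hv.coeFn_toLp] with x h1 h2
  rw [h1, h2, RCLike.inner_apply]

namespace IsSignalNoise

variable {Ω : Type*} [MeasurableSpace Ω] {μ : Measure Ω} {n : ℕ} {a f g : ℝ → ℝ}
  {ξ η : ℝ → Ω → ℂ}

/-- The noise as a curve in `L₂(Ω)`. -/
noncomputable def noiseLp (h : IsSignalNoise n f g μ ξ η) (t : ℝ) : Lp ℂ 2 μ :=
  (h.noise_memLp t).toLp _

/-- The increments of the signal as a curve in `L₂(Ω)`. -/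
noncomputable def signalIncLp (h : IsSignalNoise n f g μ ξ η) (τ t : ℝ) : Lp ℂ 2 μ :=
  (h.signal_memLp t τ).toLp _

/-- The increments of the noise as a curve in `L₂(Ω)`. -/
noncomputable def noiseIncLp (h : IsSignalNoise n f g μ ξ η) (τ t : ℝ) : Lp ℂ 2 μ :=
  ∑ l ∈ Finset.range (n + 1), ((-1) ^ l * (n.choose l : ℂ)) • h.noiseLp (t - l * τ)

/-- The increments of the observed process as a curve in `L₂(Ω)`. -/
noncomputable def obsIncLp (h : IsSignalNoise n f g μ ξ η) (τ t : ℝ) : Lp ℂ 2 μ :=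
  h.signalIncLp τ t + h.noiseIncLp τ t

/-- The frequency response `e^{ixt} (1 - e^{-ixτ})^n` of the increments. -/
noncomputable def incFunction (n : ℕ) (τ t x : ℝ) : ℂ :=
  exp (I * x * t) * (1 - exp (-(I * x * τ))) ^ n

lemma incFunction_eq_sum (n : ℕ) (τ t x : ℝ) : incFunction n τ t x
    = ∑ l ∈ Finset.range (n + 1), (-1) ^ l * (n.choose l : ℂ) * exp (I * x * (t - l * τ : ℝ)) := by
  rw [incFunction, sub_eq_neg_add, add_pow, Finset.mul_sum]
  refine Finset.sum_congr rfl fun l _ => ?_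
  have : exp (I * x * (t - l * τ : ℝ)) = exp (I * x * t) * exp (-(I * x * τ)) ^ l := by
    rw [← Complex.exp_nat_mul, ← Complex.exp_add]
    congr 1
    push_cast
    ring
  rw [this, one_pow, neg_pow]
  ring

lemma obsFunction_mul_incRatio (n : ℕ) (τ t : ℝ) {x : ℝ} (hx : x ≠ 0) :
    obsFunction n τ t x * incRatio n x = incFunction n τ t x := by
  have h1 := pow_ne_zero n (one_add_I_mul_ne_zero x)
  have h2 : (I * (x : ℂ)) ^ n ≠ 0 :=
    pow_ne_zero n (mul_ne_zero I_ne_zero (by exact_mod_cast hx))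
  rw [obsFunction, incRatio, incFunction]
  field_simp

lemma coeFn_obsIncLp (h : IsSignalNoise n f g μ ξ η) (τ t : ℝ) :
    (h.obsIncLp τ t : Ω → ℂ) =ᵐ[μ] increment n (observed ξ η) t τ := by
  have h1 : ∀ᵐ ω ∂μ, ∀ l ∈ Finset.range (n + 1),
      h.noiseLp (t - l * τ) ω = η (t - l * τ) ω :=
    (ae_ball_iff (Finset.range (n + 1)).countable_toSet).2 fun l _ => (h.noise_memLp _).coeFn_toLp
  filter_upwards [Lp.coeFn_add (h.signalIncLp τ t) (h.noiseIncLp τ t),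
    (h.signal_memLp t τ).coeFn_toLp, coeFn_sum_smul (Finset.range (n + 1))
      (fun l => (-1) ^ l * (n.choose l : ℂ)) (fun l => h.noiseLp (t - l * τ)), h1]
    with ω h2 h3 h4 h5
  rw [obsIncLp, h2, Pi.add_apply, signalIncLp, h3, noiseIncLp, h4]
  simp only [increment, observed, mul_add, Finset.sum_add_distrib]
  congr 1
  exact Finset.sum_congr rfl fun l hl => by rw [h5 l hl]

lemma obsSpace_eq (h : IsSignalNoise n f g μ ξ η) (τ : ℝ) :
    obsSpace n τ μ ξ η
      = (Submodule.span ℂ (h.obsIncLp τ '' Set.Iic 0)).topologicalClosure := by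
  rw [obsSpace]
  congr 2
  ext Y
  constructor
  · rintro ⟨t, ht, hY⟩
    exact ⟨t, ht, Lp.ext ((h.coeFn_obsIncLp τ t).trans hY.symm)⟩
  · rintro ⟨t, ht, rfl⟩
    exact ⟨t, ht, h.coeFn_obsIncLp τ t⟩

lemma inner_noiseLp (h : IsSignalNoise n f g μ ξ η) (s t : ℝ) :
    inner ℂ (h.noiseLp s) (h.noiseLp t)
      = ∫ x : ℝ, exp (I * x * t) * (conj (exp (I * x * s)) * ((2 * Real.pi : ℂ)⁻¹ * g x)) := by
  have h1 := h.covariance s (t - s)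
  rw [add_sub_cancel] at h1
  rw [noiseLp, noiseLp, inner_toLp, h1, ← integral_const_mul]
  refine integral_congr_ae (ae_of_all _ fun x => ?_)
  have : exp (I * x * (t - s : ℝ)) = exp (I * x * t) * conj (exp (I * x * s)) := by
    rw [← exp_conj, ← Complex.exp_add]
    congr 1
    simp only [map_mul, conj_I, conj_ofReal]
    push_cast
    ring
  simp only [this]
  ring

lemma integrable_conj_exp_mul_noise (hfg : IsDensityPair f g) (s : ℝ) :
    Integrable fun x : ℝ => conj (exp (I * x * s)) * ((2 * Real.pi : ℂ)⁻¹ * g x) := by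
  refine Integrable.bdd_mul (c := 1) (hfg.integrable_noise.ofReal.const_mul _)
    (continuous_conj.comp (by fun_prop)).aestronglyMeasurable (ae_of_all _ fun x => ?_)
  rw [RCLike.norm_conj, norm_exp_I_mul]

lemma norm_noiseLp (h : IsSignalNoise n f g μ ξ η) (t : ℝ) : ‖h.noiseLp t‖ = ‖h.noiseLp 0‖ := by
  have h1 : ∀ s, inner ℂ (h.noiseLp s) (h.noiseLp s)
      = ∫ x : ℝ, (2 * Real.pi : ℂ)⁻¹ * g x := by
    intro s
    rw [inner_noiseLp]
    refine integral_congr_ae (ae_of_all _ fun x => ?_)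
    simp only
    rw [← mul_assoc, mul_conj', norm_exp_I_mul]
    simp
  have h2 := (h1 t).trans (h1 0).symm
  rw [inner_self_eq_ofReal, inner_self_eq_ofReal] at h2
  have h3 : ‖h.noiseLp t‖ ^ 2 = ‖h.noiseLp 0‖ ^ 2 := by exact_mod_cast h2
  exact (pow_left_inj₀ (norm_nonneg _) (norm_nonneg _) two_ne_zero).1 h3

lemma continuous_noiseLp (h : IsSignalNoise n f g μ ξ η) (hfg : IsDensityPair f g) :
    Continuous h.noiseLp := by
  have hc : ∀ s, Continuous fun t => inner ℂ (h.noiseLp s) (h.noiseLp t) := by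
    intro s
    simp_rw [inner_noiseLp]
    have hi := integrable_conj_exp_mul_noise hfg s
    refine continuous_of_dominated
      (bound := fun x => ‖conj (exp (I * x * s)) * ((2 * Real.pi : ℂ)⁻¹ * g x)‖)
      (fun t => (integrable_exp_mul hi t).aestronglyMeasurable)
      (fun t => ae_of_all _ fun x => ?_) hi.norm (ae_of_all _ fun x => by fun_prop)
    rw [norm_mul, norm_exp_I_mul, one_mul]
  rw [continuous_iff_continuousAt]
  intro s
  rw [ContinuousAt, tendsto_iff_norm_sub_tendsto_zero]
  have hsq : Tendsto (fun t => ‖h.noiseLp t - h.noiseLp s‖ ^ 2) (𝓝 s) (𝓝 0) := by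
    have h1 : ∀ t, ‖h.noiseLp t - h.noiseLp s‖ ^ 2
        = 2 * ‖h.noiseLp s‖ ^ 2 - 2 * (inner ℂ (h.noiseLp s) (h.noiseLp t)).re := by
      intro t
      rw [norm_sub_rev, norm_sub_sq (𝕜 := ℂ), h.norm_noiseLp t, h.norm_noiseLp s]
      simp
      ring
    have h2 : Tendsto (fun t => 2 * ‖h.noiseLp s‖ ^ 2
        - 2 * (inner ℂ (h.noiseLp s) (h.noiseLp t)).re) (𝓝 s)
        (𝓝 (2 * ‖h.noiseLp s‖ ^ 2 - 2 * (inner ℂ (h.noiseLp s) (h.noiseLp s)).re)) :=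
      (((continuous_re.comp (hc s)).tendsto s).const_mul 2).const_sub _
    simp_rw [h1]
    convert h2 using 2
    rw [inner_self_eq_ofReal, ofReal_re]
    ring
  have := hsq.sqrt
  simpa [Real.sqrt_sq (norm_nonneg _)] using this

/-- The functional `∫₀^∞ a(t) η(-t) dt` as an integral in `L₂(Ω)`. -/
noncomputable def noiseFunctional (h : IsSignalNoise n f g μ ξ η) (a : ℝ → ℝ) : Lp ℂ 2 μ :=
  ∫ t in Set.Ioi (0 : ℝ), (a t : ℂ) • h.noiseLp (-t)

lemma integrableOn_smul_noiseLp (h : IsSignalNoise n f g μ ξ η) (hfg : IsDensityPair f g)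
    (ha : IntegrableOn a (Set.Ioi 0)) :
    IntegrableOn (fun t => (a t : ℂ) • h.noiseLp (-t)) (Set.Ioi 0) := by
  refine Integrable.smul_bdd (Integrable.ofReal (𝕜 := ℂ) ha) ‖h.noiseLp 0‖
    ((h.continuous_noiseLp hfg).comp continuous_neg).aestronglyMeasurable
    (ae_of_all _ fun t => ?_)
  rw [h.norm_noiseLp]

lemma isNoiseFunctional (h : IsSignalNoise n f g μ ξ η) (hfg : IsDensityPair f g)
    (ha : IntegrableOn a (Set.Ioi 0)) : IsNoiseFunctional a μ η (h.noiseFunctional a) :=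
  ⟨h.noiseLp, fun t => (h.noise_memLp t).coeFn_toLp, h.integrableOn_smul_noiseLp hfg ha, rfl⟩

/-- The spectral representation of inner products with the noise passes to the functional. -/
lemma inner_noiseFunctional (h : IsSignalNoise n f g μ ξ η) (hfg : IsDensityPair f g)
    (ha : IntegrableOn a (Set.Ioi 0)) {z : Lp ℂ 2 μ} {φ : ℝ → ℂ} (hφ : Integrable φ)
    (hz : ∀ t, inner ℂ z (h.noiseLp t) = ∫ x : ℝ, exp (I * x * t) * φ x) :
    inner ℂ z (h.noiseFunctional a) = ∫ x, specA a x * φ x := by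
  rw [noiseFunctional, ← integral_inner (h.integrableOn_smul_noiseLp hfg ha),
    ← integral_mul_integral_exp_neg ha hφ]
  refine integral_congr_ae (ae_of_all _ fun t => ?_)
  simp only
  rw [inner_smul_right, hz]
  congr 1
  refine integral_congr_ae (ae_of_all _ fun x => ?_)
  simp only
  rw [ofReal_neg, mul_neg]

lemma norm_noiseFunctional_sq (h : IsSignalNoise n f g μ ξ η) (hfg : IsDensityPair f g)
    (ha : IntegrableOn a (Set.Ioi 0)) :
    ‖h.noiseFunctional a‖ ^ 2 = (2 * Real.pi)⁻¹ * ∫ x, ‖specA a x‖ ^ 2 * g x := by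
  have h1 : ∀ s, inner ℂ (h.noiseFunctional a) (h.noiseLp s)
      = ∫ x : ℝ, exp (I * x * s) * (conj (specA a x) * ((2 * Real.pi : ℂ)⁻¹ * g x)) := by
    intro s
    rw [← inner_conj_symm, h.inner_noiseFunctional hfg ha (integrable_conj_exp_mul_noise hfg s)
      (h.inner_noiseLp s), ← integral_conj]
    refine integral_congr_ae (ae_of_all _ fun x => ?_)
    simp only [map_mul, conj_conj, map_inv₀, conj_ofReal, map_ofNat]
    ring
  have hi : Integrable fun x => conj (specA a x) * ((2 * Real.pi : ℂ)⁻¹ * g x) := by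
    refine Integrable.bdd_mul (c := ∫ t in Set.Ioi (0 : ℝ), ‖a t‖)
      (hfg.integrable_noise.ofReal.const_mul _)
      (continuous_conj.comp (continuous_specA ha)).aestronglyMeasurable (ae_of_all _ fun x => ?_)
    rw [RCLike.norm_conj]
    exact norm_specA_le x
  have h2 := h.inner_noiseFunctional hfg ha hi h1
  have h3 : ∫ x, specA a x * (conj (specA a x) * ((2 * Real.pi : ℂ)⁻¹ * g x))
      = (((2 * Real.pi)⁻¹ * ∫ x, ‖specA a x‖ ^ 2 * g x : ℝ) : ℂ) := by
    rw [← integral_const_mul, ← integral_complex_ofReal]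
    refine integral_congr_ae (ae_of_all _ fun x => ?_)
    simp only
    rw [← mul_assoc, mul_conj']
    push_cast
    ring
  rw [h3, inner_self_eq_ofReal] at h2
  exact_mod_cast h2

lemma inner_signalIncLp_noiseLp (h : IsSignalNoise n f g μ ξ η) (τ s t : ℝ) :
    inner ℂ (h.signalIncLp τ s) (h.noiseLp t) = 0 := by
  rw [← inner_conj_symm, signalIncLp, noiseLp, inner_toLp, h.uncorrelated, map_zero]

lemma integrable_conj_incFunction_mul_noise (hfg : IsDensityPair f g) (τ s : ℝ) :
    Integrable fun x : ℝ => conj (incFunction n τ s x) * ((2 * Real.pi : ℂ)⁻¹ * g x) := by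
  have hx : ∀ x : ℝ, conj (incFunction n τ s x) * ((2 * Real.pi : ℂ)⁻¹ * g x)
      = ∑ l ∈ Finset.range (n + 1), conj ((-1) ^ l * (n.choose l : ℂ))
        * (conj (exp (I * x * (s - l * τ : ℝ))) * ((2 * Real.pi : ℂ)⁻¹ * g x)) := by
    intro x
    rw [incFunction_eq_sum, map_sum, Finset.sum_mul]
    refine Finset.sum_congr rfl fun l _ => ?_
    rw [map_mul, mul_assoc]
  simp_rw [hx]
  exact integrable_finsetSum _ fun l _ =>
    (integrable_conj_exp_mul_noise hfg _).const_mul _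

lemma inner_noiseIncLp_noiseLp (h : IsSignalNoise n f g μ ξ η) (hfg : IsDensityPair f g)
    (τ s t : ℝ) :
    inner ℂ (h.noiseIncLp τ s) (h.noiseLp t) = ∫ x : ℝ, exp (I * x * t)
      * (conj (incFunction n τ s x) * ((2 * Real.pi : ℂ)⁻¹ * g x)) := by
  have hx : ∀ x : ℝ, exp (I * x * t) * (conj (incFunction n τ s x) * ((2 * Real.pi : ℂ)⁻¹ * g x))
      = ∑ l ∈ Finset.range (n + 1), conj ((-1) ^ l * (n.choose l : ℂ))
        * (exp (I * x * t) * (conj (exp (I * x * (s - l * τ : ℝ)))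
          * ((2 * Real.pi : ℂ)⁻¹ * g x))) := by
    intro x
    rw [incFunction_eq_sum, map_sum, Finset.sum_mul, Finset.mul_sum]
    refine Finset.sum_congr rfl fun l _ => ?_
    rw [map_mul]
    ring
  simp_rw [hx]
  rw [integral_finsetSum _ fun l _ =>
    (integrable_exp_mul (integrable_conj_exp_mul_noise hfg _) t).const_mul _, noiseIncLp, sum_inner]
  refine Finset.sum_congr rfl fun l _ => ?_
  rw [inner_smul_left, inner_noiseLp, integral_const_mul]

lemma inner_noiseIncLp (h : IsSignalNoise n f g μ ξ η) (hfg : IsDensityPair f g) (τ s t : ℝ) :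
    inner ℂ (h.noiseIncLp τ s) (h.noiseIncLp τ t) = ∫ x : ℝ, incFunction n τ t x
      * (conj (incFunction n τ s x) * ((2 * Real.pi : ℂ)⁻¹ * g x)) := by
  have hx : ∀ x : ℝ, incFunction n τ t x
      * (conj (incFunction n τ s x) * ((2 * Real.pi : ℂ)⁻¹ * g x))
      = ∑ l ∈ Finset.range (n + 1), ((-1) ^ l * (n.choose l : ℂ))
        * (exp (I * x * (t - l * τ : ℝ)) * (conj (incFunction n τ s x)
          * ((2 * Real.pi : ℂ)⁻¹ * g x))) := by
    intro x
    rw [incFunction_eq_sum n τ t, Finset.sum_mul]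
    refine Finset.sum_congr rfl fun l _ => ?_
    ring
  simp_rw [hx]
  rw [integral_finsetSum _ fun l _ =>
    (integrable_exp_mul (integrable_conj_incFunction_mul_noise hfg τ s) _).const_mul _]
  nth_rewrite 2 [noiseIncLp]
  rw [inner_sum]
  refine Finset.sum_congr rfl fun l _ => ?_
  rw [inner_smul_right, h.inner_noiseIncLp_noiseLp hfg, integral_const_mul]

lemma inner_signalIncLp (h : IsSignalNoise n f g μ ξ η) (τ s t : ℝ) :
    inner ℂ (h.signalIncLp τ s) (h.signalIncLp τ t) = ∫ x : ℝ, obsFunction n τ t x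
      * (conj (obsFunction n τ s x) * ((2 * Real.pi : ℂ)⁻¹ * f x)) := by
  have h1 := h.structural s (t - s) τ τ
  rw [add_sub_cancel] at h1
  rw [signalIncLp, signalIncLp, inner_toLp, h1, ← integral_const_mul]
  refine integral_congr_ae (ae_of_all _ fun x => ?_)
  have e1 : exp (I * x * (t - s : ℝ)) = exp (I * x * t) * exp (-(I * x * s)) := by
    rw [← Complex.exp_add]
    congr 1
    push_cast
    ring
  have e2 : (1 + (x : ℂ) ^ 2) ^ n / (x : ℂ) ^ (2 * n)
      = (1 + I * (x : ℂ)) ^ n / (I * x) ^ n * ((1 - I * x) ^ n / (-(I * x)) ^ n) := by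
    rw [div_mul_div_comm, ← mul_pow, one_add_I_mul_conj, ← mul_pow, pow_mul]
    congr 2
    linear_combination (x : ℂ) ^ 2 * I_sq
  have e3 : conj (obsFunction n τ s x) = exp (-(I * x * s)) * (1 - exp (I * x * τ)) ^ n
      * ((1 - I * x) ^ n / (-(I * x)) ^ n) := by
    simp only [obsFunction, map_mul, map_pow, map_sub, map_one, ← exp_conj, map_neg, conj_I,
      conj_ofReal, map_div₀, neg_mul, neg_neg, map_add, ← sub_eq_add_neg]
  simp only
  rw [e1, e2, e3, obsFunction]
  ring

/-- The increments of the observations and the functions `obsFunction n τ t` have proportional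
Gram matrices. -/
lemma inner_obsIncLp (h : IsSignalNoise n f g μ ξ η) (hfg : IsDensityPair f g) (τ s t : ℝ) :
    inner ℂ (h.obsIncLp τ s) (h.obsIncLp τ t)
      = ((2 * Real.pi)⁻¹ : ℝ) * inner ℂ (obsLp n τ hfg s) (obsLp n τ hfg t) := by
  have h1 : inner ℂ (h.signalIncLp τ s) (h.noiseIncLp τ t) = 0 := by
    rw [noiseIncLp, inner_sum]
    refine Finset.sum_eq_zero fun l _ => ?_
    rw [inner_smul_right, h.inner_signalIncLp_noiseLp, mul_zero]
  have h2 : inner ℂ (h.noiseIncLp τ s) (h.signalIncLp τ t) = 0 := by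
    rw [noiseIncLp, sum_inner]
    refine Finset.sum_eq_zero fun l _ => ?_
    rw [inner_smul_left, ← inner_conj_symm, h.inner_signalIncLp_noiseLp, map_zero, mul_zero]
  have hfi : Integrable fun x : ℝ => obsFunction n τ t x
      * (conj (obsFunction n τ s x) * ((2 * Real.pi : ℂ)⁻¹ * f x)) := by
    refine Integrable.bdd_mul (c := (|τ| + 2) ^ n) (Integrable.bdd_mul (c := (|τ| + 2) ^ n)
      (hfg.integrable_signal.ofReal.const_mul _) ?_ (ae_of_all _ fun x => ?_))
      (measurable_obsFunction n τ t).aestronglyMeasurable (ae_of_all _ (norm_obsFunction_le n τ t))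
    · exact (measurable_conj_obsFunction n τ s).aestronglyMeasurable
    · rw [RCLike.norm_conj]
      exact norm_obsFunction_le n τ s x
  have hgi : Integrable fun x : ℝ => incFunction n τ t x
      * (conj (incFunction n τ s x) * ((2 * Real.pi : ℂ)⁻¹ * g x)) := by
    refine Integrable.bdd_mul (c := 2 ^ n) (integrable_conj_incFunction_mul_noise hfg τ s) ?_
      (ae_of_all _ fun x => ?_)
    · unfold incFunction
      fun_prop
    · rw [incFunction, norm_mul, norm_exp_I_mul, one_mul, norm_pow]
      exact pow_le_pow_left₀ (norm_nonneg _) (norm_one_sub_exp_le_two x τ) n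
  rw [obsIncLp, obsIncLp, inner_add_left, inner_add_right, inner_add_right, h1, h2, add_zero,
    zero_add, h.inner_signalIncLp, h.inner_noiseIncLp hfg, ← integral_add hfi hgi, obsLp, obsLp,
    integral_conj_mul_eq_inner, hfg.integral_obsMeasure, ← integral_const_mul]
  refine integral_congr_ae ?_
  filter_upwards [ae_ne_zero] with x hx
  rw [← obsFunction_mul_incRatio n τ t hx, ← obsFunction_mul_incRatio n τ s hx, obsDensity_eq]
  push_cast
  rw [← mul_conj', map_mul]
  ring

lemma inner_obsIncLp_noiseFunctional (h : IsSignalNoise n f g μ ξ η) (hfg : IsDensityPair f g)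
    (hp : ∀ x, obsDensity n f g x = 0 → ‖incRatio n x‖ ^ 2 * g x = 0)
    (ha : IntegrableOn a (Set.Ioi 0)) (τ s : ℝ) :
    inner ℂ (h.obsIncLp τ s) (h.noiseFunctional a)
      = ((2 * Real.pi)⁻¹ : ℝ) * inner ℂ (obsLp n τ hfg s)
        ((memLp_targetFunction ha hfg).toLp (targetFunction n a f g)) := by
  have h1 : ∀ t, inner ℂ (h.obsIncLp τ s) (h.noiseLp t) = ∫ x : ℝ, exp (I * x * t)
      * (conj (incFunction n τ s x) * ((2 * Real.pi : ℂ)⁻¹ * g x)) := by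
    intro t
    rw [obsIncLp, inner_add_left, h.inner_signalIncLp_noiseLp, zero_add,
      h.inner_noiseIncLp_noiseLp hfg]
  rw [h.inner_noiseFunctional hfg ha (integrable_conj_incFunction_mul_noise hfg τ s) h1, obsLp,
    integral_conj_mul_eq_inner, hfg.integral_obsMeasure, ← integral_const_mul]
  refine integral_congr_ae ?_
  filter_upwards [ae_ne_zero] with x hx
  rw [← obsFunction_mul_incRatio n τ s hx, targetFunction, map_mul]
  by_cases hpx : obsDensity n f g x = 0
  · have hg : g x = 0 :=
      (mul_eq_zero.1 (hp x hpx)).resolve_left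
        (pow_ne_zero 2 (norm_ne_zero_iff.2 (incRatio_ne_zero n hx)))
    simp [hg]
  · have hpx' : (obsDensity n f g x : ℂ) ≠ 0 := by exact_mod_cast hpx
    push_cast
    field_simp

end IsSignalNoise

/-! ### Mean-square errors of the estimates -/

section

variable {n : ℕ} {τ : ℝ} {a f g : ℝ → ℝ}

lemma integral_norm_specA_sq_mul_noise (ha : IntegrableOn a (Set.Ioi 0)) (hfg : IsDensityPair f g) :
    ∫ x, ‖specA a x‖ ^ 2 * g x
      = residualError n a f g + ∫ x, ‖targetFunction n a f g x‖ ^ 2 ∂(obsMeasure n f g) := by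
  rw [residualError, hfg.integral_obsMeasure_real,
    ← integral_add (integrable_norm_specA_sq_mul ha (integrable_symQ hfg))
      (integrable_norm_sq_mul_obsDensity hfg (memLp_targetFunction ha hfg))]
  refine integral_congr_ae ?_
  filter_upwards [ae_ne_zero] with x hx
  have h1 := sq_error_eq (a := a) (n := n) hfg (fun _ => 0) hx
  simpa using h1

namespace IsSignalNoise

variable {Ω : Type*} [MeasurableSpace Ω] {μ : Measure Ω} {ξ η : ℝ → Ω → ℂ}

/-- The error of an estimate is that of its spectral characteristic. -/
lemma eLpNorm_noiseFunctional_sub (h : IsSignalNoise n f g μ ξ η) (hfg : IsDensityPair f g)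
    (ha : IntegrableOn a (Set.Ioi 0)) {u : ℝ → ℂ} (hm : AEStronglyMeasurable u)
    (hu : MemLp u 2 (obsMeasure n f g)) {X : Lp ℂ 2 μ}
    (hX : IsGramPair (obsLp n τ hfg) (h.obsIncLp τ) (Set.Iic 0) (hu.toLp u) X) :
    eLpNorm (fun ω => h.noiseFunctional a ω - X ω) 2 μ ^ 2 = mse n a u f g := by
  have hp : ∀ x, obsDensity n f g x = 0 → ‖incRatio n x‖ ^ 2 * g x = 0 := fun x hx =>
    le_antisymm (hx ▸ hfg.noise_le_obsDensity n x)
      (mul_nonneg (sq_nonneg _) (hfg.noise_nonneg x))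
  have hv := memLp_targetFunction (n := n) ha hfg
  have h1 := hX.norm_sub_sq_eq (h.inner_obsIncLp hfg τ)
    (h.inner_obsIncLp_noiseFunctional hfg hp ha τ)
  rw [← MemLp.toLp_sub, norm_toLp_sq, norm_toLp_sq, h.norm_noiseFunctional_sq hfg ha,
    integral_norm_specA_sq_mul_noise ha hfg] at h1
  have h2 : eLpNorm (fun ω => h.noiseFunctional a ω - X ω) 2 μ
      = ENNReal.ofReal ‖h.noiseFunctional a - X‖ := by
    rw [Lp.norm_def, ENNReal.ofReal_toReal (Lp.eLpNorm_ne_top _)]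
    exact eLpNorm_congr_ae (Lp.coeFn_sub _ _).symm
  rw [h2, ← ENNReal.ofReal_pow (norm_nonneg _), h1, mse_eq ha hfg hm hu, sqDistTarget]
  congr 1
  simp only [Pi.sub_apply]
  ring

lemma coeFn_linearCombination_obsIncLp (h : IsSignalNoise n f g μ ξ η) (τ : ℝ) (c : ℝ →₀ ℂ) :
    (Finsupp.linearCombination ℂ (h.obsIncLp τ) c : Ω → ℂ) =ᵐ[μ]
      fun ω => c.sum fun t z => z * increment n (observed ξ η) t τ ω := by
  rw [Finsupp.linearCombination_apply]
  unfold Finsupp.sum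
  have h1 : ∀ᵐ ω ∂μ, ∀ t ∈ c.support, h.obsIncLp τ t ω = increment n (observed ξ η) t τ ω :=
    (ae_ball_iff c.support.countable_toSet).2 fun t _ => h.coeFn_obsIncLp τ t
  filter_upwards [coeFn_sum_smul c.support c (h.obsIncLp τ), h1] with ω h2 h3
  rw [h2]
  exact Finset.sum_congr rfl fun t ht => by rw [h3 t ht]

lemma hasSpectralCharacteristic (h : IsSignalNoise n f g μ ξ η) (hfg : IsDensityPair f g)
    {u : ℝ → ℂ} (hu : MemLp u 2 (obsMeasure n f g)) {X : Lp ℂ 2 μ}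
    (hX : IsGramPair (obsLp n τ hfg) (h.obsIncLp τ) (Set.Iic 0) (hu.toLp u) X) :
    HasSpectralCharacteristic n τ f g μ ξ η u X := by
  intro ε hε
  obtain ⟨δ, hδ0, hδ, hδ'⟩ := exists_ofReal_pow_lt hε
  obtain ⟨c, hc, h1, h2⟩ := hX δ hδ0
  refine ⟨c, fun t ht => (Finsupp.mem_supported ℂ c).1 hc ht, ?_, ?_⟩
  · rw [sqNormObs_sub_obsComb hfg hu]
    refine lt_of_le_of_lt ?_ hδ
    gcongr
  · have h3 : eLpNorm (fun ω => X ω - c.sum fun t z => z * increment n (observed ξ η) t τ ω) 2 μ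
        = ENNReal.ofReal ‖X - Finsupp.linearCombination ℂ (h.obsIncLp τ) c‖ := by
      rw [Lp.norm_def, ENNReal.ofReal_toReal (Lp.eLpNorm_ne_top _)]
      refine eLpNorm_congr_ae ?_
      filter_upwards [Lp.coeFn_sub X (Finsupp.linearCombination ℂ (h.obsIncLp τ) c),
        h.coeFn_linearCombination_obsIncLp τ c] with ω h4 h5
      rw [h4, Pi.sub_apply, h5]
    rw [h3]
    refine lt_of_le_of_lt ?_ hδ'
    gcongr

lemma exists_estimate (h : IsSignalNoise n f g μ ξ η) (hfg : IsDensityPair f g)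
    (ha : IntegrableOn a (Set.Ioi 0)) {u : ℝ → ℂ} (hu : u ∈ L20 n τ f g) :
    ∃ X ∈ obsSpace n τ μ ξ η, HasSpectralCharacteristic n τ f g μ ξ η u X ∧
      eLpNorm (fun ω => h.noiseFunctional a ω - X ω) 2 μ ^ 2 = mse n a u f g := by
  have hL := memLp_of_mem_L20 hfg hu
  obtain ⟨X, hX⟩ := exists_isGramPair (h.inner_obsIncLp hfg τ)
    ((mem_L20_iff_mem_obsSubmodule hfg hu.1 hL).1 hu)
  refine ⟨X, ?_, h.hasSpectralCharacteristic hfg hL hX,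
    h.eLpNorm_noiseFunctional_sub hfg ha hu.1 hL hX⟩
  rw [h.obsSpace_eq]
  exact hX.right_mem

/-- Every linear estimate has a spectral characteristic. -/
lemma exists_mse_eq (h : IsSignalNoise n f g μ ξ η) (hfg : IsDensityPair f g)
    (ha : IntegrableOn a (Set.Ioi 0)) {X : Lp ℂ 2 μ} (hX : X ∈ obsSpace n τ μ ξ η) :
    ∃ u ∈ L20 n τ f g,
      eLpNorm (fun ω => h.noiseFunctional a ω - X ω) 2 μ ^ 2 = mse n a u f g := by
  rw [h.obsSpace_eq] at hX
  have hG : ∀ s t, inner ℂ (obsLp n τ hfg s) (obsLp n τ hfg t)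
      = ((2 * Real.pi : ℝ) : ℂ) * inner ℂ (h.obsIncLp τ s) (h.obsIncLp τ t) := by
    intro s t
    rw [h.inner_obsIncLp hfg, ← mul_assoc, ← ofReal_mul, mul_inv_cancel₀ (by positivity),
      ofReal_one, one_mul]
  obtain ⟨k, hk⟩ := exists_isGramPair hG hX
  -- a representative measurable with respect to Lebesgue measure, not only to `p dx`
  have hm : AEStronglyMeasurable (k : ℝ → ℂ) := (Lp.stronglyMeasurable k).aestronglyMeasurable
  have hL := Lp.memLp k
  have hkL : hL.toLp k = k := Lp.toLp_coeFn k hL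
  refine ⟨k, (mem_L20_iff_mem_obsSubmodule hfg hm hL).2 (by rw [hkL]; exact hk.right_mem),
    h.eLpNorm_noiseFunctional_sub hfg ha hm hL (τ := τ) ?_⟩
  rw [hkL]
  exact hk.symm

lemma iInf_eLpNorm_eq_optMse (h : IsSignalNoise n f g μ ξ η) (hfg : IsDensityPair f g)
    (ha : IntegrableOn a (Set.Ioi 0)) :
    (⨅ X ∈ obsSpace n τ μ ξ η, eLpNorm (fun ω => h.noiseFunctional a ω - X ω) 2 μ ^ 2)
      = optMse n τ a f g := by
  refine le_antisymm (le_iInf₂ fun u hu => ?_) (le_iInf₂ fun X hX => ?_)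
  · obtain ⟨X, hX, -, he⟩ := h.exists_estimate hfg ha hu
    exact (iInf₂_le X hX).trans he.le
  · obtain ⟨u, hu, he⟩ := h.exists_mse_eq hfg ha hX
    exact (iInf₂_le u hu).trans he.ge

end IsSignalNoise

end

/-! ### The least favorable densities -/

lemma norm_hTau_eq_of_numF_eq {n : ℕ} {τ : ℝ} {a f g : ℝ → ℝ} {C : ℝ → ℂ} {α : ℝ} (hτ : τ ≠ 0)
    (hp : ∀ᵐ x, 0 < obsDensity n f g x)
    (h : ∀ᵐ x : ℝ, numF n τ a g C x
      = α * ‖stepFactor τ x‖ ^ n * (‖1 - I * x‖ ^ n)⁻¹ * commonDenom n f g x) :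
    ∀ᵐ x, ‖hTau n τ a f g C x‖ = α := by
  filter_upwards [hp, h, norm_hTau hτ n a f g C, ae_stepFactor_ne_zero hτ] with x hx h1 h2 hs
  have hd : 0 < commonDenom n f g x := by
    rw [commonDenom_eq]
    positivity
  have hs' : 0 < ‖stepFactor τ x‖ := norm_pos_iff.2 hs
  have hq : 0 < ‖1 + I * (x : ℂ)‖ := norm_pos_iff.2 (one_add_I_mul_ne_zero x)
  have h3 := h2.resolve_right hd.ne'
  rw [h1, norm_one_sub_I_mul, abs_of_pos hd] at h3
  refine mul_right_cancel₀ (b := ‖stepFactor τ x‖ ^ n * commonDenom n f g x) (by positivity) ?_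
  rw [h3]
  field_simp

lemma norm_error_eq_of_numG_eq {n : ℕ} {τ : ℝ} {a f g : ℝ → ℝ} {C : ℝ → ℂ} {α : ℝ} (hτ : τ ≠ 0)
    (hp : ∀ᵐ x, 0 < obsDensity n f g x)
    (h : ∀ᵐ x : ℝ, numG n τ a f C x = α * ‖stepFactor τ x‖ ^ n * commonDenom n f g x) :
    ∀ᵐ x, ‖specA a x - hTau n τ a f g C x * incRatio n x‖ = α := by
  filter_upwards [hp, h, norm_error hτ n a f g C, ae_stepFactor_ne_zero hτ] with x hx h1 h2 hs
  have hd : 0 < commonDenom n f g x := by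
    rw [commonDenom_eq]
    positivity
  have hs' : 0 < ‖stepFactor τ x‖ := norm_pos_iff.2 hs
  have h3 := h2.resolve_right hd.ne'
  rw [h1, abs_of_pos hd] at h3
  refine mul_right_cancel₀ (b := ‖stepFactor τ x‖ ^ n * commonDenom n f g x) (by positivity) ?_
  rw [h3, mul_assoc]

end IncrementFiltering

open IncrementFiltering in
theorem theorem4 (n : ℕ) (hn : 1 ≤ n) (τ : ℝ) (hτ : 0 < τ) (P₁ P₂ : ℝ)
    (a : ℝ → ℝ) (ha : IntegrableOn a (Set.Ioi 0)) (haτ : ATauCondition n τ a)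
    (f0 g0 : ℝ → ℝ) (hf0 : f0 ∈ PowerClass P₁) (hg0 : g0 ∈ PowerClass P₂)
    (hmin : IsMinimal n τ f0 g0)
    -- the spectrum of `P⁻¹ S a_τ` for the densities `f0`, `g0`
    (C0 : ℝ → ℂ) (hC0 : IsInverseImage n τ a f0 g0 C0)
    (hbf : EssBounded (hTauF n τ a f0 g0 C0)) (hbg : EssBounded (hTauG n τ a f0 g0 C0))
    (α₁ α₂ : ℝ) (hα₁ : 0 ≤ α₁) (hα₂ : 0 ≤ α₂)
    (heq1 : ∀ᵐ x : ℝ, numG n τ a f0 C0 x =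
      α₁ * ‖stepFactor τ x‖ ^ n * commonDenom n f0 g0 x)
    (heq2 : ∀ᵐ x : ℝ, numF n τ a g0 C0 x =
      α₂ * ‖stepFactor τ x‖ ^ n * (‖1 - Complex.I * x‖ ^ n)⁻¹ * commonDenom n f0 g0 x)
    (hext : SolvesExtremumProblem n τ a (PowerClass P₁) (PowerClass P₂) f0 g0 C0) :
    IsLeastFavorable n τ a (PowerClass P₁) (PowerClass P₂) f0 g0 ∧
    IsOptimal n τ a f0 g0 (hTau n τ a f0 g0 C0) ∧
    IsMinimaxRobust n τ a (PowerClass P₁) (PowerClass P₂) (hTau n τ a f0 g0 C0) ∧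
    worstMse n a (PowerClass P₁) (PowerClass P₂) (hTau n τ a f0 g0 C0) = optMse n τ a f0 g0 ∧
    -- `mse` and `optMse` are the mean-square errors for the random processes themselves
    (∀ f ∈ PowerClass P₁, ∀ g ∈ PowerClass P₂,
      ∀ {Ω : Type*} [MeasurableSpace Ω] (μ : Measure Ω) [IsProbabilityMeasure μ]
        (ξ η : ℝ → Ω → ℂ), IsSignalNoise n f g μ ξ η →
      ∃ Y : Lp ℂ 2 μ, IsNoiseFunctional a μ η Y ∧
        (⨅ X ∈ obsSpace n τ μ ξ η, eLpNorm (fun ω => Y ω - X ω) 2 μ ^ 2) = optMse n τ a f g ∧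
        ∀ h ∈ L20 n τ f g, ∃ X ∈ obsSpace n τ μ ξ η,
          HasSpectralCharacteristic n τ f g μ ξ η h X ∧
          eLpNorm (fun ω => Y ω - X ω) 2 μ ^ 2 = mse n a h f g) := by

  have hfg := isDensityPair_of_mem hf0 hg0
  have hp := hmin.ae_obsDensity_pos hfg
  have hnorm := norm_hTau_eq_of_numF_eq hτ.ne' hp heq2
  have herr := norm_error_eq_of_numG_eq hτ.ne' hp heq1
  have hL := hC0.hTau_mem_L20 hτ ha hfg hp
  have hopt := hC0.mse_hTau hτ ha hfg hp
  set h0 := hTau n τ a f0 g0 C0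
  -- the densities are replaced by larger ones that exhaust the power bounds
  obtain ⟨f₁, hf₁, hff, hP₁⟩ := exists_le_of_mem_powerClass hf0
  obtain ⟨g₁, hg₁, hgg, hP₂⟩ := exists_le_of_mem_powerClass hg0
  have hbound : ∀ f ∈ PowerClass P₁, ∀ g ∈ PowerClass P₂,
      mse n a h0 f g ≤ optMse n τ a f0 g0 := by
    intro f hf g hg
    refine le_trans ?_ (mse_hTau_le_of_le hτ ha hfg hmin hC0 hext hf₁ hg₁ hff hgg)
    rw [mse_of_norm_eq (isDensityPair_of_mem hf hg) herr hnorm,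
      mse_of_norm_eq (isDensityPair_of_mem hf₁ hg₁) herr hnorm, hP₁, hP₂]
    gcongr
    · exact hg.2.2.2
    · exact hf.2.2.2
  have hadm : h0 ∈ admissible n τ (PowerClass P₁) (PowerClass P₂) := fun f hf g hg =>
    mem_L20_of_bounded hτ hfg hp (hmin.exists_orthogonalToObs hτ.ne' hfg) hL
      (hnorm.mono fun x hx => hx.le) (isDensityPair_of_mem hf hg)
  have hworst : worstMse n a (PowerClass P₁) (PowerClass P₂) h0 = optMse n τ a f0 g0 := by
    refine le_antisymm (iSup₂_le fun f hf => iSup₂_le fun g hg => hbound f hf g hg) ?_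
    rw [← hopt]
    exact le_iSup₂_of_le f0 hf0 (le_iSup₂_of_le g0 hg0 le_rfl)
  refine ⟨⟨hf0, hg0, fun f hf g hg => ?_⟩, ⟨hL, hopt⟩, ⟨hadm, ?_, ⟨f0, hf0, g0, hg0, ?_⟩,
    fun h' hh' => ?_⟩, hworst, ?_⟩
  · exact (iInf₂_le h0 (hadm f hf g hg)).trans (hbound f hf g hg)
  · rw [hworst, hC0.optMse_eq_ofReal hτ ha hfg hp]
    exact ENNReal.ofReal_lt_top
  · rw [hworst, hopt]
  · rw [hworst]
    exact (iInf₂_le h' (hh' f0 hf0 g0 hg0)).trans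
      (le_iSup₂_of_le f0 hf0 (le_iSup₂_of_le g0 hg0 le_rfl))
  · intro f hf g hg Ω _ μ _ ξ η h
    have hd := isDensityPair_of_mem hf hg
    exact ⟨h.noiseFunctional a, h.isNoiseFunctional hd ha, h.iInf_eLpNorm_eq_optMse hd ha,
      fun u hu => h.exists_estimate hd ha hu⟩
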